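/- Let $\ell$ be a prime. For $A=\mathbb{Z}$ (discrete) or $A=\mathbb{Z}_\ell$ (the $\ell$-adic integers with the profinite topology), let $A^\bullet$ be the cosimplicial topological abelian group with $A^n=A\cdot e_{0\to1}\oplus\dots\oplus A\cdot e_{n-1\to n}\cong H_1(\Delta^n/(\Delta^n)_0;A)$, where $(\Delta^n)_0$ is the set of vertices, in which an order-preserving map $f:[n]\to[m]$ sends $e_{i\to i+1}$ to $e_{f(i)\to f(i+1)}:=\sum_{f(i)\le j<f(i+1)}e_{j\to j+1}$. For a discrete group $H$ let $B(A,H)=|\operatorname{Hom}(A^\bullet,H)|$ be the geometric realization of the simplicial set whose $n$-simplices are the continuous homomorphisms $A^n\to H$. The completion map $\mathbb{Z}\to\mathbb{Z}_\ell$ induces, by precomposition, a natural map $B(\mathbb{Z}_\ell,H)\to B(\mathbb{Z},H)$. Suppose that $H$ is locally finite, that is, $H=\operatorname{colim}_i H_i$ is a filtered colimit of finite groups $H_i$. Then the natural map $$B(\mathbb{Z}_\ell,H)\longrightarrow B(\mathbb{Z},H)$$ is a mod-$\ell$ equivalence, i.e. it induces an isomorphism $H_n(B(\mathbb{Z}_\ell,H);\mathbb{Z}/\ell)\to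 H_n(B(\mathbb{Z},H);\mathbb{Z}/\ell)$ on singular homology for every $n\ge 0$. -/

import Mathlib

open CategoryTheory CategoryTheory.Limits

universe u

noncomputable section

namespace CommClassifying

/-- The action of an order-preserving map `f : [n] → [m]` on the reduced free abelian cosimplicial
group `A^n = H₁(Δⁿ/(Δⁿ)₀; A)`, written in the ordered basis `e_{0→1}, …, e_{n-1→n}`.
The `i`-th basis vector `e_{i→i+1}` goes to `e_{f(i)→f(i+1)}`, which is the sum of all
`e_{j→j+1}` with `f(i) ≤ j` and `j + 1 ≤ f(i+1)`. -/
def pushforward (A : Type*) [AddCommMonoid A] {n m : ℕ} (f : Fin (n + 1) →o Fin (m + 1)) :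
    (Fin n → A) →+ (Fin m → A) where
  toFun a j := ∑ i : Fin n, if f i.castSucc ≤ j.castSucc ∧ j.succ ≤ f i.succ then a i else 0
  map_zero' := by ext j; simp
  map_add' a b := by
    ext j
    simp only [Pi.add_apply, ← Finset.sum_add_distrib]
    exact Finset.sum_congr rfl fun i _ => by split_ifs <;> simp

theorem pushforward_apply (A : Type*) [AddCommMonoid A] {n m : ℕ}
    (f : Fin (n + 1) →o Fin (m + 1)) (a : Fin n → A) (j : Fin m) :
    pushforward A f a j =
      ∑ i : Fin n, if f i.castSucc ≤ j.castSucc ∧ j.succ ≤ f i.succ then a i else 0 := rfl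

theorem pushforward_id (A : Type*) [AddCommMonoid A] {n : ℕ} (a : Fin n → A) :
    pushforward A (OrderHom.id : Fin (n + 1) →o Fin (n + 1)) a = a := by
  ext j
  rw [pushforward_apply, Finset.sum_eq_single j]
  · simp
  · intro i _ hij
    refine if_neg ?_
    simp only [OrderHom.id_coe, id_eq, Fin.le_def, Fin.val_castSucc, Fin.val_succ]
    intro h
    exact hij (Fin.ext (by omega))
  · simp

/-- For a monotone sequence, `[u s, u t)` is the disjoint union of the `[u j, u (j+1))`. -/
theorem exists_step {m p : ℕ} (g : Fin (m + 1) →o Fin (p + 1)) (k : Fin p) (s t : Fin (m + 1))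
    (hs : g s ≤ k.castSucc) (ht : k.succ ≤ g t) :
    ∃ j : Fin m, (s ≤ j.castSucc ∧ j.succ ≤ t) ∧ (g j.castSucc ≤ k.castSucc ∧ k.succ ≤ g j.succ) := by
  induction t using Fin.induction with
  | zero =>
    have h := g.monotone (Fin.zero_le s)
    simp only [Fin.le_def, Fin.val_castSucc, Fin.val_succ] at h hs ht
    omega
  | succ j ih =>
    by_cases h : k.succ ≤ g j.castSucc
    · obtain ⟨j', ⟨h1, h2⟩, h3⟩ := ih h
      refine ⟨j', ⟨h1, h2.trans ?_⟩, h3⟩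
      exact (Fin.castSucc_lt_succ (i := j)).le
    · refine ⟨j, ⟨?_, le_rfl⟩, ?_, ht⟩
      · by_contra hlt
        have h2 : j.succ ≤ s := by
          simp only [Fin.le_def, Fin.val_castSucc, Fin.val_succ] at hlt ⊢
          omega
        have h3 := g.monotone h2
        simp only [Fin.le_def, Fin.val_castSucc, Fin.val_succ] at h3 hs ht
        omega
      · simp only [Fin.le_def, Fin.val_castSucc, Fin.val_succ] at h ⊢
        omega

theorem step_unique {m p : ℕ} (g : Fin (m + 1) →o Fin (p + 1)) (k : Fin p) (j j' : Fin m)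
    (h : g j.castSucc ≤ k.castSucc ∧ k.succ ≤ g j.succ)
    (h' : g j'.castSucc ≤ k.castSucc ∧ k.succ ≤ g j'.succ) : j = j' := by
  have key : ∀ i i' : Fin m, k.succ ≤ g i.succ → g i'.castSucc ≤ k.castSucc → i' ≤ i := by
    intro i i' h1 h2
    by_contra hlt
    have h3 : i.succ ≤ i'.castSucc := by
      simp only [Fin.le_def, Fin.val_castSucc, Fin.val_succ] at hlt ⊢
      omega
    have h4 := g.monotone h3
    simp only [Fin.le_def, Fin.val_castSucc, Fin.val_succ] at h1 h2 h4
    omega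
  exact le_antisymm (key j' j h'.2 h.1) (key j j' h.2 h'.1)

theorem pushforward_comp (A : Type*) [AddCommMonoid A] {n m p : ℕ}
    (g : Fin (m + 1) →o Fin (p + 1)) (f : Fin (n + 1) →o Fin (m + 1)) (a : Fin n → A) :
    pushforward A (g.comp f) a = pushforward A g (pushforward A f a) := by
  ext k
  simp only [pushforward_apply, OrderHom.comp_coe, Function.comp_apply]
  have h1 : ∀ j : Fin m,
      (if g j.castSucc ≤ k.castSucc ∧ k.succ ≤ g j.succ then
        ∑ i : Fin n, (if f i.castSucc ≤ j.castSucc ∧ j.succ ≤ f i.succ then a i else 0) else 0) =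
      ∑ i : Fin n, if (f i.castSucc ≤ j.castSucc ∧ j.succ ≤ f i.succ) ∧
        (g j.castSucc ≤ k.castSucc ∧ k.succ ≤ g j.succ) then a i else 0 := by
    intro j
    by_cases h : g j.castSucc ≤ k.castSucc ∧ k.succ ≤ g j.succ <;> simp [h]
  rw [Finset.sum_congr rfl fun j _ => h1 j, Finset.sum_comm]
  refine Finset.sum_congr rfl fun i _ => ?_
  by_cases h : g (f i.castSucc) ≤ k.castSucc ∧ k.succ ≤ g (f i.succ)
  · obtain ⟨j, hj1, hj2⟩ := exists_step g k _ _ h.1 h.2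
    rw [if_pos h, Finset.sum_eq_single j, if_pos ⟨hj1, hj2⟩]
    · intro j' _ hne
      exact if_neg fun h' => hne (step_unique g k _ _ h'.2 hj2)
    · simp
  · rw [if_neg h]
    refine (Finset.sum_eq_zero fun j _ => if_neg fun h' => h ?_).symm
    exact ⟨(g.monotone h'.1.1).trans h'.2.1, h'.2.2.trans (g.monotone h'.1.2)⟩

/-- Additive maps act coordinatewise and commute with the cosimplicial structure. -/
theorem pushforward_map {A A' : Type*} [AddCommMonoid A] [AddCommMonoid A'] (φ : A →+ A')
    {n m : ℕ} (f : Fin (n + 1) →o Fin (m + 1)) (a : Fin n → A) :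
    pushforward A' f (fun i => φ (a i)) = fun j => φ (pushforward A f a j) := by
  ext j
  simp only [pushforward_apply, map_sum]
  exact Finset.sum_congr rfl fun i _ => by split_ifs <;> simp

/-- The cosimplicial structure map `pushforward A f`, as a continuous homomorphism of topological
groups (`A^n` has the product topology and is written multiplicatively). -/
def pushforwardHom (A : Type*) [AddCommGroup A] [TopologicalSpace A] [IsTopologicalAddGroup A]
    {n m : ℕ} (f : Fin (n + 1) →o Fin (m + 1)) :
    Multiplicative (Fin n → A) →ₜ* Multiplicative (Fin m → A) where
  toMonoidHom := AddMonoidHom.toMultiplicative (pushforward A f)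
  continuous_toFun := by
    have h : Continuous (pushforward A f) := by
      refine continuous_pi fun j => ?_
      simp only [pushforward_apply]
      refine continuous_finsetSum _ fun i _ => ?_
      split_ifs
      · exact continuous_apply i
      · exact continuous_const
    exact h

/-- The homomorphism `A^n → A'^n` induced coordinatewise by a continuous homomorphism `A → A'`. -/
def coordHom {A A' : Type*} [AddCommGroup A] [TopologicalSpace A] [AddCommGroup A']
    [TopologicalSpace A'] (φ : A →ₜ+ A') (n : ℕ) :
    Multiplicative (Fin n → A) →ₜ* Multiplicative (Fin n → A') where
  toMonoidHom := AddMonoidHom.toMultiplicative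
    { toFun := fun a i => φ (a i)
      map_zero' := by ext i; simp
      map_add' := fun a b => by ext i; simp }
  continuous_toFun := by
    have h : Continuous fun (a : Fin n → A) (i : Fin n) => φ (a i) :=
      continuous_pi fun i => (map_continuous φ).comp (continuous_apply i)
    exact h

/-- The simplicial set `Hom(A^•, G)`: its `n`-simplices are the continuous homomorphisms
`A^n → G`, and its structure maps are precomposition with those of the cosimplicial group `A^•`.
For `A = ℤ` (discrete topology) these are all homomorphisms `ℤ^n → G`. -/
def homSSet (A : Type) [AddCommGroup A] [TopologicalSpace A] [IsTopologicalAddGroup A]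
    (G : Type u) [Group G] [TopologicalSpace G] : SSet.{u} where
  obj Δ := Multiplicative (Fin Δ.unop.len → A) →ₜ* G
  map f := TypeCat.ofHom fun ρ => ρ.comp (pushforwardHom A f.unop.toOrderHom)
  map_id Δ := by
    ext ρ x
    exact congrArg (fun y => ρ (Multiplicative.ofAdd y)) (pushforward_id A x.toAdd)
  map_comp f g := by
    ext ρ x
    exact congrArg (fun y => ρ (Multiplicative.ofAdd y))
      (pushforward_comp A f.unop.toOrderHom g.unop.toOrderHom x.toAdd)

/-- The map `Hom(A'^•, G) → Hom(A^•, G)` given by precomposition with `A → A'`. -/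
def homSSetMap {A A' : Type} [AddCommGroup A] [TopologicalSpace A] [IsTopologicalAddGroup A]
    [AddCommGroup A'] [TopologicalSpace A'] [IsTopologicalAddGroup A'] (φ : A →ₜ+ A')
    (G : Type u) [Group G] [TopologicalSpace G] : homSSet A' G ⟶ homSSet A G where
  app Δ := TypeCat.ofHom fun ρ => ρ.comp (coordHom φ Δ.unop.len)
  naturality Δ Δ' f := by
    ext ρ
    refine ContinuousMonoidHom.ext fun x => ?_
    exact congrArg (fun y => (show _ →ₜ* G from ρ) (Multiplicative.ofAdd y))
      (pushforward_map φ.toAddMonoidHom f.unop.toOrderHom x.toAdd)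

/-- The space `B(A, G) = |Hom(A^•, G)|` for a discrete group `G`. The spaces of homomorphisms
into a discrete group that occur here are discrete (for `A = ℤ_ℓ` the topology is the colimit of
the discrete spaces `Hom((ℤ/ℓ^k)^n, G)`), so that the geometric realization of the simplicial space
is the one of the underlying simplicial set. -/
def B (A : Type) [AddCommGroup A] [TopologicalSpace A] [IsTopologicalAddGroup A]
    (G : Type u) [Group G] [TopologicalSpace G] [DiscreteTopology G] : TopCat.{u} :=
  SSet.toTop.obj (homSSet A G)

/-- The map `B(A', G) → B(A, G)` induced by a continuous homomorphism `A → A'`. -/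
def BMap {A A' : Type} [AddCommGroup A] [TopologicalSpace A] [IsTopologicalAddGroup A]
    [AddCommGroup A'] [TopologicalSpace A'] [IsTopologicalAddGroup A'] (φ : A →ₜ+ A')
    (G : Type u) [Group G] [TopologicalSpace G] [DiscreteTopology G] : B A' G ⟶ B A G :=
  SSet.toTop.map (homSSetMap φ G)

/-- The completion map `ℤ → ℤ_ℓ`. -/
def completionMap (l : ℕ) [Fact l.Prime] : ℤ →ₜ+ ℤ_[l] where
  toAddMonoidHom := Int.castAddHom ℤ_[l]
  continuous_toFun := continuous_of_discreteTopology

/-- A map of spaces is a mod-`l` equivalence if it induces an isomorphism on singular homology with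
coefficients in `ℤ/l` in every degree. -/
def IsModEquivalence (l : ℕ) {X Y : TopCat.{u}} (f : X ⟶ Y) : Prop :=
  ∀ n : ℕ, IsIso (((AlgebraicTopology.singularHomologyFunctor (ModuleCat.{u} (ZMod l)) n).obj
    (ModuleCat.of (ZMod l) (ULift.{u} (ZMod l)))).map f)

/-- A group is locally finite if it is a filtered colimit of finite groups. -/
def IsLocallyFinite (H : Type u) [Group H] : Prop :=
  ∃ (J : Type u) (_ : SmallCategory J) (_ : IsFiltered J) (F : J ⥤ GrpCat.{u})
    (ι : F ⟶ (Functor.const J).obj (GrpCat.of H)),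
    (∀ j, Finite (F.obj j)) ∧ Nonempty (IsColimit (Cocone.mk (GrpCat.of H) ι))

end CommClassifying

end

/-!
The map `Hom(ℤ_l^•, H) ⟶ Hom(ℤ^•, H)` is injective, since `ℤ` is dense in `ℤ_l`, and its image
consists of the commuting tuples whose orders are powers of `l`. If `H` is a torsion group, then
taking `l`-primary parts of commuting tuples is a simplicial retraction to it. On simplicial cycles
with coefficients in `ℤ/l` this retraction is homologous to the identity, by the method of acyclic
carriers: a simplex is carried by a finite commutative subgroup `K`, and within `K` a chain that is
killed by the projection to the `l`-primary part can be filled by averaging over the kernel of the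
projection, whose order is invertible in `ℤ/l`.

Both halves of the conclusion then follow from the retraction once every singular cycle of a
realization `|Y|` is known to be homologous to a simplicial one. By compactness it lies in a finite
subcomplex, and there one attaches one cell at a time, using excision for the pair `(Δᵈ, ∂Δᵈ)`.
-/

noncomputable section

open Simplicial Opposite AlgebraicTopology

namespace CommClassifying

/-! ### Simplicial chains and relative homology -/

section ModuleComplexes

universe v

variable {R : Type*} [Ring R] {S S₁ S₂ : ShortComplex (ModuleCat.{v} R)}

lemma exists_leftHomologyData_i_eq (h : S.LeftHomologyData) {x : S.X₂} (hx : S.g x = 0) :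
    ∃ z, h.i z = x :=
  (ShortComplex.moduleCat_exact_iff _).1
    (ShortComplex.exact_of_f_is_kernel (ShortComplex.mk h.i S.g h.wi) h.hi) x hx

lemma leftHomologyData_π_eq_zero_iff (h : S.LeftHomologyData) (z : h.K) :
    h.π z = 0 ↔ ∃ w, S.f w = h.i z := by
  have hex := (ShortComplex.moduleCat_exact_iff _).1
    (ShortComplex.exact_of_g_is_cokernel (ShortComplex.mk h.f' h.π h.wπ) h.hπ)
  have hf (w : S.X₁) : h.i (h.f' w) = S.f w := congr($(h.f'_i) w)
  constructor
  · intro hz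
    obtain ⟨w, rfl⟩ := hex z hz
    exact ⟨w, (hf w).symm⟩
  · rintro ⟨w, hw⟩
    obtain rfl : h.f' w = z := (ModuleCat.mono_iff_injective h.i).1 inferInstance ((hf w).trans hw)
    exact congr($(h.wπ) w)

variable {φ : S₁ ⟶ S₂} {h₁ : S₁.LeftHomologyData} {h₂ : S₂.LeftHomologyData}
  (γ : ShortComplex.LeftHomologyMapData φ h₁ h₂)

lemma injective_leftHomologyMap_iff : Function.Injective γ.φH ↔
    ∀ x : S₁.X₂, S₁.g x = 0 → ∀ y : S₂.X₁, φ.τ₂ x = S₂.f y → ∃ w : S₁.X₁, S₁.f w = x := by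
  have hi (z : h₁.K) : h₂.i (γ.φK z) = φ.τ₂ (h₁.i z) := congr($(γ.commi) z)
  have hπ (z : h₁.K) : γ.φH (h₁.π z) = h₂.π (γ.φK z) := congr($(γ.commπ) z)
  have hwi (z : h₁.K) : S₁.g (h₁.i z) = 0 := congr($(h₁.wi) z)
  rw [injective_iff_map_eq_zero]
  constructor
  · intro hγ x hx y hy
    obtain ⟨z, rfl⟩ := exists_leftHomologyData_i_eq h₁ hx
    refine (leftHomologyData_π_eq_zero_iff h₁ z).1 (hγ _ ?_)
    rw [hπ, leftHomologyData_π_eq_zero_iff, hi]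
    exact ⟨y, hy.symm⟩
  · intro hφ q hq
    obtain ⟨z, rfl⟩ := (ModuleCat.epi_iff_surjective h₁.π).1 inferInstance q
    rw [hπ, leftHomologyData_π_eq_zero_iff, hi] at hq
    obtain ⟨y, hy⟩ := hq
    exact (leftHomologyData_π_eq_zero_iff h₁ z).2 (hφ _ (hwi z) y hy.symm)

lemma surjective_leftHomologyMap_iff : Function.Surjective γ.φH ↔
    ∀ y : S₂.X₂, S₂.g y = 0 → ∃ x : S₁.X₂, S₁.g x = 0 ∧ ∃ w : S₂.X₁, y = φ.τ₂ x + S₂.f w := by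
  have hi (z : h₁.K) : h₂.i (γ.φK z) = φ.τ₂ (h₁.i z) := congr($(γ.commi) z)
  have hπ (z : h₁.K) : γ.φH (h₁.π z) = h₂.π (γ.φK z) := congr($(γ.commπ) z)
  have hwi₁ (z : h₁.K) : S₁.g (h₁.i z) = 0 := congr($(h₁.wi) z)
  have hwi₂ (z : h₂.K) : S₂.g (h₂.i z) = 0 := congr($(h₂.wi) z)
  have hdiff (z : h₁.K) (z' : h₂.K) :
      γ.φH (h₁.π z) = h₂.π z' ↔ ∃ w, h₂.i z' = φ.τ₂ (h₁.i z) + S₂.f w := by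
    rw [hπ, eq_comm, ← sub_eq_zero, ← map_sub, leftHomologyData_π_eq_zero_iff, map_sub, hi]
    simp only [eq_sub_iff_add_eq', eq_comm]
  constructor
  · intro hγ y hy
    obtain ⟨z', rfl⟩ := exists_leftHomologyData_i_eq h₂ hy
    obtain ⟨q, hq⟩ := hγ (h₂.π z')
    obtain ⟨z, rfl⟩ := (ModuleCat.epi_iff_surjective h₁.π).1 inferInstance q
    exact ⟨h₁.i z, hwi₁ z, (hdiff z z').1 hq⟩
  · intro hφ q
    obtain ⟨z', rfl⟩ := (ModuleCat.epi_iff_surjective h₂.π).1 inferInstance q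
    obtain ⟨x, hx, hw⟩ := hφ _ (hwi₂ z')
    obtain ⟨z, rfl⟩ := exists_leftHomologyData_i_eq h₁ hx
    exact ⟨h₁.π z, (hdiff z z').2 hw⟩

variable (φ) in
lemma shortComplex_quasiIso_iff :
    ShortComplex.QuasiIso φ ↔
      (∀ x : S₁.X₂, S₁.g x = 0 → ∀ y : S₂.X₁, φ.τ₂ x = S₂.f y → ∃ w : S₁.X₁, S₁.f w = x) ∧
      (∀ y : S₂.X₂, S₂.g y = 0 → ∃ x : S₁.X₂, S₁.g x = 0 ∧ ∃ w : S₂.X₁, y = φ.τ₂ x + S₂.f w) := by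
  let γ : ShortComplex.LeftHomologyMapData φ S₁.leftHomologyData S₂.leftHomologyData := default
  rw [γ.quasiIso_iff, ConcreteCategory.isIso_iff_bijective, Function.Bijective,
    injective_leftHomologyMap_iff γ, surjective_leftHomologyMap_iff γ]

lemma chainComplex_quasiIso_iff {K L : ChainComplex (ModuleCat.{v} R) ℕ} (f : K ⟶ L) :
    QuasiIso f ↔ ∀ n : ℕ,
      (∀ x : K.X n, K.d n (n - 1) x = 0 → ∀ y : L.X (n + 1), f.f n x = L.d (n + 1) n y →
        ∃ w : K.X (n + 1), K.d (n + 1) n w = x) ∧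
      (∀ y : L.X n, L.d n (n - 1) y = 0 → ∃ x : K.X n, K.d n (n - 1) x = 0 ∧
        ∃ w : L.X (n + 1), y = f.f n x + L.d (n + 1) n w) := by
  rw [quasiIso_iff]
  refine forall_congr' fun n => ?_
  rw [quasiIsoAt_iff' f (n + 1) n (n - 1) (by simp) (by cases n <;> simp)]
  exact shortComplex_quasiIso_iff _

end ModuleComplexes

section Chains

variable (k : Type) [CommRing k]

/-- The free `k`-module functor. Unlike `ModuleCat.free`, it allows the sets to live in a higher
universe than the ring. -/
def freeModule : Type u ⥤ ModuleCat.{u} k where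
  obj X := ModuleCat.of k (X →₀ k)
  map f := ModuleCat.ofHom (Finsupp.lmapDomain k k f)
  map_id X := by
    ext : 1
    exact Finsupp.lmapDomain_id k k
  map_comp f g := by
    ext : 1
    exact Finsupp.lmapDomain_comp k k f g

/-- The ring `k` as a module over itself in universe `u`: the coefficients of homology. -/
abbrev coefficients : ModuleCat.{u} k := ModuleCat.of k (ULift.{u} k)

/-- The inclusion in a free module of the summand indexed by `x`. -/
def freeModuleInc {X : Type u} (x : X) : coefficients.{u} k ⟶ (freeModule.{u} k).obj X :=
  ModuleCat.ofHom (X := ULift.{u} k) (Y := X →₀ k)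
    ((Finsupp.lsingle x).comp (ULift.moduleEquiv : ULift.{u} k ≃ₗ[k] k).toLinearMap)

lemma freeModuleInc_map {X Y : Type u} (f : X ⟶ Y) (x : X) :
    freeModuleInc k x ≫ (freeModule k).map f = freeModuleInc k (f x) := by
  ext r
  exact Finsupp.mapDomain_single

variable {k} in
/-- The homomorphism from a free module with given restrictions to its summands. -/
def freeModuleDesc {X : Type u} {M : ModuleCat.{u} k} (f : X → (coefficients.{u} k ⟶ M)) :
    (freeModule.{u} k).obj X ⟶ M :=
  ModuleCat.ofHom (X := X →₀ k) (Finsupp.lsum k fun x =>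
    (f x).hom.comp (ULift.moduleEquiv : ULift.{u} k ≃ₗ[k] k).symm.toLinearMap)

lemma freeModuleInc_desc {X : Type u} {M : ModuleCat.{u} k}
    (f : X → (coefficients.{u} k ⟶ M)) (x : X) :
    freeModuleInc k x ≫ freeModuleDesc f = f x := by
  ext r
  exact Finsupp.lsum_single k (fun x =>
    (f x).hom.comp (ULift.moduleEquiv : ULift.{u} k ≃ₗ[k] k).symm.toLinearMap) x _

variable {k} in
lemma freeModule_hom_ext {X : Type u} {M : ModuleCat.{u} k} {f g : (freeModule.{u} k).obj X ⟶ M}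
    (h : ∀ x, freeModuleInc k x ≫ f = freeModuleInc k x ≫ g) : f = g := by
  ext : 1
  exact Finsupp.lhom_ext (M := k) fun x r => congr($(h x).hom (ULift.up r))

/-- Free modules as coproducts of copies of the coefficients. -/
def freeModuleIso : sigmaConst.obj (coefficients.{u} k) ≅ freeModule.{u} k :=
  NatIso.ofComponents
    (fun X =>
      { hom := Sigma.desc (freeModuleInc k)
        inv := freeModuleDesc (Sigma.ι (fun _ : X => coefficients.{u} k))
        hom_inv_id := Sigma.hom_ext _ _ fun x => by
          exact (Sigma.ι_desc_assoc _ _ _).trans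
            ((freeModuleInc_desc k _ x).trans (Category.comp_id _).symm)
        inv_hom_id := freeModule_hom_ext fun x => by
          rw [← Category.assoc, freeModuleInc_desc, Sigma.ι_desc, Category.comp_id] })
    (fun {X Y} f => Sigma.hom_ext _ _ fun x => by
      dsimp only [sigmaConst_obj_map]
      rw [Sigma.ι_desc_assoc, freeModuleInc_map, Sigma.ι_comp_map'_assoc, Category.id_comp,
        Sigma.ι_desc])

/-- The complex of unnormalized simplicial chains with coefficients in `k`. -/
def chains : SSet.{u} ⥤ ChainComplex (ModuleCat.{u} k) ℕ :=
  (SimplicialObject.whiskering _ _).obj (freeModule k) ⋙ alternatingFaceMapComplex _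

/-- The complex `chains k` computes the homology given by `SSet.chainComplexFunctor`, in terms of
which singular homology is defined. -/
def chainsIso : (SSet.chainComplexFunctor (ModuleCat.{u} k)).obj (coefficients k) ≅ chains k :=
  Functor.isoWhiskerRight ((SimplicialObject.whiskering _ _).mapIso (freeModuleIso k))
    (alternatingFaceMapComplex _)

/-- The boundary `∑ᵢ (-1)ⁱ dᵢ` on simplicial chains. -/
def boundary (X : SSet.{u}) (n : ℕ) : (X _⦋n + 1⦌ →₀ k) →ₗ[k] (X _⦋n⦌ →₀ k) :=
  ∑ i : Fin (n + 2), (-1 : k) ^ (i : ℕ) • Finsupp.lmapDomain k k (X.δ i)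

lemma chains_d (X : SSet.{u}) (n : ℕ) :
    (((chains k).obj X).d (n + 1) n).hom = boundary k X n := by
  have hd : ((chains k).obj X).d (n + 1) n = ∑ i : Fin (n + 2),
      (-1 : ℤ) ^ (i : ℕ) • (((SimplicialObject.whiskering _ _).obj (freeModule k)).obj X).δ i :=
    AlternatingFaceMapComplex.obj_d_eq _ _
  rw [hd, boundary]
  refine (ModuleCat.hom_sum (M := (freeModule k).obj (X _⦋n + 1⦌))
    (N := (freeModule k).obj (X _⦋n⦌)) _ _).trans (Finset.sum_congr rfl fun i _ => ?_)
  rw [show (-1 : k) ^ (i : ℕ) = ((-1 : ℤ) ^ (i : ℕ) : ℤ) by push_cast; rfl]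
  exact (ModuleCat.hom_zsmul (M := (freeModule k).obj (X _⦋n + 1⦌))
    (N := (freeModule k).obj (X _⦋n⦌)) _ _).trans (Int.cast_smul_eq_zsmul k _ _).symm

/-- A simplicial chain is a cycle; in degree zero this is no condition. -/
def IsCycle {X : SSet.{u}} {n : ℕ} : (X _⦋n⦌ →₀ k) → Prop :=
  match n with
  | 0 => fun _ => True
  | n + 1 => fun x => boundary k X n x = 0

variable {k}

lemma isCycle_iff {X : SSet.{u}} {n : ℕ} (x : X _⦋n⦌ →₀ k) :
    IsCycle k x ↔ ((chains k).obj X).d n (n - 1) x = 0 := by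
  cases n with
  | zero =>
    rw [show ((chains k).obj X).d 0 (0 - 1) = 0 from HomologicalComplex.shape _ _ _ (by simp)]
    exact iff_of_true trivial rfl
  | succ n =>
    change boundary k X n x = 0 ↔ (((chains k).obj X).d (n + 1) n).hom x = 0
    rw [chains_d k X n]
    exact Iff.rfl

variable (k) in
/-- A map of simplicial sets that induces isomorphisms on homology with coefficients in `k`. -/
def IsHomologyIso {X Y : SSet.{u}} (f : X ⟶ Y) : Prop := QuasiIso ((chains k).map f)

lemma isHomologyIso_iff {X Y : SSet.{u}} (f : X ⟶ Y) :
    IsHomologyIso k f ↔ ∀ n : ℕ,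
      (∀ x : X _⦋n⦌ →₀ k, IsCycle k x → ∀ y : Y _⦋n + 1⦌ →₀ k,
        Finsupp.mapDomain (f.app (op ⦋n⦌)) x = boundary k Y n y →
        ∃ w : X _⦋n + 1⦌ →₀ k, boundary k X n w = x) ∧
      (∀ y : Y _⦋n⦌ →₀ k, IsCycle k y → ∃ x : X _⦋n⦌ →₀ k, IsCycle k x ∧
        ∃ w : Y _⦋n + 1⦌ →₀ k, y = Finsupp.mapDomain (f.app (op ⦋n⦌)) x + boundary k Y n w) := by
  rw [IsHomologyIso, chainComplex_quasiIso_iff]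
  refine forall_congr' fun n => ?_
  simp only [isCycle_iff, ← chains_d]
  rfl

lemma IsHomologyIso.comp {X Y Z : SSet.{u}} {f : X ⟶ Y} {g : Y ⟶ Z} (hf : IsHomologyIso k f)
    (hg : IsHomologyIso k g) : IsHomologyIso k (f ≫ g) := by
  unfold IsHomologyIso at *
  rw [Functor.map_comp]
  infer_instance

lemma IsHomologyIso.of_comp_left {X Y Z : SSet.{u}} {f : X ⟶ Y} {g : Y ⟶ Z} (hf : IsHomologyIso k f)
    (hfg : IsHomologyIso k (f ≫ g)) : IsHomologyIso k g := by
  unfold IsHomologyIso at *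
  rw [Functor.map_comp] at hfg
  exact quasiIso_of_comp_left ((chains k).map f) ((chains k).map g)

lemma IsHomologyIso.of_isIso {X Y : SSet.{u}} (f : X ⟶ Y) [IsIso f] : IsHomologyIso k f := by
  unfold IsHomologyIso
  infer_instance

lemma boundary_mapDomain {X Y : SSet.{u}} (f : X ⟶ Y) (n : ℕ) (x : X _⦋n + 1⦌ →₀ k) :
    boundary k Y n (Finsupp.mapDomain (f.app (op ⦋n + 1⦌)) x) =
      Finsupp.mapDomain (f.app (op ⦋n⦌)) (boundary k X n x) := by
  have := congr($(((chains k).map f).comm (n + 1) n).hom x)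
  rw [ModuleCat.hom_comp, ModuleCat.hom_comp, chains_d, chains_d] at this
  exact this

lemma boundary_boundary (X : SSet.{u}) (n : ℕ) (x : X _⦋n + 2⦌ →₀ k) :
    boundary k X n (boundary k X (n + 1) x) = 0 := by
  have := congr($(((chains k).obj X).d_comp_d (n + 2) (n + 1) n).hom x)
  rw [ModuleCat.hom_comp, chains_d, chains_d] at this
  exact this

lemma isCycle_boundary {X : SSet.{u}} {n : ℕ} (x : X _⦋n + 1⦌ →₀ k) :
    IsCycle k (boundary k X n x) := by
  cases n with
  | zero => trivial
  | succ n => exact boundary_boundary X n x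

lemma IsCycle.map {X Y : SSet.{u}} (f : X ⟶ Y) {n : ℕ} {x : X _⦋n⦌ →₀ k} (hx : IsCycle k x) :
    IsCycle k (Finsupp.mapDomain (f.app (op ⦋n⦌)) x) := by
  cases n with
  | zero => trivial
  | succ n =>
    change boundary k Y n _ = 0
    rw [boundary_mapDomain, show boundary k X n x = 0 from hx, Finsupp.mapDomain_zero]

lemma boundary_single (X : SSet.{u}) (n : ℕ) (x : X _⦋n + 1⦌) :
    boundary k X n (Finsupp.single x 1) =
      ∑ i : Fin (n + 2), (-1 : k) ^ (i : ℕ) • Finsupp.single (X.δ i x) 1 := by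
  simp [boundary, LinearMap.sum_apply]

end Chains

section Sequences

open HomologicalComplex ComposableArrows Abelian

variable {C ι : Type*} [Category* C] [Abelian C] {c : ComplexShape ι}
  {S₁ S₂ : ShortComplex (HomologicalComplex C c)} (φ : S₁ ⟶ S₂)

lemma mono_homologyMap_τ₂ (hS₁ : S₁.ShortExact) (hS₂ : S₂.ShortExact) [QuasiIso φ.τ₁]
    [QuasiIso φ.τ₃] (i : ι) : Mono (homologyMap φ.τ₂ i) := by
  by_cases! hi : ∃ j, c.Rel j i
  · obtain ⟨j, hji⟩ := hi
    apply mono_of_epi_of_mono_of_mono ((δ₀Functor ⋙ δ₀Functor).map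
      (HomologySequence.mapComposableArrows₅ φ hS₁ hS₂ j i hji))
    · exact (HomologySequence.composableArrows₅_exact hS₁ j i hji).δ₀.δ₀
    · exact (HomologySequence.composableArrows₅_exact hS₂ j i hji).δ₀.δ₀
    · exact inferInstanceAs (Epi (homologyMap φ.τ₃ j))
    · exact inferInstanceAs (Mono (homologyMap φ.τ₁ i))
    · exact inferInstanceAs (Mono (homologyMap φ.τ₃ i))
  · have := hS₂.mono_f
    apply mono_of_mono_of_mono_of_mono (HomologySequence.mapComposableArrows₂ φ i)
    · exact HomologySequence.composableArrows₂_exact hS₁ i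
    · exact mono_homologyMap_of_mono_of_not_rel S₂.f i hi
    · exact inferInstanceAs (Mono (homologyMap φ.τ₁ i))
    · exact inferInstanceAs (Mono (homologyMap φ.τ₃ i))

lemma epi_homologyMap_τ₂ (hS₁ : S₁.ShortExact) (hS₂ : S₂.ShortExact) [QuasiIso φ.τ₁]
    [QuasiIso φ.τ₃] (i : ι) : Epi (homologyMap φ.τ₂ i) := by
  by_cases! hi : ∃ j, c.Rel i j
  · obtain ⟨j, hij⟩ := hi
    apply epi_of_epi_of_epi_of_mono ((δlastFunctor ⋙ δlastFunctor).map
      (HomologySequence.mapComposableArrows₅ φ hS₁ hS₂ i j hij))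
    · exact (HomologySequence.composableArrows₅_exact hS₁ i j hij).δlast.δlast
    · exact (HomologySequence.composableArrows₅_exact hS₂ i j hij).δlast.δlast
    · exact inferInstanceAs (Epi (homologyMap φ.τ₁ i))
    · exact inferInstanceAs (Epi (homologyMap φ.τ₃ i))
    · exact inferInstanceAs (Mono (homologyMap φ.τ₁ j))
  · have := hS₁.epi_g
    apply epi_of_epi_of_epi_of_epi (HomologySequence.mapComposableArrows₂ φ i)
    · exact HomologySequence.composableArrows₂_exact hS₂ i
    · exact epi_homologyMap_of_epi_of_not_rel S₁.g i hi
    · exact inferInstanceAs (Epi (homologyMap φ.τ₁ i))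
    · exact inferInstanceAs (Epi (homologyMap φ.τ₃ i))

lemma quasiIso_τ₂ (hS₁ : S₁.ShortExact) (hS₂ : S₂.ShortExact) [QuasiIso φ.τ₁]
    [QuasiIso φ.τ₃] : QuasiIso φ.τ₂ := by
  rw [quasiIso_iff]
  intro i
  rw [quasiIsoAt_iff_isIso_homologyMap]
  have := mono_homologyMap_τ₂ φ hS₁ hS₂ i
  have := epi_homologyMap_τ₂ φ hS₁ hS₂ i
  exact isIso_of_mono_of_epi _

end Sequences

section Relative

variable (k : Type) [CommRing k] {A B A' B' C D : SSet.{u}} {i : A ⟶ B} {i' : A' ⟶ B'}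
  {i'' : C ⟶ D} {a : A ⟶ A'} {b : B ⟶ B'} {a' : A' ⟶ C} {b' : B' ⟶ D}

/-- The complex of chains of `B` relative to a simplicial set `A` over `B`. -/
abbrev relativeChains (i : A ⟶ B) : ChainComplex (ModuleCat.{u} k) ℕ :=
  cokernel ((chains k).map i)

/-- The map on relative chains induced by a commutative square. -/
abbrev relativeMap (w : i ≫ b = a ≫ i') : relativeChains k i ⟶ relativeChains k i' :=
  cokernel.map _ _ ((chains k).map a) ((chains k).map b)
    (by rw [← Functor.map_comp, ← Functor.map_comp, w])

variable (i i' a b) in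
/-- The maps `a` and `b` form a map of pairs `i ⟶ i'` that induces isomorphisms on relative
homology with coefficients in `k`. -/
def IsRelHomologyIso : Prop :=
  ∃ w : i ≫ b = a ≫ i', QuasiIso (relativeMap k w)

instance mono_chains_map (i : A ⟶ B) [Mono i] : Mono ((chains k).map i) := by
  refine HomologicalComplex.mono_of_mono_f _ fun n => ?_
  rw [ModuleCat.mono_iff_injective]
  have : Mono (i.app (op ⦋n⦌)) := inferInstance
  rw [CategoryTheory.mono_iff_injective] at this
  exact Finsupp.mapDomain_injective this

/-- The short complex `C(A) ⟶ C(B) ⟶ C(B, A)` of a pair. -/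
abbrev pairShortComplex (i : A ⟶ B) :
    ShortComplex (ChainComplex (ModuleCat.{u} k) ℕ) :=
  ShortComplex.mk ((chains k).map i) (cokernel.π _) (cokernel.condition _)

lemma pairShortComplex_shortExact (i : A ⟶ B) [Mono i] : (pairShortComplex k i).ShortExact where
  exact := ShortComplex.exact_cokernel _
  mono_f := mono_chains_map k i
  epi_g := inferInstanceAs (Epi (cokernel.π _))

/-- The map of short complexes induced by a map of pairs. -/
abbrev pairShortComplexMap (w : i ≫ b = a ≫ i') : pairShortComplex k i ⟶ pairShortComplex k i' where
  τ₁ := (chains k).map a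
  τ₂ := (chains k).map b
  τ₃ := relativeMap k w
  comm₁₂ := by dsimp only [pairShortComplex]; rw [← Functor.map_comp, ← Functor.map_comp, w]
  comm₂₃ := (cokernel.π_desc _ _ _).symm

variable {k}

lemma IsRelHomologyIso.of_isHomologyIso [Mono i] [Mono i'] (w : i ≫ b = a ≫ i')
    (ha : IsHomologyIso k a) (hb : IsHomologyIso k b) : IsRelHomologyIso k i i' a b :=
  ⟨w, HomologicalComplex.HomologySequence.quasiIso_τ₃ (pairShortComplexMap k w)
    (pairShortComplex_shortExact k i) (pairShortComplex_shortExact k i') ha hb⟩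

lemma IsRelHomologyIso.isHomologyIso [Mono i] [Mono i'] (h : IsRelHomologyIso k i i' a b)
    (ha : IsHomologyIso k a) : IsHomologyIso k b := by
  obtain ⟨w, h⟩ := h
  have : QuasiIso (pairShortComplexMap k w).τ₁ := ha
  exact quasiIso_τ₂ (pairShortComplexMap k w) (pairShortComplex_shortExact k i)
    (pairShortComplex_shortExact k i')

lemma relativeMap_comp (w : i ≫ b = a ≫ i') (w' : i' ≫ b' = a' ≫ i'') :
    relativeMap k w ≫ relativeMap k w' =
      relativeMap k (a := a ≫ a') (b := b ≫ b') (by rw [reassoc_of% w, w', Category.assoc]) := by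
  rw [← cancel_epi (cokernel.π _)]
  simp [relativeMap]

lemma IsRelHomologyIso.comp (h : IsRelHomologyIso k i i' a b)
    (h' : IsRelHomologyIso k i' i'' a' b') : IsRelHomologyIso k i i'' (a ≫ a') (b ≫ b') := by
  obtain ⟨w, h⟩ := h
  obtain ⟨w', h'⟩ := h'
  refine ⟨by rw [reassoc_of% w, w', Category.assoc], ?_⟩
  rw [← relativeMap_comp w w']
  infer_instance

lemma IsRelHomologyIso.of_comp_left (h : IsRelHomologyIso k i i' a b) (w' : i' ≫ b' = a' ≫ i'')
    (hc : IsRelHomologyIso k i i'' (a ≫ a') (b ≫ b')) : IsRelHomologyIso k i' i'' a' b' := by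
  obtain ⟨w, h⟩ := h
  obtain ⟨_, hc⟩ := hc
  refine ⟨w', ?_⟩
  rw [← relativeMap_comp w w'] at hc
  exact quasiIso_of_comp_left (relativeMap k w) (relativeMap k w')

lemma IsRelHomologyIso.of_comp_right (w : i ≫ b = a ≫ i') (h' : IsRelHomologyIso k i' i'' a' b')
    (hc : IsRelHomologyIso k i i'' (a ≫ a') (b ≫ b')) : IsRelHomologyIso k i i' a b := by
  obtain ⟨w', h'⟩ := h'
  obtain ⟨_, hc⟩ := hc
  refine ⟨w, ?_⟩
  rw [← relativeMap_comp w w'] at hc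
  exact quasiIso_of_comp_right (relativeMap k w) (relativeMap k w')

instance : PreservesColimitsOfShape WalkingSpan (freeModule.{u} k) :=
  preservesColimitsOfShape_of_natIso (freeModuleIso k)

instance : PreservesColimitsOfShape WalkingSpan (chains.{u} k) :=
  HomologicalComplex.preservesColimitsOfShape_of_eval _ fun n =>
    inferInstanceAs (PreservesColimitsOfShape WalkingSpan
      ((evaluation SimplexCategoryᵒᵖ (Type u)).obj (op ⦋n⦌) ⋙ freeModule.{u} k))

lemma IsRelHomologyIso.of_isPushout (h : IsPushout a i i' b) : IsRelHomologyIso k i i' a b := by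
  have : IsIso (relativeMap k h.w.symm) := by
    have hp : IsPushout ((chains k).map a) ((chains k).map i) ((chains k).map i')
        ((chains k).map b) := h.map (chains k)
    exact isIso_cokernel_map_of_isPushout hp.flip
  exact ⟨h.w.symm, inferInstance⟩

end Relative

/-! ### Barycentric subdivision and small simplices -/

section Tuples

/-- The simplicial set whose `n`-simplices are the `(n + 1)`-tuples of elements of `V`. -/
def tupleSSet (V : Type u) : SSet.{u} where
  obj Δ := Fin (Δ.unop.len + 1) → V
  map f := TypeCat.ofHom fun v => v ∘ f.unop.toOrderHom

/-- The map of simplicial sets of tuples induced by a map of points. -/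
def tupleSSetMap {V W : Type u} (g : V → W) : tupleSSet V ⟶ tupleSSet W where
  app _ := TypeCat.ofHom fun v => g ∘ v

variable (k : Type) [CommRing k] {V W : Type u}

/-- The boundary of chains of tuples. -/
def tupleBoundary (V : Type u) (n : ℕ) :
    ((Fin (n + 2) → V) →₀ k) →ₗ[k] ((Fin (n + 1) → V) →₀ k) :=
  boundary k (tupleSSet V) n

/-- The cone with apex `b` on chains of tuples. -/
def tupleCone (b : V) (n : ℕ) : ((Fin (n + 1) → V) →₀ k) →ₗ[k] ((Fin (n + 2) → V) →₀ k) :=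
  Finsupp.lmapDomain k k fun v => (Fin.cons b v : Fin (n + 2) → V)

/-- The map on chains of tuples induced by a map of points. -/
def tupleMap (g : V → W) (n : ℕ) : ((Fin (n + 1) → V) →₀ k) →ₗ[k] ((Fin (n + 1) → W) →₀ k) :=
  Finsupp.lmapDomain k k (fun v => g ∘ v)

/-- The augmentation of chains of tuples: the sum of the coefficients of a chain of points. -/
def augmentation (V : Type u) : ((Fin 1 → V) →₀ k) →ₗ[k] k :=
  Finsupp.linearCombination k fun _ => (1 : k)

variable {k}

lemma tupleBoundary_single {n : ℕ} (v : Fin (n + 2) → V) :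
    tupleBoundary k V n (Finsupp.single v 1) =
      ∑ i : Fin (n + 2), (-1 : k) ^ (i : ℕ) • Finsupp.single (v ∘ i.succAbove) 1 :=
  boundary_single (tupleSSet V) n v

lemma tupleBoundary_tupleBoundary {n : ℕ} (x : (Fin (n + 3) → V) →₀ k) :
    tupleBoundary k V n (tupleBoundary k V (n + 1) x) = 0 :=
  boundary_boundary (tupleSSet V) n x

lemma tupleMap_tupleBoundary (g : V → W) {n : ℕ} (x : (Fin (n + 2) → V) →₀ k) :
    tupleMap k g n (tupleBoundary k V n x) = tupleBoundary k W n (tupleMap k g (n + 1) x) :=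
  (boundary_mapDomain (tupleSSetMap g) n x).symm

@[simp]
lemma tupleCone_single (b : V) {n : ℕ} (v : Fin (n + 1) → V) :
    tupleCone k b n (Finsupp.single v 1) = Finsupp.single (Fin.cons b v : Fin (n + 2) → V) 1 := by
  simp [tupleCone]

@[simp]
lemma tupleMap_single (g : V → W) {n : ℕ} (v : Fin (n + 1) → V) :
    tupleMap k g n (Finsupp.single v 1) = Finsupp.single (g ∘ v) 1 := by
  simp [tupleMap]

@[simp]
lemma augmentation_single (v : Fin 1 → V) : augmentation k V (Finsupp.single v 1) = 1 := by
  simp [augmentation]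

lemma tupleChain_hom_ext {n : ℕ} {M : Type*} [AddCommMonoid M] [Module k M]
    {f g : ((Fin (n + 1) → V) →₀ k) →ₗ[k] M}
    (h : ∀ v, f (Finsupp.single v 1) = g (Finsupp.single v 1)) : f = g :=
  Finsupp.lhom_ext' fun v => LinearMap.ext_ring (h v)

lemma augmentation_tupleMap (g : V → W) (x : (Fin 1 → V) →₀ k) :
    augmentation k W (tupleMap k g 0 x) = augmentation k V x := by
  have : augmentation k W ∘ₗ tupleMap k g 0 = augmentation k V :=
    tupleChain_hom_ext fun v => by simp
  exact LinearMap.congr_fun this x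

lemma augmentation_tupleBoundary (x : (Fin 2 → V) →₀ k) :
    augmentation k V (tupleBoundary k V 0 x) = 0 := by
  have : augmentation k V ∘ₗ tupleBoundary k V 0 = 0 := tupleChain_hom_ext fun v => by
    rw [LinearMap.comp_apply, tupleBoundary_single, Fin.sum_univ_two]
    simp
  exact LinearMap.congr_fun this x

lemma tupleMap_tupleCone (g : V → W) (b : V) {n : ℕ} (x : (Fin (n + 1) → V) →₀ k) :
    tupleMap k g (n + 1) (tupleCone k b n x) = tupleCone k (g b) n (tupleMap k g n x) := by
  have : tupleMap k g (n + 1) ∘ₗ tupleCone k b n = tupleCone k (g b) n ∘ₗ tupleMap k g n :=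
    tupleChain_hom_ext fun v => by simp [Fin.comp_cons]
  exact LinearMap.congr_fun this x

lemma tupleBoundary_tupleCone (b : V) {n : ℕ} (x : (Fin (n + 2) → V) →₀ k) :
    tupleBoundary k V (n + 1) (tupleCone k b (n + 1) x) =
      x - tupleCone k b n (tupleBoundary k V n x) := by
  have : tupleBoundary k V (n + 1) ∘ₗ tupleCone k b (n + 1) =
      LinearMap.id - tupleCone k b n ∘ₗ tupleBoundary k V n := tupleChain_hom_ext fun v => by
    rw [LinearMap.comp_apply, tupleCone_single, tupleBoundary_single, Fin.sum_univ_succ,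
      LinearMap.sub_apply, LinearMap.comp_apply, tupleBoundary_single, map_sum, sub_eq_add_neg,
      ← Finset.sum_neg_distrib]
    congr 1
    · rw [Fin.val_zero, pow_zero, one_smul]
      rfl
    · refine Finset.sum_congr rfl fun i _ => ?_
      rw [map_smul, tupleCone_single, Fin.val_succ, pow_succ, mul_neg_one, neg_smul]
      congr 3
      ext j
      cases j using Fin.cases <;> simp
  exact LinearMap.congr_fun this x

lemma tupleBoundary_tupleCone_zero (b : V) (x : (Fin 1 → V) →₀ k) :
    tupleBoundary k V 0 (tupleCone k b 0 x) =
      x - augmentation k V x • Finsupp.single (fun _ => b) 1 := by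
  have : tupleBoundary k V 0 ∘ₗ tupleCone k b 0 = LinearMap.id -
      (augmentation k V).smulRight (Finsupp.single (fun _ => b) 1) := tupleChain_hom_ext fun v => by
    rw [LinearMap.comp_apply, tupleCone_single, tupleBoundary_single, Fin.sum_univ_two,
      show (Fin.cons b v : Fin 2 → V) ∘ Fin.succAbove 0 = v from rfl,
      show (Fin.cons b v : Fin 2 → V) ∘ Fin.succAbove 1 = fun _ => b from
        funext fun j => by rw [Fin.fin_one_eq_zero j]; rfl]
    simp [sub_eq_add_neg]
  exact LinearMap.congr_fun this x

section ConeHomotopy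

variable (k) (β : ∀ n : ℕ, (Fin (n + 1) → V) → V)
  (F G : ∀ n : ℕ, ((Fin (n + 1) → V) →₀ k) →ₗ[k] ((Fin (n + 1) → V) →₀ k))

/-- The homotopy between two chain maps `F` and `G` of tuples obtained by coning off, where `β v`
is the apex of the cone for the tuple `v`. -/
def coneHomotopy (n : ℕ) : ((Fin (n + 1) → V) →₀ k) →ₗ[k] ((Fin (n + 2) → V) →₀ k) :=
  match n with
  | 0 => Finsupp.linearCombination k fun v =>
      tupleCone k (β 0 v) 0 ((F 0 - G 0) (Finsupp.single v 1))
  | n + 1 => Finsupp.linearCombination k fun v =>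
      tupleCone k (β (n + 1) v) (n + 1) ((F (n + 1) - G (n + 1)) (Finsupp.single v 1) -
        coneHomotopy n (tupleBoundary k V n (Finsupp.single v 1)))

variable {k}

lemma coneHomotopy_zero_single (v : Fin 1 → V) :
    coneHomotopy k β F G 0 (Finsupp.single v 1) =
      tupleCone k (β 0 v) 0 ((F 0 - G 0) (Finsupp.single v 1)) := by
  rw [coneHomotopy, Finsupp.linearCombination_single, one_smul]

lemma coneHomotopy_succ_single {n : ℕ} (v : Fin (n + 2) → V) :
    coneHomotopy k β F G (n + 1) (Finsupp.single v 1) =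
      tupleCone k (β (n + 1) v) (n + 1) ((F (n + 1) - G (n + 1)) (Finsupp.single v 1) -
        coneHomotopy k β F G n (tupleBoundary k V n (Finsupp.single v 1))) := by
  rw [coneHomotopy, Finsupp.linearCombination_single, one_smul]

variable {F G}

lemma tupleBoundary_coneHomotopy_zero
    (haug : ∀ x, augmentation k V (F 0 x) = augmentation k V (G 0 x)) (x : (Fin 1 → V) →₀ k) :
    tupleBoundary k V 0 (coneHomotopy k β F G 0 x) = F 0 x - G 0 x := by
  have : tupleBoundary k V 0 ∘ₗ coneHomotopy k β F G 0 = F 0 - G 0 := tupleChain_hom_ext fun v => by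
    rw [LinearMap.comp_apply, coneHomotopy_zero_single, tupleBoundary_tupleCone_zero,
      LinearMap.sub_apply, map_sub, haug, sub_self, zero_smul, sub_zero]
  exact LinearMap.congr_fun this x

lemma tupleBoundary_coneHomotopy
    (haug : ∀ x, augmentation k V (F 0 x) = augmentation k V (G 0 x))
    (hF : ∀ n x, tupleBoundary k V n (F (n + 1) x) = F n (tupleBoundary k V n x))
    (hG : ∀ n x, tupleBoundary k V n (G (n + 1) x) = G n (tupleBoundary k V n x))
    {n : ℕ} (x : (Fin (n + 2) → V) →₀ k) :
    tupleBoundary k V (n + 1) (coneHomotopy k β F G (n + 1) x) =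
      F (n + 1) x - G (n + 1) x - coneHomotopy k β F G n (tupleBoundary k V n x) := by
  suffices h : tupleBoundary k V (n + 1) ∘ₗ coneHomotopy k β F G (n + 1) =
      F (n + 1) - G (n + 1) - coneHomotopy k β F G n ∘ₗ tupleBoundary k V n from
    LinearMap.congr_fun h x
  clear x
  refine tupleChain_hom_ext fun v => ?_
  -- The chain that is coned off is a cycle.
  have hcycle : tupleBoundary k V n ((F (n + 1) - G (n + 1)) (Finsupp.single v 1)) =
      tupleBoundary k V n
        (coneHomotopy k β F G n (tupleBoundary k V n (Finsupp.single v 1))) := by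
    rw [LinearMap.sub_apply, map_sub, hF, hG]
    cases n with
    | zero => rw [tupleBoundary_coneHomotopy_zero β haug]
    | succ n =>
      rw [tupleBoundary_coneHomotopy haug hF hG, tupleBoundary_tupleBoundary, map_zero, sub_zero]
  rw [LinearMap.comp_apply, coneHomotopy_succ_single, tupleBoundary_tupleCone, map_sub, hcycle,
    sub_self, map_zero, sub_zero]
  rfl

lemma tupleMap_coneHomotopy {β' : ∀ n : ℕ, (Fin (n + 1) → W) → W}
    {F' G' : ∀ n : ℕ, ((Fin (n + 1) → W) →₀ k) →ₗ[k] ((Fin (n + 1) → W) →₀ k)} {g : V → W}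
    (hβ : ∀ n v, β' n (g ∘ v) = g (β n v))
    (hF : ∀ n x, tupleMap k g n (F n x) = F' n (tupleMap k g n x))
    (hG : ∀ n x, tupleMap k g n (G n x) = G' n (tupleMap k g n x))
    {n : ℕ} (x : (Fin (n + 1) → V) →₀ k) :
    tupleMap k g (n + 1) (coneHomotopy k β F G n x) =
      coneHomotopy k β' F' G' n (tupleMap k g n x) := by
  suffices h : tupleMap k g (n + 1) ∘ₗ coneHomotopy k β F G n =
      coneHomotopy k β' F' G' n ∘ₗ tupleMap k g n from LinearMap.congr_fun h x
  clear x
  refine tupleChain_hom_ext fun v => ?_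
  cases n with
  | zero =>
    rw [LinearMap.comp_apply, LinearMap.comp_apply, tupleMap_single, coneHomotopy_zero_single,
      coneHomotopy_zero_single, tupleMap_tupleCone, hβ, LinearMap.sub_apply, map_sub, hF, hG,
      tupleMap_single, LinearMap.sub_apply]
  | succ n =>
    rw [LinearMap.comp_apply, LinearMap.comp_apply, tupleMap_single, coneHomotopy_succ_single,
      coneHomotopy_succ_single, tupleMap_tupleCone, hβ, map_sub (tupleMap k g (n + 1)),
      tupleMap_coneHomotopy hβ hF hG, tupleMap_tupleBoundary, LinearMap.sub_apply,
      map_sub (tupleMap k g (n + 1)), hF, hG,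
      tupleMap_single, LinearMap.sub_apply]

end ConeHomotopy

section MapHomotopy

variable (k) in
/-- The homotopy from `r_*` to the identity on chains of tuples that cones off to the first
vertex. -/
def mapHomotopy (r : V → V) (n : ℕ) :
    ((Fin (n + 1) → V) →₀ k) →ₗ[k] ((Fin (n + 2) → V) →₀ k) :=
  coneHomotopy k (fun _ v => v 0) (tupleMap k r) (fun _ => LinearMap.id) n

lemma tupleBoundary_mapHomotopy (r : V → V) {n : ℕ} (x : (Fin (n + 2) → V) →₀ k) :
    tupleBoundary k V (n + 1) (mapHomotopy k r (n + 1) x) =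
      tupleMap k r (n + 1) x - x - mapHomotopy k r n (tupleBoundary k V n x) :=
  tupleBoundary_coneHomotopy (F := tupleMap k r) (G := fun _ => LinearMap.id) _
    (augmentation_tupleMap r) (fun _ x => (tupleMap_tupleBoundary r x).symm) (fun _ _ => rfl) x

lemma tupleMap_mapHomotopy {r : V → V} {r' : W → W} {g : V → W} (h : ∀ y, g (r y) = r' (g y))
    {n : ℕ} (x : (Fin (n + 1) → V) →₀ k) :
    tupleMap k g (n + 1) (mapHomotopy k r n x) = mapHomotopy k r' n (tupleMap k g n x) := by
  refine tupleMap_coneHomotopy (F := tupleMap k r) (F' := tupleMap k r') (β := fun _ v => v 0)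
    (β' := fun _ v => v 0) (g := g) (fun _ _ => rfl) (fun n x => ?_) (fun _ _ => rfl) x
  suffices e : tupleMap k g n ∘ₗ tupleMap k r n = tupleMap k r' n ∘ₗ tupleMap k g n from
    LinearMap.congr_fun e x
  refine tupleChain_hom_ext fun v => ?_
  simp only [LinearMap.comp_apply, tupleMap_single]
  exact congrArg (fun v => Finsupp.single v 1) (funext fun i => h (v i))

end MapHomotopy

section Subdivision

variable (k) (β : ∀ n : ℕ, (Fin (n + 1) → V) → V)

/-- The subdivision of chains of tuples, for a choice `β` of a centre of each tuple. -/
def subdivision (n : ℕ) : ((Fin (n + 1) → V) →₀ k) →ₗ[k] ((Fin (n + 1) → V) →₀ k) :=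
  match n with
  | 0 => LinearMap.id
  | n + 1 => Finsupp.linearCombination k fun v =>
      tupleCone k (β (n + 1) v) n (subdivision n (tupleBoundary k V n (Finsupp.single v 1)))

/-- The homotopy from the subdivision of chains of tuples to the identity. -/
def subdivisionHomotopy : ∀ n : ℕ, ((Fin (n + 1) → V) →₀ k) →ₗ[k] ((Fin (n + 2) → V) →₀ k) :=
  coneHomotopy k β (fun _ => LinearMap.id) (subdivision k β)

variable {k}

lemma subdivision_succ_single {n : ℕ} (v : Fin (n + 2) → V) :
    subdivision k β (n + 1) (Finsupp.single v 1) =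
      tupleCone k (β (n + 1) v) n
        (subdivision k β n (tupleBoundary k V n (Finsupp.single v 1))) := by
  rw [subdivision, Finsupp.linearCombination_single, one_smul]

lemma tupleBoundary_subdivision (n : ℕ) (x : (Fin (n + 2) → V) →₀ k) :
    tupleBoundary k V n (subdivision k β (n + 1) x) =
      subdivision k β n (tupleBoundary k V n x) := by
  suffices h : tupleBoundary k V n ∘ₗ subdivision k β (n + 1) =
      subdivision k β n ∘ₗ tupleBoundary k V n from LinearMap.congr_fun h x
  clear x
  refine tupleChain_hom_ext fun v => ?_
  rw [LinearMap.comp_apply, LinearMap.comp_apply, subdivision_succ_single]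
  cases n with
  | zero =>
    rw [tupleBoundary_tupleCone_zero, subdivision, LinearMap.id_apply, augmentation_tupleBoundary,
      zero_smul, sub_zero]
  | succ n =>
    rw [tupleBoundary_tupleCone, tupleBoundary_subdivision n, tupleBoundary_tupleBoundary,
      map_zero, map_zero, sub_zero]

lemma tupleBoundary_subdivisionHomotopy {n : ℕ} (x : (Fin (n + 2) → V) →₀ k) :
    tupleBoundary k V (n + 1) (subdivisionHomotopy k β (n + 1) x) =
      x - subdivision k β (n + 1) x - subdivisionHomotopy k β n (tupleBoundary k V n x) :=
  tupleBoundary_coneHomotopy (F := fun _ => LinearMap.id) β (fun _ => rfl) (fun _ _ => rfl)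
    (tupleBoundary_subdivision β) x

variable {β} {β' : ∀ n : ℕ, (Fin (n + 1) → W) → W} {g : V → W}

lemma tupleMap_subdivision (h : ∀ n v, β' n (g ∘ v) = g (β n v)) (n : ℕ)
    (x : (Fin (n + 1) → V) →₀ k) :
    tupleMap k g n (subdivision k β n x) = subdivision k β' n (tupleMap k g n x) := by
  cases n with
  | zero => rfl
  | succ n =>
    suffices e : tupleMap k g (n + 1) ∘ₗ subdivision k β (n + 1) =
        subdivision k β' (n + 1) ∘ₗ tupleMap k g (n + 1) from LinearMap.congr_fun e x
    clear x
    refine tupleChain_hom_ext fun v => ?_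
    rw [LinearMap.comp_apply, LinearMap.comp_apply, tupleMap_single, subdivision_succ_single,
      subdivision_succ_single, tupleMap_tupleCone, tupleMap_subdivision h n,
      tupleMap_tupleBoundary, tupleMap_single, h]

lemma tupleMap_subdivisionHomotopy (h : ∀ n v, β' n (g ∘ v) = g (β n v)) {n : ℕ}
    (x : (Fin (n + 1) → V) →₀ k) :
    tupleMap k g (n + 1) (subdivisionHomotopy k β n x) =
      subdivisionHomotopy k β' n (tupleMap k g n x) :=
  tupleMap_coneHomotopy β h (fun _ _ => rfl) (tupleMap_subdivision h) x

end Subdivision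

end Tuples

section Affine

variable {l m n p : ℕ} (v : Fin (m + 1) → stdSimplex ℝ (Fin (n + 1)))

/-- The affine map of standard simplices given by the images of the vertices. -/
def affineSimplex : C(stdSimplex ℝ (Fin (m + 1)), stdSimplex ℝ (Fin (n + 1))) where
  toFun t := ⟨∑ i, t.1 i • (v i).1,
    (convex_stdSimplex ℝ _).sum_mem (fun i _ => t.2.1 i) t.2.2 fun i _ => (v i).2⟩
  continuous_toFun := by
    refine Continuous.subtype_mk (continuous_finsetSum _ fun i _ => ?_) _
    exact ((continuous_apply i).comp continuous_subtype_val).smul continuous_const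

lemma affineSimplex_coe (t : stdSimplex ℝ (Fin (m + 1))) :
    (affineSimplex v t).1 = ∑ i, t.1 i • (v i).1 := rfl

lemma affineSimplex_comp (w : Fin (n + 1) → stdSimplex ℝ (Fin (p + 1))) :
    affineSimplex (affineSimplex w ∘ v) = (affineSimplex w).comp (affineSimplex v) := by
  ext t : 1
  refine Subtype.ext ?_
  rw [ContinuousMap.comp_apply, affineSimplex_coe, affineSimplex_coe]
  simp only [Function.comp_apply, affineSimplex_coe, Finset.smul_sum]
  rw [Finset.sum_comm]
  refine Finset.sum_congr rfl fun j _ => ?_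
  rw [Finset.sum_apply, Finset.sum_smul]
  exact Finset.sum_congr rfl fun i _ => smul_smul _ _ _

/-- The tuple of vertices of the standard simplex. -/
def vertices (n : ℕ) : Fin (n + 1) → stdSimplex ℝ (Fin (n + 1)) := fun i => stdSimplex.vertex i

lemma affineSimplex_vertices (n : ℕ) : affineSimplex (vertices n) = ContinuousMap.id _ := by
  ext t : 1
  refine Subtype.ext ?_
  rw [affineSimplex_coe]
  ext j
  simp [vertices, Finset.sum_apply, Pi.single_apply]

lemma affineSimplex_comp_vertices : affineSimplex v ∘ vertices m = v := by
  ext j : 1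
  refine Subtype.ext ?_
  rw [Function.comp_apply, affineSimplex_coe]
  simp [vertices, Pi.single_apply]

lemma affineSimplex_map (f : Fin (l + 1) → Fin (m + 1)) (t : stdSimplex ℝ (Fin (l + 1))) :
    affineSimplex v (stdSimplex.map f t) = affineSimplex (v ∘ f) t := by
  refine Subtype.ext ?_
  rw [affineSimplex_coe, affineSimplex_coe]
  have hc (j) : (stdSimplex.map f t).1 j = ∑ i with f i = j, t.1 i :=
    FunOnFinite.linearMap_apply_apply ..
  simp only [hc, Finset.sum_smul]
  rw [← Finset.sum_fiberwise Finset.univ f (fun i => t.1 i • ((v ∘ f) i).1)]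
  refine Finset.sum_congr rfl fun j _ => Finset.sum_congr rfl fun i hi => ?_
  rw [Function.comp_apply, (Finset.mem_filter.1 hi).2]

/-- The barycentre of a tuple of points of a simplex. -/
def barycenter (m : ℕ) (v : Fin (m + 1) → stdSimplex ℝ (Fin (n + 1))) :
    stdSimplex ℝ (Fin (n + 1)) := affineSimplex v stdSimplex.barycenter

lemma barycenter_affineSimplex (w : Fin (n + 1) → stdSimplex ℝ (Fin (p + 1))) (m : ℕ)
    (v : Fin (m + 1) → stdSimplex ℝ (Fin (n + 1))) :
    barycenter m (affineSimplex w ∘ v) = affineSimplex w (barycenter m v) := by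
  rw [barycenter, affineSimplex_comp]; rfl

lemma dist_affineSimplex_le (t : stdSimplex ℝ (Fin (m + 1)))
    (c : stdSimplex ℝ (Fin (n + 1))) {d : ℝ}
    (h : ∀ i, dist (v i) c ≤ d) : dist (affineSimplex v t) c ≤ d := by
  have : (affineSimplex v t).1 ∈ Metric.closedBall c.1 d :=
    (convex_closedBall _ _).sum_mem (fun i _ => t.2.1 i) t.2.2 fun i _ => h i
  exact this

lemma coe_barycenter_sub (c : Fin (n + 1) → ℝ) :
    (barycenter m v).1 - c = ((m : ℝ) + 1)⁻¹ • ∑ i, ((v i).1 - c) := by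
  have hm : (m : ℝ) + 1 ≠ 0 := by positivity
  have hb (i : Fin (m + 1)) : (stdSimplex.barycenter : stdSimplex ℝ (Fin (m + 1))).1 i =
      ((m : ℝ) + 1)⁻¹ := by
    simp
  rw [barycenter, affineSimplex_coe, Finset.sum_sub_distrib, smul_sub, Finset.smul_sum,
    Finset.sum_const, Finset.card_univ, Fintype.card_fin, ← Nat.cast_smul_eq_nsmul ℝ, smul_smul,
    Nat.cast_add_one, inv_mul_cancel₀ hm, one_smul]
  simp only [hb]

variable {v} in
lemma dist_barycenter_le {d : ℝ} (h : ∀ i j, dist (v i) (v j) ≤ d) (j : Fin (m + 1)) :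
    dist (v j) (barycenter m v) ≤ m / (m + 1) * d := by
  have hm : (0 : ℝ) < m + 1 := by positivity
  have hsum : ‖∑ i, ((v i).1 - (v j).1)‖ ≤ m * d := by
    rw [← Finset.add_sum_erase _ _ (Finset.mem_univ j), sub_self, zero_add]
    refine (norm_sum_le_of_le _ fun i _ => (dist_eq_norm (v i).1 (v j).1).ge.trans (h i j)).trans ?_
    simp
  rw [dist_comm, Subtype.dist_eq, dist_eq_norm, coe_barycenter_sub, norm_smul, norm_inv,
    Real.norm_of_nonneg hm.le]
  calc ((m : ℝ) + 1)⁻¹ * ‖∑ i, ((v i).1 - (v j).1)‖ ≤ ((m : ℝ) + 1)⁻¹ * (m * d) := by gcongr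
    _ = m / (m + 1) * d := by ring

end Affine

section Mesh

variable {k : Type} [CommRing k] {m n : ℕ}

/-- The `(l + 1)`-tuples of points in the convex hull of `v` with pairwise distances at most `d`. -/
def meshSet (v : Fin (m + 1) → stdSimplex ℝ (Fin (n + 1))) (l : ℕ) (d : ℝ) :
    Set (Fin (l + 1) → stdSimplex ℝ (Fin (n + 1))) :=
  {w | (∀ i, ∃ t, w i = affineSimplex v t) ∧ ∀ i j, dist (w i) (w j) ≤ d}

lemma mapDomain_mem_supported {α β : Type*} {f : α → β} {S : Set α} {T : Set β}
    (h : Set.MapsTo f S T) {x : α →₀ k} (hx : x ∈ Finsupp.supported k k S) :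
    Finsupp.mapDomain f x ∈ Finsupp.supported k k T := by
  have himage : Finsupp.lmapDomain k k f x ∈ (Finsupp.supported k k S).map
    (Finsupp.lmapDomain k k f) := ⟨x, hx, rfl⟩
  rw [Finsupp.lmapDomain_supported] at himage
  exact Finsupp.supported_mono h.image_subset himage

lemma cons_barycenter_mem_meshSet {v : Fin (m + 2) → stdSimplex ℝ (Fin (n + 1))} {d : ℝ}
    (h : ∀ i j, dist (v i) (v j) ≤ d) (i : Fin (m + 2))
    {w : Fin (m + 1) → stdSimplex ℝ (Fin (n + 1))}
    (hw : w ∈ meshSet (v ∘ i.succAbove) m (m / (m + 1) * d)) :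
    (Fin.cons (barycenter (m + 1) v) w : Fin (m + 2) → stdSimplex ℝ (Fin (n + 1))) ∈
      meshSet v (m + 1) ((m + 1 : ℕ) / ((m + 1 : ℕ) + 1) * d) := by
  have hd : 0 ≤ d := dist_nonneg.trans (h 0 0)
  have hapex (j) : dist (w j) (barycenter (m + 1) v) ≤ (m + 1 : ℕ) / ((m + 1 : ℕ) + 1) * d := by
    obtain ⟨t, ht⟩ := hw.1 j
    rw [ht]
    exact dist_affineSimplex_le _ _ _ fun a => dist_barycenter_le h _
  have hbase (a b) : dist (w a) (w b) ≤ (m + 1 : ℕ) / ((m + 1 : ℕ) + 1) * d := by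
    refine (hw.2 a b).trans (mul_le_mul_of_nonneg_right ?_ hd)
    rw [div_le_div_iff₀ (by positivity) (by positivity)]
    push_cast
    nlinarith
  constructor
  · refine Fin.cases ⟨stdSimplex.barycenter, rfl⟩ fun j => ?_
    obtain ⟨t, ht⟩ := hw.1 j
    exact ⟨stdSimplex.map i.succAbove t, by rw [Fin.cons_succ, ht, affineSimplex_map]⟩
  · refine Fin.cases (Fin.cases ?_ fun b => ?_) fun a => Fin.cases ?_ fun b => ?_
    · rw [dist_self]
      positivity
    · rw [Fin.cons_zero, Fin.cons_succ, dist_comm]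
      exact hapex b
    · exact hapex a
    · exact hbase a b

lemma subdivision_single_mem_supported_meshSet {v : Fin (m + 1) → stdSimplex ℝ (Fin (n + 1))}
    {d : ℝ} (h : ∀ i j, dist (v i) (v j) ≤ d) :
    subdivision k barycenter m (Finsupp.single v 1) ∈
      Finsupp.supported k k (meshSet v m (m / (m + 1) * d)) := by
  induction m with
  | zero =>
    refine Finsupp.single_mem_supported k _ ⟨fun i => ⟨vertices 0 i, ?_⟩, fun i j => ?_⟩
    · exact (congrFun (affineSimplex_comp_vertices v) i).symm
    · rw [Fin.fin_one_eq_zero i, Fin.fin_one_eq_zero j]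
      simp
  | succ m ih =>
    rw [subdivision_succ_single, tupleBoundary_single, map_sum, map_sum]
    refine Submodule.sum_mem _ fun i _ => ?_
    rw [map_smul, map_smul]
    exact Submodule.smul_mem _ _ (mapDomain_mem_supported
      (fun w hw => cons_barycenter_mem_meshSet h i hw) (ih fun a b => h _ _))

lemma subdivision_mem_supported_dist_le {d : ℝ}
    {x : (Fin (m + 1) → stdSimplex ℝ (Fin (n + 1))) →₀ k}
    (hx : x ∈ Finsupp.supported k k {v | ∀ i j, dist (v i) (v j) ≤ d}) :
    subdivision k barycenter m x ∈
      Finsupp.supported k k {v | ∀ i j, dist (v i) (v j) ≤ m / (m + 1) * d} := by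
  rw [Finsupp.supported_eq_span_single] at hx
  refine (Submodule.span_le (p := (Finsupp.supported k k _).comap _)).2 ?_ hx
  rintro _ ⟨v, hv, rfl⟩
  exact Finsupp.supported_mono (fun w hw => hw.2) (subdivision_single_mem_supported_meshSet hv)

lemma subdivision_iterate_mem_supported_dist_le {d : ℝ} (N : ℕ)
    {x : (Fin (m + 1) → stdSimplex ℝ (Fin (n + 1))) →₀ k}
    (hx : x ∈ Finsupp.supported k k {v | ∀ i j, dist (v i) (v j) ≤ d}) :
    (subdivision k barycenter m)^[N] x ∈
      Finsupp.supported k k {v | ∀ i j, dist (v i) (v j) ≤ ((m : ℝ) / (m + 1)) ^ N * d} := by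
  induction N with
  | zero => simpa using hx
  | succ N ih =>
    rw [Function.iterate_succ_apply', pow_succ', mul_assoc]
    exact subdivision_mem_supported_dist_le ih

lemma exists_subdivision_iterate_mem_supported_dist_lt
    (v : Fin (m + 1) → stdSimplex ℝ (Fin (n + 1))) {ε : ℝ} (hε : 0 < ε) :
    ∃ N : ℕ, (subdivision k barycenter m)^[N] (Finsupp.single v 1) ∈
      Finsupp.supported k k {v | ∀ i j, dist (v i) (v j) < ε} := by
  have h : Filter.Tendsto (fun N : ℕ => ((m : ℝ) / (m + 1)) ^ N *
      Metric.diam (Set.univ : Set (stdSimplex ℝ (Fin (n + 1))))) Filter.atTop (nhds 0) := by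
    rw [← zero_mul (Metric.diam (Set.univ : Set (stdSimplex ℝ (Fin (n + 1)))))]
    refine (tendsto_pow_atTop_nhds_zero_of_lt_one (by positivity) ?_).mul_const _
    rw [div_lt_one (by positivity)]
    linarith
  obtain ⟨N, hN⟩ := (h.eventually (gt_mem_nhds hε)).exists
  refine ⟨N, Finsupp.supported_mono (fun w hw i j => (hw i j).trans_lt hN)
    (subdivision_iterate_mem_supported_dist_le N
      (Finsupp.single_mem_supported k _ fun i j => ?_))⟩
  exact Metric.dist_le_diam_of_mem isCompact_univ.isBounded (Set.mem_univ _) (Set.mem_univ _)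

end Mesh

section Subcomplexes

variable {k : Type} [CommRing k]

lemma mapDomain_mem_supported_iff {α β : Type*} {f : α → β} (hf : Function.Injective f)
    (y : β →₀ k) :
    y ∈ Finsupp.supported k k (Set.range f) ↔ ∃ x, Finsupp.mapDomain f x = y := by
  constructor
  · exact fun h => ⟨_, Finsupp.mapDomain_comapDomain f hf y h⟩
  · rintro ⟨x, rfl⟩
    exact mapDomain_mem_supported (S := Set.univ) (fun a _ => Set.mem_range_self a) (by simp)

variable {Y : SSet.{u}} {S : ∀ n : ℕ, Set (Y _⦋n⦌)} {n : ℕ}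

/-- A chain whose boundary is supported on the given simplices: a relative cycle. In degree zero
this is no condition. -/
def IsRelCycle (S : ∀ n : ℕ, Set (Y _⦋n⦌)) {n : ℕ} (x : Y _⦋n⦌ →₀ k) : Prop :=
  match n with
  | 0 => True
  | n + 1 => boundary k Y n x ∈ Finsupp.supported k k (S n)

lemma IsCycle.isRelCycle {x : Y _⦋n⦌ →₀ k} (hx : IsCycle k x) : IsRelCycle S x := by
  cases n with
  | zero => trivial
  | succ n =>
    have hx : boundary k Y n x = 0 := hx
    change boundary k Y n x ∈ Finsupp.supported k k (S n)
    exact hx ▸ Submodule.zero_mem _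

lemma isHomologyIso_of_forall_isRelCycle {X : SSet.{u}} (i : X ⟶ Y)
    (hi : ∀ n : ℕ, Function.Injective (i.app (op ⦋n⦌)))
    (h : ∀ (n : ℕ) (x : Y _⦋n⦌ →₀ k), IsRelCycle (fun n => Set.range (i.app (op ⦋n⦌))) x →
      ∃ w, x - boundary k Y n w ∈ Finsupp.supported k k (Set.range (i.app (op ⦋n⦌)))) :
    IsHomologyIso k i := by
  rw [isHomologyIso_iff]
  intro n
  constructor
  · intro x _ y hxy
    obtain ⟨w, hw⟩ := h (n + 1) y ((mapDomain_mem_supported_iff (hi n) _).2 ⟨x, hxy⟩)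
    obtain ⟨v, hv⟩ := (mapDomain_mem_supported_iff (hi (n + 1)) _).1 hw
    refine ⟨v, Finsupp.mapDomain_injective (hi n) ?_⟩
    rw [← boundary_mapDomain, hv, map_sub, boundary_boundary, sub_zero, hxy]
  · intro y hy
    obtain ⟨w, hw⟩ := h n y hy.isRelCycle
    obtain ⟨v, hv⟩ := (mapDomain_mem_supported_iff (hi n) _).1 hw
    refine ⟨v, ?_, w, by rw [hv]; abel⟩
    cases n with
    | zero => trivial
    | succ n =>
      have hy : boundary k Y n y = 0 := hy
      refine Finsupp.mapDomain_injective (hi n) ?_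
      rw [← boundary_mapDomain, hv, map_sub, boundary_boundary, hy, sub_zero,
        Finsupp.mapDomain_zero]

end Subcomplexes

section SmallSimplices

variable {k : Type} [CommRing k] {X : TopCat.{u}} {n m p : ℕ}

/-- A singular simplex as a continuous map. -/
def asMap {n : ℕ} : (TopCat.toSSet.obj X) _⦋n⦌ ≃ C(stdSimplex ℝ (Fin (n + 1)), X) :=
  X.toSSetObjEquiv (op ⦋n⦌)

lemma asMap_δ (i : Fin (n + 2)) (σ : (TopCat.toSSet.obj X) _⦋n + 1⦌)
    (t : stdSimplex ℝ (Fin (n + 1))) :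
    asMap ((TopCat.toSSet.obj X).δ i σ) t = asMap σ (stdSimplex.map i.succAbove t) := rfl

section AffineRestriction

variable (σ : (TopCat.toSSet.obj X) _⦋n⦌) (v : Fin (m + 1) → stdSimplex ℝ (Fin (n + 1)))

/-- The restriction of a singular simplex to an affine simplex. -/
def affineRestriction : (TopCat.toSSet.obj X) _⦋m⦌ :=
  asMap.symm ((asMap σ).comp (affineSimplex v))

lemma asMap_affineRestriction :
    asMap (affineRestriction σ v) = (asMap σ).comp (affineSimplex v) := asMap.apply_symm_apply _

lemma affineRestriction_affineRestriction (w : Fin (p + 1) → stdSimplex ℝ (Fin (m + 1))) :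
    affineRestriction (affineRestriction σ v) w = affineRestriction σ (affineSimplex v ∘ w) := by
  refine asMap.injective ?_
  rw [asMap_affineRestriction, asMap_affineRestriction, asMap_affineRestriction, affineSimplex_comp,
    ContinuousMap.comp_assoc]

lemma affineRestriction_vertices : affineRestriction σ (vertices n) = σ := by
  refine asMap.injective ?_
  rw [asMap_affineRestriction, affineSimplex_vertices, ContinuousMap.comp_id]

lemma δ_affineRestriction (w : Fin (m + 2) → stdSimplex ℝ (Fin (n + 1))) (i : Fin (m + 2)) :
    (TopCat.toSSet.obj X).δ i (affineRestriction σ w) = affineRestriction σ (w ∘ i.succAbove) := by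
  refine asMap.injective (ContinuousMap.ext fun t => ?_)
  rw [asMap_δ, asMap_affineRestriction, asMap_affineRestriction, ContinuousMap.comp_apply,
    ContinuousMap.comp_apply, affineSimplex_map]

variable (k) in
/-- The chain map from affine chains in a simplex to singular chains. -/
def affineChain (m : ℕ) :
    ((Fin (m + 1) → stdSimplex ℝ (Fin (n + 1))) →₀ k) →ₗ[k] ((TopCat.toSSet.obj X) _⦋m⦌ →₀ k) :=
  Finsupp.lmapDomain k k (affineRestriction σ)

lemma affineChain_single :
    affineChain k σ m (Finsupp.single v 1) = Finsupp.single (affineRestriction σ v) 1 := by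
  rw [affineChain, Finsupp.lmapDomain_apply, Finsupp.mapDomain_single]

lemma single_eq_affineChain :
    (Finsupp.single σ 1 : _ →₀ k) = affineChain k σ n (Finsupp.single (vertices n) 1) := by
  rw [affineChain_single, affineRestriction_vertices]

lemma boundary_affineChain (x : (Fin (m + 2) → stdSimplex ℝ (Fin (n + 1))) →₀ k) :
    boundary k _ m (affineChain k σ (m + 1) x) = affineChain k σ m (tupleBoundary k _ m x) := by
  have h : boundary k _ m ∘ₗ affineChain k σ (m + 1) =
      affineChain k σ m ∘ₗ tupleBoundary k _ m := tupleChain_hom_ext fun v => by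
    rw [LinearMap.comp_apply, LinearMap.comp_apply, affineChain_single, boundary_single,
      tupleBoundary_single, map_sum]
    refine Finset.sum_congr rfl fun i _ => ?_
    rw [map_smul, affineChain_single, δ_affineRestriction]
  exact LinearMap.congr_fun h x

lemma affineChain_affineRestriction (x : (Fin (p + 1) → stdSimplex ℝ (Fin (m + 1))) →₀ k) :
    affineChain k (affineRestriction σ v) p x =
      affineChain k σ p (tupleMap k (affineSimplex v) p x) := by
  have h : affineChain k (affineRestriction σ v) p =
      affineChain k σ p ∘ₗ tupleMap k (affineSimplex v) p := tupleChain_hom_ext fun w => by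
    rw [LinearMap.comp_apply, affineChain_single, tupleMap_single, affineChain_single,
      affineRestriction_affineRestriction]
  exact LinearMap.congr_fun h x

end AffineRestriction

variable (k X) in
/-- The barycentric subdivision of singular chains. -/
def singularSubdivision (n : ℕ) :
    ((TopCat.toSSet.obj X) _⦋n⦌ →₀ k) →ₗ[k] ((TopCat.toSSet.obj X) _⦋n⦌ →₀ k) :=
  Finsupp.linearCombination k fun σ =>
    affineChain k σ n (subdivision k barycenter n (Finsupp.single (vertices n) 1))

variable (k X) in
/-- The chain homotopy between the identity and the barycentric subdivision. -/
def singularSubdivisionHomotopy (n : ℕ) :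
    ((TopCat.toSSet.obj X) _⦋n⦌ →₀ k) →ₗ[k] ((TopCat.toSSet.obj X) _⦋n + 1⦌ →₀ k) :=
  Finsupp.linearCombination k fun σ =>
    affineChain k σ (n + 1) (subdivisionHomotopy k barycenter n (Finsupp.single (vertices n) 1))

lemma singularSubdivision_affineChain (σ : (TopCat.toSSet.obj X) _⦋n⦌)
    (x : (Fin (m + 1) → stdSimplex ℝ (Fin (n + 1))) →₀ k) :
    singularSubdivision k X m (affineChain k σ m x) =
      affineChain k σ m (subdivision k barycenter m x) := by
  have h : singularSubdivision k X m ∘ₗ affineChain k σ m =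
      affineChain k σ m ∘ₗ subdivision k barycenter m := tupleChain_hom_ext fun v => by
    rw [LinearMap.comp_apply, LinearMap.comp_apply, affineChain_single, singularSubdivision,
      Finsupp.linearCombination_single, one_smul, affineChain_affineRestriction,
      tupleMap_subdivision (barycenter_affineSimplex v), tupleMap_single,
      affineSimplex_comp_vertices]
  exact LinearMap.congr_fun h x

lemma singularSubdivisionHomotopy_affineChain (σ : (TopCat.toSSet.obj X) _⦋n⦌)
    (x : (Fin (m + 1) → stdSimplex ℝ (Fin (n + 1))) →₀ k) :
    singularSubdivisionHomotopy k X m (affineChain k σ m x) =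
      affineChain k σ (m + 1) (subdivisionHomotopy k barycenter m x) := by
  have h : singularSubdivisionHomotopy k X m ∘ₗ affineChain k σ m =
      affineChain k σ (m + 1) ∘ₗ subdivisionHomotopy k barycenter m :=
    tupleChain_hom_ext fun v => by
      rw [LinearMap.comp_apply, LinearMap.comp_apply, affineChain_single,
        singularSubdivisionHomotopy, Finsupp.linearCombination_single, one_smul,
        affineChain_affineRestriction, tupleMap_subdivisionHomotopy (barycenter_affineSimplex v),
        tupleMap_single, affineSimplex_comp_vertices]
  exact LinearMap.congr_fun h x

lemma boundary_singularSubdivision (x : (TopCat.toSSet.obj X) _⦋n + 1⦌ →₀ k) :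
    boundary k _ n (singularSubdivision k X (n + 1) x) =
      singularSubdivision k X n (boundary k _ n x) := by
  have h : boundary k _ n ∘ₗ singularSubdivision k X (n + 1) =
      singularSubdivision k X n ∘ₗ boundary k _ n :=
    Finsupp.lhom_ext' fun σ => LinearMap.ext_ring <| by
      simp only [LinearMap.comp_apply, Finsupp.lsingle_apply]
      rw [single_eq_affineChain, singularSubdivision_affineChain, boundary_affineChain,
        boundary_affineChain, tupleBoundary_subdivision, singularSubdivision_affineChain]
  exact LinearMap.congr_fun h x

lemma boundary_singularSubdivisionHomotopy (x : (TopCat.toSSet.obj X) _⦋n + 1⦌ →₀ k) :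
    boundary k _ (n + 1) (singularSubdivisionHomotopy k X (n + 1) x) =
      x - singularSubdivision k X (n + 1) x -
        singularSubdivisionHomotopy k X n (boundary k _ n x) := by
  have h : boundary k _ (n + 1) ∘ₗ singularSubdivisionHomotopy k X (n + 1) =
      LinearMap.id - singularSubdivision k X (n + 1) -
        singularSubdivisionHomotopy k X n ∘ₗ boundary k _ n :=
    Finsupp.lhom_ext' fun σ => LinearMap.ext_ring <| by
      simp only [LinearMap.comp_apply, LinearMap.sub_apply, LinearMap.id_apply,
        Finsupp.lsingle_apply]
      rw [single_eq_affineChain, singularSubdivision_affineChain,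
        singularSubdivisionHomotopy_affineChain, boundary_affineChain, boundary_affineChain,
        tupleBoundary_subdivisionHomotopy, singularSubdivisionHomotopy_affineChain, map_sub,
        map_sub]
  exact LinearMap.congr_fun h x

lemma singularSubdivision_zero (x : (TopCat.toSSet.obj X) _⦋0⦌ →₀ k) :
    singularSubdivision k X 0 x = x := by
  have h : singularSubdivision k X 0 = LinearMap.id :=
    Finsupp.lhom_ext' fun σ => LinearMap.ext_ring <| by
      simp only [LinearMap.comp_apply, LinearMap.id_apply, Finsupp.lsingle_apply]
      rw [single_eq_affineChain, singularSubdivision_affineChain]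
      rfl
  exact LinearMap.congr_fun h x

variable {ι : Type*} {U : ι → Set X}

/-- The singular simplices which lie in a member of a family of subsets. -/
def smallSimplices (U : ι → Set X) (n : ℕ) : Set ((TopCat.toSSet.obj X) _⦋n⦌) :=
  {σ | ∃ i, ∀ t, asMap σ t ∈ U i}

lemma affineChain_mem_smallSimplices {σ : (TopCat.toSSet.obj X) _⦋n⦌} (hσ : σ ∈ smallSimplices U n)
    (x : (Fin (m + 1) → stdSimplex ℝ (Fin (n + 1))) →₀ k) :
    affineChain k σ m x ∈ Finsupp.supported k k (smallSimplices U m) := by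
  obtain ⟨i, hi⟩ := hσ
  have hmaps : Set.MapsTo (affineRestriction (m := m) σ) Set.univ (smallSimplices U m) :=
    fun v _ => ⟨i, fun t => by rw [asMap_affineRestriction]; exact hi _⟩
  exact mapDomain_mem_supported hmaps (by simp)

lemma linearCombination_mem {α M : Type*} [AddCommGroup M] [Module k M] {N : Submodule k M}
    {S : Set α} {f : α → M} (hf : ∀ a ∈ S, f a ∈ N) {x : α →₀ k}
    (hx : x ∈ Finsupp.supported k k S) : Finsupp.linearCombination k f x ∈ N := by
  rw [Finsupp.linearCombination_apply]
  exact Submodule.sum_mem _ fun a ha => Submodule.smul_mem _ _ (hf a (hx ha))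

lemma singularSubdivision_mem_smallSimplices {x : (TopCat.toSSet.obj X) _⦋n⦌ →₀ k}
    (hx : x ∈ Finsupp.supported k k (smallSimplices U n)) :
    singularSubdivision k X n x ∈ Finsupp.supported k k (smallSimplices U n) :=
  linearCombination_mem (fun _ hσ => affineChain_mem_smallSimplices hσ _) hx

lemma singularSubdivisionHomotopy_mem_smallSimplices {x : (TopCat.toSSet.obj X) _⦋n⦌ →₀ k}
    (hx : x ∈ Finsupp.supported k k (smallSimplices U n)) :
    singularSubdivisionHomotopy k X n x ∈ Finsupp.supported k k (smallSimplices U (n + 1)) :=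
  linearCombination_mem (fun _ hσ => affineChain_mem_smallSimplices hσ _) hx

lemma singularSubdivision_iterate_mem_smallSimplices {x : (TopCat.toSSet.obj X) _⦋n⦌ →₀ k}
    (hx : x ∈ Finsupp.supported k k (smallSimplices U n)) (N : ℕ) :
    (singularSubdivision k X n)^[N] x ∈ Finsupp.supported k k (smallSimplices U n) := by
  induction N with
  | zero => exact hx
  | succ N ih =>
    rw [Function.iterate_succ_apply']
    exact singularSubdivision_mem_smallSimplices ih

lemma singularSubdivision_iterate_single (σ : (TopCat.toSSet.obj X) _⦋n⦌) (N : ℕ) :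
    (singularSubdivision k X n)^[N] (Finsupp.single σ 1) =
      affineChain k σ n ((subdivision k barycenter n)^[N] (Finsupp.single (vertices n) 1)) := by
  induction N with
  | zero => exact single_eq_affineChain σ
  | succ N ih =>
    rw [Function.iterate_succ_apply', ih, singularSubdivision_affineChain,
      Function.iterate_succ_apply']

lemma exists_iterate_single_mem_smallSimplices (hU : ∀ i, IsOpen (U i))
    (hc : ∀ x, ∃ i, x ∈ U i) (σ : (TopCat.toSSet.obj X) _⦋n⦌) :
    ∃ N, (singularSubdivision k X n)^[N] (Finsupp.single σ 1) ∈
      Finsupp.supported k k (smallSimplices U n) := by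
  obtain ⟨δ, hδ, hball⟩ := lebesgue_number_lemma_of_metric (s := Set.univ)
    (c := fun i => asMap σ ⁻¹' U i) isCompact_univ
    (fun i => (hU i).preimage (asMap σ).continuous)
    (fun t _ => Set.mem_iUnion.2 (hc (asMap σ t)))
  obtain ⟨N, hN⟩ := exists_subdivision_iterate_mem_supported_dist_lt (k := k) (vertices n)
    (half_pos hδ)
  refine ⟨N, ?_⟩
  rw [singularSubdivision_iterate_single]
  refine mapDomain_mem_supported (fun v hv => ?_) hN
  obtain ⟨i, hi⟩ := hball (v 0) (Set.mem_univ _)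
  refine ⟨i, fun t => ?_⟩
  rw [asMap_affineRestriction]
  refine hi (Metric.mem_ball.2 ?_)
  exact (dist_affineSimplex_le v t (v 0) fun j => (hv j 0).le).trans_lt (half_lt_self hδ)

lemma exists_iterate_mem_smallSimplices (hU : ∀ i, IsOpen (U i)) (hc : ∀ x, ∃ i, x ∈ U i)
    (x : (TopCat.toSSet.obj X) _⦋n⦌ →₀ k) :
    ∃ N, (singularSubdivision k X n)^[N] x ∈ Finsupp.supported k k (smallSimplices U n) := by
  induction x using Finsupp.induction_linear with
  | zero => exact ⟨0, Submodule.zero_mem _⟩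
  | add x y hx hy =>
    obtain ⟨N, hN⟩ := hx
    obtain ⟨M, hM⟩ := hy
    refine ⟨N + M, ?_⟩
    rw [iterate_map_add]
    refine Submodule.add_mem _ ?_ ?_
    · rw [add_comm, Function.iterate_add_apply]
      exact singularSubdivision_iterate_mem_smallSimplices hN M
    · rw [Function.iterate_add_apply]
      exact singularSubdivision_iterate_mem_smallSimplices hM N
  | single σ a =>
    obtain ⟨N, hN⟩ := exists_iterate_single_mem_smallSimplices (k := k) hU hc σ
    refine ⟨N, ?_⟩
    rw [← Finsupp.smul_single_one, ← Module.End.coe_pow, map_smul, Module.End.coe_pow]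
    exact Submodule.smul_mem _ _ hN

lemma IsRelCycle.singularSubdivision_iterate {x : (TopCat.toSSet.obj X) _⦋n⦌ →₀ k}
    (hx : IsRelCycle (smallSimplices U) x) (N : ℕ) :
    IsRelCycle (smallSimplices U) ((singularSubdivision k X n)^[N] x) ∧
      ∃ w, x - (singularSubdivision k X n)^[N] x - boundary k _ n w ∈
        Finsupp.supported k k (smallSimplices U n) := by
  induction N with
  | zero => exact ⟨hx, 0, by simp⟩
  | succ N ih =>
    obtain ⟨hcycle, w, hw⟩ := ih
    rw [Function.iterate_succ_apply']
    generalize (singularSubdivision k X n)^[N] x = y at *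
    cases n with
    | zero => exact ⟨trivial, w, by rwa [singularSubdivision_zero]⟩
    | succ n =>
      have hcycle : boundary k _ n y ∈ Finsupp.supported k k (smallSimplices U n) := hcycle
      refine ⟨?_, w + singularSubdivisionHomotopy k X _ y, ?_⟩
      · change boundary k _ n _ ∈ _
        rw [boundary_singularSubdivision]
        exact singularSubdivision_mem_smallSimplices hcycle
      · rw [map_add, boundary_singularSubdivisionHomotopy]
        convert Submodule.add_mem _ hw (singularSubdivisionHomotopy_mem_smallSimplices hcycle)
          using 1
        abel

theorem isHomologyIso_of_range_eq_smallSimplices (hU : ∀ i, IsOpen (U i))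
    (hc : ∀ x, ∃ i, x ∈ U i) {S : SSet.{u}} (j : S ⟶ TopCat.toSSet.obj X)
    (hj : ∀ n : ℕ, Function.Injective (j.app (op ⦋n⦌)))
    (hr : ∀ n : ℕ, Set.range (j.app (op ⦋n⦌)) = smallSimplices U n) : IsHomologyIso k j := by
  refine isHomologyIso_of_forall_isRelCycle j hj fun n x hx => ?_
  simp only [hr] at hx ⊢
  obtain ⟨N, hN⟩ := exists_iterate_mem_smallSimplices hU hc x
  obtain ⟨-, w, hw⟩ := hx.singularSubdivision_iterate N
  refine ⟨w, ?_⟩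
  convert Submodule.add_mem _ hN hw using 1
  abel

end SmallSimplices

/-! ### Cells of the realization -/

section CharacteristicMaps

variable {Y Z : SSet.{u}} {n m : ℕ}

/-- The characteristic map `Δⁿ → |Y|` of an `n`-simplex `y`. -/
def charMap {n : ℕ} (y : Y _⦋n⦌) : C(stdSimplex ℝ (Fin (n + 1)), SSet.toTop.obj Y) :=
  asMap ((sSetTopAdj.unit.app Y).app (op ⦋n⦌) y)

lemma charMap_map (f : ⦋m⦌ ⟶ ⦋n⦌) (y : Y _⦋n⦌) (t : stdSimplex ℝ (Fin (m + 1))) :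
    charMap (Y.map f.op y) t = charMap y (stdSimplex.map f t) := by
  have h : (sSetTopAdj.unit.app Y).app (op ⦋m⦌) (Y.map f.op y) =
      (TopCat.toSSet.obj (SSet.toTop.obj Y)).map f.op ((sSetTopAdj.unit.app Y).app (op ⦋n⦌) y) :=
    (ConcreteCategory.congr_hom ((sSetTopAdj.unit.app Y).naturality f.op) y :)
  change asMap ((sSetTopAdj.unit.app Y).app (op ⦋m⦌) (Y.map f.op y)) t = _
  rw [h]
  rfl

lemma toTop_map_charMap (f : Y ⟶ Z) (y : Y _⦋n⦌) (t : stdSimplex ℝ (Fin (n + 1))) :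
    SSet.toTop.map f (charMap y t) = charMap (f.app (op ⦋n⦌) y) t := by
  have h : (sSetTopAdj.unit.app Z).app (op ⦋n⦌) (f.app (op ⦋n⦌) y) =
      (TopCat.toSSet.map (SSet.toTop.map f)).app (op ⦋n⦌)
        ((sSetTopAdj.unit.app Y).app (op ⦋n⦌) y) :=
    (ConcreteCategory.congr_hom (NatTrans.congr_app (sSetTopAdj.unit.naturality f) (op ⦋n⦌)) y :)
  change _ = asMap ((sSetTopAdj.unit.app Z).app (op ⦋n⦌) (f.app (op ⦋n⦌) y)) t
  rw [h]
  rfl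

lemma toTop_hom_ext {T : TopCat.{u}} {f g : SSet.toTop.obj Y ⟶ T}
    (h : ∀ (n : ℕ) (y : Y _⦋n⦌) (t : stdSimplex ℝ (Fin (n + 1))),
      f (charMap y t) = g (charMap y t)) : f = g := by
  apply (sSetTopAdj.homEquiv _ _).injective
  ext ⟨Δ⟩ y
  induction Δ using SimplexCategory.rec with | _ n => ?_
  rw [Adjunction.homEquiv_unit, Adjunction.homEquiv_unit]
  exact asMap.injective (ContinuousMap.ext (h n y))

lemma exists_toTop_desc (T : TopCat.{u}) (F : ∀ n, Y _⦋n⦌ → C(stdSimplex ℝ (Fin (n + 1)), T))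
    (hF : ∀ (n m : ℕ) (f : ⦋m⦌ ⟶ ⦋n⦌) (y : Y _⦋n⦌) (t),
      F m (Y.map f.op y) t = F n y (stdSimplex.map f t)) :
    ∃ g : SSet.toTop.obj Y ⟶ T, ∀ n (y : Y _⦋n⦌) t, g (charMap y t) = F n y t := by
  let φ : Y ⟶ TopCat.toSSet.obj T :=
    { app := fun Δ => TypeCat.ofHom fun y => (asMap (n := Δ.unop.len)).symm (F Δ.unop.len y)
      naturality := by
        rintro ⟨Δ⟩ ⟨Δ'⟩ f
        induction Δ using SimplexCategory.rec with | _ n => ?_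
        induction Δ' using SimplexCategory.rec with | _ m => ?_
        ext y
        exact asMap.injective (ContinuousMap.ext fun t => hF n m f.unop y t) }
  refine ⟨(sSetTopAdj.homEquiv _ _).symm φ, fun n y t => ?_⟩
  have hφ := (sSetTopAdj.homEquiv _ _).apply_symm_apply φ
  rw [Adjunction.homEquiv_unit] at hφ
  exact congrArg (fun σ => asMap σ t)
    (ConcreteCategory.congr_hom (NatTrans.congr_app hφ (op ⦋n⦌)) y)

/- A subset of `|Y|` is a map to `Prop` with the indiscrete topology, to which the universal
property of the realization applies. -/
lemma exists_forall_charMap_iff (P : ∀ n, Y _⦋n⦌ → stdSimplex ℝ (Fin (n + 1)) → Prop)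
    (hP : ∀ (n m : ℕ) (f : ⦋m⦌ ⟶ ⦋n⦌) (y : Y _⦋n⦌) (t),
      P m (Y.map f.op y) t ↔ P n y (stdSimplex.map f t)) :
    ∃ Q : SSet.toTop.obj Y → Prop, ∀ n (y : Y _⦋n⦌) t, Q (charMap y t) ↔ P n y t := by
  let _ : TopologicalSpace (ULift.{u} Prop) := ⊤
  obtain ⟨g, hg⟩ := exists_toTop_desc (Y := Y) (TopCat.of (ULift.{u} Prop))
    (fun n y => ⟨fun t => ULift.up (P n y t), continuous_top⟩)
    (fun n m f y t => ULift.ext _ _ (propext (hP n m f y t)))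
  exact ⟨fun x => (g x).down, fun n y t => iff_of_eq (congrArg ULift.down (hg n y t))⟩

lemma exists_charMap_eq (x : SSet.toTop.obj Y) :
    ∃ (n : ℕ) (y : Y _⦋n⦌) (t : stdSimplex ℝ (Fin (n + 1))), charMap y t = x := by
  let _ : TopologicalSpace (ULift.{u} Prop) := ⊤
  let f : SSet.toTop.obj Y ⟶ TopCat.of (ULift.{u} Prop) :=
    TopCat.ofHom ⟨fun x => ULift.up (∃ (n : ℕ) (y : Y _⦋n⦌) (t : stdSimplex ℝ (Fin (n + 1))),
      charMap y t = x), continuous_top⟩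
  let g : SSet.toTop.obj Y ⟶ TopCat.of (ULift.{u} Prop) :=
    TopCat.ofHom ⟨fun _ => ULift.up True, continuous_top⟩
  have h : f = g := toTop_hom_ext fun n y t =>
    ULift.ext _ _ (propext ⟨fun _ => trivial, fun _ => ⟨n, y, t, rfl⟩⟩)
  exact of_eq_true (congrArg ULift.down (ConcreteCategory.congr_hom h x))

lemma isOpen_toTop_iff (U : Set (SSet.toTop.obj Y)) :
    IsOpen U ↔ ∀ n (y : Y _⦋n⦌), IsOpen (charMap y ⁻¹' U) := by
  refine ⟨fun h n y => h.preimage (charMap y).continuous, fun h => ?_⟩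
  obtain ⟨g, hg⟩ := exists_toTop_desc (Y := Y) (TopCat.of (ULift.{u} Prop))
    (fun n y => ⟨fun t => ULift.up (charMap y t ∈ U),
      continuous_uliftUp.comp (continuous_Prop.2 (h n y))⟩)
    (fun n m f y t => congrArg (fun x => ULift.up (x ∈ U)) (charMap_map f y t))
  have hU : U = {x | (g x).down} := by
    ext x
    obtain ⟨n, y, t, rfl⟩ := exists_charMap_eq x
    exact (iff_of_eq (congrArg ULift.down (hg n y t))).symm
  rw [hU]
  exact continuous_Prop.1 (continuous_uliftDown.comp g.hom.continuous)

lemma isClosed_toTop_iff (U : Set (SSet.toTop.obj Y)) :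
    IsClosed U ↔ ∀ n (y : Y _⦋n⦌), IsClosed (charMap y ⁻¹' U) := by
  simp only [← isOpen_compl_iff, isOpen_toTop_iff, Set.preimage_compl]

end CharacteristicMaps

section Faces

variable {n m p q r : ℕ}

lemma stdSimplex_map_apply (f : Fin (n + 1) → Fin (m + 1)) (t : stdSimplex ℝ (Fin (n + 1)))
    (j : Fin (m + 1)) : (stdSimplex.map f t).1 j = ∑ i with f i = j, t.1 i :=
  FunOnFinite.linearMap_apply_apply ℝ ℝ f t.1 j

lemma stdSimplex_map_comp (f : ⦋n⦌ ⟶ ⦋m⦌) (g : ⦋m⦌ ⟶ ⦋p⦌) (t : stdSimplex ℝ (Fin (n + 1))) :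
    stdSimplex.map (f ≫ g) t = stdSimplex.map g (stdSimplex.map f t) :=
  (stdSimplex.map_comp_apply (fun i : Fin (n + 1) => f i) (fun i : Fin (m + 1) => g i) t).symm

lemma stdSimplex_map_id (t : stdSimplex ℝ (Fin (n + 1))) :
    stdSimplex.map (𝟙 ⦋n⦌ : ⦋n⦌ ⟶ ⦋n⦌) t = t := stdSimplex.map_id_apply t

/-- A point of the open simplex. -/
def IsInterior (t : stdSimplex ℝ (Fin (n + 1))) : Prop := ∀ i, 0 < t.1 i

lemma mem_range_of_stdSimplex_map_pos {f : Fin (n + 1) → Fin (m + 1)}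
    {t : stdSimplex ℝ (Fin (n + 1))} {j : Fin (m + 1)} (h : 0 < (stdSimplex.map f t).1 j) :
    j ∈ Set.range f := by
  rw [stdSimplex_map_apply] at h
  obtain ⟨i, hi, -⟩ := Finset.exists_ne_zero_of_sum_ne_zero h.ne'
  exact ⟨i, (Finset.mem_filter.1 hi).2⟩

lemma stdSimplex_map_pos_iff (f : Fin (n + 1) → Fin (m + 1)) {t : stdSimplex ℝ (Fin (n + 1))}
    (ht : IsInterior t) (j : Fin (m + 1)) : 0 < (stdSimplex.map f t).1 j ↔ j ∈ Set.range f := by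
  refine ⟨mem_range_of_stdSimplex_map_pos, ?_⟩
  rintro ⟨i, rfl⟩
  rw [stdSimplex_map_apply]
  exact Finset.sum_pos (fun i _ => ht i) ⟨i, by simp⟩

lemma epi_of_isInterior_map {f : ⦋n⦌ ⟶ ⦋m⦌} {t : stdSimplex ℝ (Fin (n + 1))}
    (h : IsInterior (stdSimplex.map f t)) : Epi f :=
  SimplexCategory.epi_iff_surjective.2 fun j => mem_range_of_stdSimplex_map_pos (h j)

lemma IsInterior.map {t : stdSimplex ℝ (Fin (n + 1))} (ht : IsInterior t) (f : ⦋n⦌ ⟶ ⦋m⦌)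
    [Epi f] : IsInterior (stdSimplex.map f t) := fun j =>
  (stdSimplex_map_pos_iff _ ht j).2 (SimplexCategory.epi_iff_surjective.1 ‹_› j)

lemma stdSimplex_map_apply_of_injective {f : Fin (n + 1) → Fin (m + 1)}
    (hf : Function.Injective f) (t : stdSimplex ℝ (Fin (n + 1))) (i : Fin (n + 1)) :
    (stdSimplex.map f t).1 (f i) = t.1 i := by
  rw [stdSimplex_map_apply, Finset.sum_eq_single i]
  · intro b hb hne
    exact absurd (hf (Finset.mem_filter.1 hb).2) hne
  · simp

lemma stdSimplex_map_injective (k : ⦋n⦌ ⟶ ⦋m⦌) [Mono k] :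
    Function.Injective (stdSimplex.map (S := ℝ) k) := by
  intro s t h
  have hk := SimplexCategory.mono_iff_injective.1 ‹Mono k›
  refine Subtype.ext (funext fun i => ?_)
  exact ((stdSimplex_map_apply_of_injective hk s i).symm.trans
    (congrArg (fun x => x.1 (k i)) h)).trans (stdSimplex_map_apply_of_injective hk t i)

lemma exists_face (t : stdSimplex ℝ (Fin (n + 1))) :
    ∃ (r : ℕ) (k : ⦋r⦌ ⟶ ⦋n⦌) (t₀ : stdSimplex ℝ (Fin (r + 1))), Mono k ∧ IsInterior t₀ ∧
      stdSimplex.map k t₀ = t := by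
  classical
  let s : Finset (Fin (n + 1)) := Finset.univ.filter fun i => t.1 i ≠ 0
  have mem_s (i) : i ∈ s ↔ t.1 i ≠ 0 := by simp [s]
  have sum_s : ∑ i ∈ s, t.1 i = 1 := by rw [Finset.sum_filter_ne_zero]; exact t.2.2
  have hs : s.card ≠ 0 := by
    intro h
    rw [Finset.card_eq_zero.1 h, Finset.sum_empty] at sum_s
    exact zero_ne_one sum_s
  obtain ⟨r, hr⟩ := Nat.exists_eq_succ_of_ne_zero hs
  let e := s.orderEmbOfFin hr
  have he : Function.Injective e := e.injective
  have hsum : ∑ i, t.1 (e i) = 1 := by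
    rw [← sum_s, ← Finset.image_orderEmbOfFin_univ s hr, Finset.sum_image he.injOn]
  let t₀ : stdSimplex ℝ (Fin (r + 1)) := ⟨fun i => t.1 (e i), fun i => t.2.1 _, hsum⟩
  refine ⟨r, SimplexCategory.mkHom e.toOrderHom, t₀, SimplexCategory.mono_iff_injective.2 he,
    fun i => (t.2.1 _).lt_of_ne' ((mem_s _).1 (Finset.orderEmbOfFin_mem s hr i)), ?_⟩
  refine Subtype.ext (funext fun j => ?_)
  by_cases hj : j ∈ Set.range e
  · obtain ⟨i, rfl⟩ := hj
    exact stdSimplex_map_apply_of_injective he t₀ i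
  · have h0 : t.1 j = 0 := by
      rw [Finset.range_orderEmbOfFin s hr, Finset.mem_coe, mem_s, not_not] at hj
      exact hj
    rw [h0]
    refine (stdSimplex_map_apply _ _ _).trans (Finset.sum_eq_zero fun i hi => ?_)
    exact absurd ⟨i, (Finset.mem_filter.1 hi).2⟩ hj

lemma exists_comp_eq_of_range_subset (f : ⦋q⦌ ⟶ ⦋n⦌) (k : ⦋r⦌ ⟶ ⦋n⦌) [Mono k]
    (h : Set.range f ⊆ Set.range k) : ∃ e : ⦋q⦌ ⟶ ⦋r⦌, e ≫ k = f := by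
  have hk : StrictMono k := k.toOrderHom.monotone.strictMono_of_injective
    (SimplexCategory.mono_iff_injective.1 ‹Mono k›)
  choose e he using fun i => h (Set.mem_range_self i)
  refine ⟨SimplexCategory.mkHom ⟨e, fun i j hij => ?_⟩, ?_⟩
  · rw [← hk.le_iff_le, he, he]
    exact f.toOrderHom.monotone hij
  · ext i : 3
    exact he i

lemma exists_comp_eq_of_map_eq_map {f : ⦋q⦌ ⟶ ⦋n⦌} {k : ⦋r⦌ ⟶ ⦋n⦌} [Mono k]
    {t : stdSimplex ℝ (Fin (q + 1))} {t₀ : stdSimplex ℝ (Fin (r + 1))} (ht : IsInterior t)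
    (h₀ : IsInterior t₀) (h : stdSimplex.map k t₀ = stdSimplex.map f t) :
    ∃ e : ⦋q⦌ ⟶ ⦋r⦌, Epi e ∧ e ≫ k = f ∧ stdSimplex.map e t = t₀ := by
  have hrange : Set.range f ⊆ Set.range k := fun j hj => by
    rw [← stdSimplex_map_pos_iff _ ht, ← h] at hj
    exact mem_range_of_stdSimplex_map_pos hj
  obtain ⟨e, he⟩ := exists_comp_eq_of_range_subset f k hrange
  have het : stdSimplex.map e t = t₀ :=
    stdSimplex_map_injective k (by rw [← stdSimplex_map_comp, he, h])
  exact ⟨e, epi_of_isInterior_map (het ▸ h₀), he, het⟩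

lemma isClosed_of_isClosed_faces {C : Set (stdSimplex ℝ (Fin (n + 1)))}
    (D : ∀ r, (⦋r⦌ ⟶ ⦋n⦌) → Set (stdSimplex ℝ (Fin (r + 1))))
    (hD : ∀ r (k : ⦋r⦌ ⟶ ⦋n⦌), IsClosed (D r k))
    (hDC : ∀ r (k : ⦋r⦌ ⟶ ⦋n⦌), Set.MapsTo (stdSimplex.map k) (D r k) C)
    (hCD : ∀ r (k : ⦋r⦌ ⟶ ⦋n⦌) [Mono k] t, IsInterior t → stdSimplex.map k t ∈ C → t ∈ D r k) :
    IsClosed C := by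
  have hC : C = ⋃ p : Σ r : Fin (n + 1), (⦋(r : ℕ)⦌ ⟶ ⦋n⦌),
      stdSimplex.map p.2 '' D p.1 p.2 := by
    refine Set.Subset.antisymm (fun t ht => ?_)
      (Set.iUnion_subset fun p => (hDC p.1 p.2).image_subset)
    obtain ⟨r, k, t₀, hk, h₀, rfl⟩ := exists_face t
    have hr : r < n + 1 := Nat.lt_succ_of_le (SimplexCategory.len_le_of_mono k)
    exact Set.mem_iUnion.2 ⟨⟨⟨r, hr⟩, k⟩, t₀, hCD r k t₀ h₀ ht, rfl⟩
  rw [hC]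
  exact isClosed_iUnion_of_finite fun p =>
    ((hD p.1 p.2).isCompact.image (stdSimplex.continuous_map _)).isClosed

end Faces

section NormalForm

variable {Y Z : SSet.{u}} {n d r : ℕ}

lemma simplex_map_comp {a b c : ℕ} (f : ⦋a⦌ ⟶ ⦋b⦌) (g : ⦋b⦌ ⟶ ⦋c⦌) (y : Y _⦋c⦌) :
    Y.map (f ≫ g).op y = Y.map f.op (Y.map g.op y) := by
  rw [op_comp, Functor.map_comp]; rfl

lemma exists_epi_of_map_eq {q : ℕ} {y : Y _⦋n⦌} {z : Y _⦋d⦌} (hz : z ∈ Y.nonDegenerate d)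
    {s : stdSimplex ℝ (Fin (d + 1))} (hs : IsInterior s) {f : ⦋q⦌ ⟶ ⦋n⦌} {τ : ⦋q⦌ ⟶ ⦋d⦌}
    {t : stdSimplex ℝ (Fin (q + 1))} (h : Y.map f.op y = Y.map τ.op z)
    (ht : stdSimplex.map τ t = s) (k : ⦋r⦌ ⟶ ⦋n⦌) [Mono k] {t₀ : stdSimplex ℝ (Fin (r + 1))}
    (h₀ : IsInterior t₀) (hk : stdSimplex.map k t₀ = stdSimplex.map f t) :
    ∃ τ₀ : ⦋r⦌ ⟶ ⦋d⦌, Epi τ₀ ∧ Y.map k.op y = Y.map τ₀.op z ∧ stdSimplex.map τ₀ t₀ = s := by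
  obtain ⟨p, a, t, -, hi, rfl⟩ := exists_face t
  rw [← stdSimplex_map_comp] at hk ht
  obtain ⟨e, hepi, he, het⟩ := exists_comp_eq_of_map_eq_map hi h₀ hk
  have hepi' : Epi (a ≫ τ) := epi_of_isInterior_map (ht ▸ hs)
  obtain ⟨d', τ', hτ', w, hw⟩ := Y.exists_nonDegenerate (Y.map k.op y)
  have hw' : Y.map (a ≫ f).op y = Y.map (e ≫ τ').op w := by
    rw [← he, simplex_map_comp, simplex_map_comp, hw]
  have hz' : Y.map (a ≫ f).op y = Y.map (a ≫ τ).op z := by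
    rw [simplex_map_comp, simplex_map_comp, h]
  obtain rfl := Y.unique_nonDegenerate_dim _ (e ≫ τ') w hw' (a ≫ τ) ⟨z, hz⟩ hz'
  have hwz := Y.unique_nonDegenerate_simplex _ (e ≫ τ') w hw' (a ≫ τ) ⟨z, hz⟩ hz'
  have hmap := Y.unique_nonDegenerate_map _ (e ≫ τ') w hw' (a ≫ τ) ⟨z, hz⟩ hz'
  exact ⟨τ', hτ', by rw [hw, hwz], by rw [← het, ← stdSimplex_map_comp, hmap, ht]⟩

/- Being related to `(z, s)` by a single span of simplicial operators is already invariant under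
simplicial operators, so it descends to `|Y|`. -/
lemma exists_epi_of_charMap_eq {y : Y _⦋n⦌} {z : Y _⦋d⦌} (hz : z ∈ Y.nonDegenerate d)
    {s : stdSimplex ℝ (Fin (d + 1))} (hs : IsInterior s) (k : ⦋r⦌ ⟶ ⦋n⦌) [Mono k]
    {t₀ : stdSimplex ℝ (Fin (r + 1))} (h₀ : IsInterior t₀)
    (h : charMap y (stdSimplex.map k t₀) = charMap z s) :
    ∃ τ₀ : ⦋r⦌ ⟶ ⦋d⦌, Epi τ₀ ∧ Y.map k.op y = Y.map τ₀.op z ∧ stdSimplex.map τ₀ t₀ = s := by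
  obtain ⟨Q, hQ⟩ := exists_forall_charMap_iff (Y := Y) (fun n y t => ∃ (q : ℕ) (f : ⦋q⦌ ⟶ ⦋n⦌)
    (τ : ⦋q⦌ ⟶ ⦋d⦌) (t' : stdSimplex ℝ (Fin (q + 1))), stdSimplex.map f t' = t ∧
      stdSimplex.map τ t' = s ∧ Y.map f.op y = Y.map τ.op z) (by
    intro n m f y t
    constructor
    · rintro ⟨q, g, τ, t', rfl, ht', hg⟩
      exact ⟨q, g ≫ f, τ, t', stdSimplex_map_comp _ _ _, ht', by rw [simplex_map_comp, hg]⟩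
    · rintro ⟨q, g, τ, t', hgt, ht', hg⟩
      obtain ⟨p, a, t, -, hi, rfl⟩ := exists_face t
      rw [← stdSimplex_map_comp] at hgt
      obtain ⟨b, k, x, hk, hx, hb⟩ := exists_face (stdSimplex.map (a ≫ f) t)
      obtain ⟨τ₀, -, hτ₀, hτs⟩ := exists_epi_of_map_eq hz hs hg ht' k hx (hb.trans hgt.symm)
      obtain ⟨e, -, he, het⟩ := exists_comp_eq_of_map_eq_map hi hx hb
      refine ⟨p, a, e ≫ τ₀, t, rfl, by rw [stdSimplex_map_comp, het, hτs], ?_⟩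
      rw [← simplex_map_comp, ← he, simplex_map_comp, hτ₀, simplex_map_comp])
  have hq : Q (charMap z s) :=
    (hQ _ z s).2 ⟨d, 𝟙 _, 𝟙 _, s, stdSimplex_map_id s, stdSimplex_map_id s, rfl⟩
  rw [← h, hQ] at hq
  obtain ⟨q, f, τ, t, hf, hτ, hfτ⟩ := hq
  exact exists_epi_of_map_eq hz hs hfτ hτ k h₀ hf.symm

lemma exists_charMap_eq_of_nonDegenerate (x : SSet.toTop.obj Y) :
    ∃ (z : Y.N) (s : stdSimplex ℝ (Fin (z.dim + 1))), IsInterior s ∧ charMap z.simplex s = x := by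
  obtain ⟨n, y, t, rfl⟩ := exists_charMap_eq x
  obtain ⟨r, k, t₀, -, h₀, rfl⟩ := exists_face t
  obtain ⟨d, τ, hτ, z, hz⟩ := Y.exists_nonDegenerate (Y.map k.op y)
  refine ⟨SSet.N.mk z.1 z.2, stdSimplex.map τ t₀, h₀.map τ, ?_⟩
  exact (charMap_map τ z.1 t₀).symm.trans
    ((congrArg (fun w => charMap w t₀) hz.symm).trans (charMap_map k y t₀))

lemma nonDegenerate_unique {y : Y _⦋n⦌} {z z' : Y.N} (τ : ⦋n⦌ ⟶ ⦋z.dim⦌) [Epi τ]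
    (hz : y = Y.map τ.op z.simplex) (τ' : ⦋n⦌ ⟶ ⦋z'.dim⦌) [Epi τ']
    (hz' : y = Y.map τ'.op z'.simplex) : z = z' := by
  obtain ⟨d, z, rfl⟩ := z.mk_surjective
  obtain ⟨d', z', rfl⟩ := z'.mk_surjective
  obtain rfl := Y.unique_nonDegenerate_dim _ τ z hz τ' z' hz'
  obtain rfl := Y.unique_nonDegenerate_simplex _ τ z hz τ' z' hz'
  rfl

lemma eq_of_charMap_eq {z z' : Y.N} {s : stdSimplex ℝ (Fin (z.dim + 1))}
    {s' : stdSimplex ℝ (Fin (z'.dim + 1))} (hs : IsInterior s) (hs' : IsInterior s')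
    (h : charMap z.simplex s = charMap z'.simplex s') : z = z' := by
  obtain ⟨τ, hτ, hz, -⟩ := exists_epi_of_charMap_eq (y := z'.simplex) z.nonDegenerate hs (𝟙 _) hs'
    (by rw [stdSimplex_map_id, h])
  exact nonDegenerate_unique τ hz (𝟙 _) rfl

lemma exists_map_eq_of_charMap_eq (i : Y ⟶ Z) [Mono i] {b : Z _⦋n⦌} {c : SSet.toTop.obj Y}
    (k : ⦋r⦌ ⟶ ⦋n⦌) [Mono k] {t₀ : stdSimplex ℝ (Fin (r + 1))} (h₀ : IsInterior t₀)
    (h : charMap b (stdSimplex.map k t₀) = SSet.toTop.map i c) :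
    ∃ a : Y _⦋r⦌, i.app _ a = Z.map k.op b ∧ charMap a t₀ = c := by
  obtain ⟨z, s, hs, rfl⟩ := exists_charMap_eq_of_nonDegenerate c
  rw [toTop_map_charMap] at h
  obtain ⟨τ, -, hb, hτ⟩ := exists_epi_of_charMap_eq
    ((SSet.nonDegenerate_iff_of_mono i z.simplex).2 z.nonDegenerate) hs k h₀ h
  refine ⟨Y.map τ.op z.simplex, (NatTrans.naturality_apply i τ.op z.simplex).trans hb.symm, ?_⟩
  rw [charMap_map, hτ]

lemma toTop_map_injective (i : Y ⟶ Z) [Mono i] : Function.Injective (SSet.toTop.map i) := by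
  intro c c' hc
  obtain ⟨n, y, t, rfl⟩ := exists_charMap_eq c'
  obtain ⟨r, k, t₀, hk, h₀, rfl⟩ := exists_face t
  rw [toTop_map_charMap] at hc
  obtain ⟨a, ha, rfl⟩ := exists_map_eq_of_charMap_eq i k h₀ hc.symm
  have hi : Function.Injective (i.app (op ⦋r⦌)) := (mono_iff_injective _).1 inferInstance
  rw [hi (ha.trans (NatTrans.naturality_apply i k.op y).symm), charMap_map]

lemma toTop_map_isClosedEmbedding (i : Y ⟶ Z) [Mono i] :
    Topology.IsClosedEmbedding (SSet.toTop.map i) := by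
  refine .of_continuous_injective_isClosedMap (SSet.toTop.map i).hom.continuous
    (toTop_map_injective i) fun C hC => (isClosed_toTop_iff _).2 fun n b => ?_
  refine isClosed_of_isClosed_faces
    (fun r k => ⋃ a : {a : Y _⦋r⦌ // i.app _ a = Z.map k.op b}, charMap a.1 ⁻¹' C)
    (fun r k => ?_) (fun r k t ht => ?_) (fun r k _ t hi ht => ?_)
  · have : Subsingleton {a : Y _⦋r⦌ // i.app _ a = Z.map k.op b} :=
      ⟨fun a a' => Subtype.ext ((mono_iff_injective (i.app (op ⦋r⦌))).1 inferInstance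
        (a.2.trans a'.2.symm))⟩
    exact isClosed_iUnion_of_finite fun a => hC.preimage (charMap a.1).continuous
  · obtain ⟨⟨a, ha⟩, hat⟩ := Set.mem_iUnion.1 ht
    refine ⟨charMap a t, hat, ?_⟩
    rw [toTop_map_charMap, ha, charMap_map]
  · obtain ⟨c, hc, hct⟩ := ht
    obtain ⟨a, ha, rfl⟩ := exists_map_eq_of_charMap_eq i k hi hct.symm
    exact Set.mem_iUnion.2 ⟨⟨a, ha⟩, hc⟩

end NormalForm

section CompactSubsets

variable {Y : SSet.{u}}

lemma isClosed_image_charMap {W : Set Y.N} (s : ∀ z : Y.N, stdSimplex ℝ (Fin (z.dim + 1)))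
    (hs : ∀ z ∈ W, IsInterior (s z)) :
    IsClosed ((fun z : Y.N => charMap z.simplex (s z)) '' W) := by
  refine (isClosed_toTop_iff _).2 fun n y => ?_
  refine isClosed_of_isClosed_faces
    (fun r k => ⋃ z : {z : Y.N // z ∈ W ∧ ∃ τ : ⦋r⦌ ⟶ ⦋z.dim⦌, Epi τ ∧
        Y.map k.op y = Y.map τ.op z.simplex},
      ⋃ τ : {τ : ⦋r⦌ ⟶ ⦋z.1.dim⦌ // Y.map k.op y = Y.map τ.op z.1.simplex},
        stdSimplex.map τ.1 ⁻¹' {s z.1}) (fun r k => ?_) (fun r k t ht => ?_) fun r k _ t hi ht => ?_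
  · have : Subsingleton {z : Y.N // z ∈ W ∧ ∃ τ : ⦋r⦌ ⟶ ⦋z.dim⦌, Epi τ ∧
        Y.map k.op y = Y.map τ.op z.simplex} := by
      refine ⟨fun ⟨z, _, τ, hτ, hz⟩ ⟨z', _, τ', hτ', hz'⟩ => Subtype.ext ?_⟩
      exact nonDegenerate_unique τ hz τ' hz'
    exact isClosed_iUnion_of_finite fun z => isClosed_iUnion_of_finite fun τ =>
      isClosed_singleton.preimage (stdSimplex.continuous_map _)
  · simp only [Set.mem_iUnion] at ht
    obtain ⟨⟨z, hz, _⟩, ⟨τ, hτ⟩, hτt⟩ := ht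
    refine ⟨z, hz, ?_⟩
    exact (charMap_map τ z.simplex t |>.trans (congrArg _ hτt)).symm.trans
      ((congrArg (fun w => charMap w t) hτ.symm).trans (charMap_map k y t))
  · obtain ⟨z, hz, hzt⟩ := ht
    obtain ⟨τ, hτ, hy, hτt⟩ := exists_epi_of_charMap_eq z.nonDegenerate (hs z hz) k hi hzt.symm
    simp only [Set.mem_iUnion]
    exact ⟨⟨z, hz, τ, hτ, hy⟩, ⟨τ, hy⟩, hτt⟩

/-- The nondegenerate simplices whose open cell meets `K`. -/
def cellsMeeting (K : Set (SSet.toTop.obj Y)) : Set Y.N :=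
  {z | ∃ s, IsInterior s ∧ charMap z.simplex s ∈ K}

/- Choosing a point of `K` in each cell that `K` meets gives a closed discrete subset of `K`. -/
lemma finite_cellsMeeting_of_isCompact {K : Set (SSet.toTop.obj Y)} (hK : IsCompact K) :
    (cellsMeeting K).Finite := by
  have hex (z : Y.N) : ∃ s : stdSimplex ℝ (Fin (z.dim + 1)),
      z ∈ cellsMeeting K → IsInterior s ∧ charMap z.simplex s ∈ K := by
    by_cases hz : z ∈ cellsMeeting K
    · exact hz.imp fun s hs _ => hs
    · exact ⟨stdSimplex.barycenter, fun h => absurd h hz⟩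
  choose s hs using hex
  let _ : TopologicalSpace (cellsMeeting K) := ⊥
  have : DiscreteTopology (cellsMeeting K) := ⟨rfl⟩
  let x : cellsMeeting K → SSet.toTop.obj Y := fun z => charMap z.1.simplex (s z.1)
  have hx : Topology.IsClosedEmbedding x := by
    refine .of_continuous_injective_isClosedMap continuous_of_discreteTopology ?_ fun C _ => ?_
    · exact fun z z' h => Subtype.ext (eq_of_charMap_eq (hs _ z.2).1 (hs _ z'.2).1 h)
    · have hC := isClosed_image_charMap (W := Subtype.val '' C) s (by
        rintro _ ⟨z, -, rfl⟩; exact (hs _ z.2).1)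
      rwa [Set.image_image] at hC
  have hcompact := hx.isCompact_preimage hK
  rw [show x ⁻¹' K = Set.univ from Set.eq_univ_of_forall fun z => (hs _ z.2).2] at hcompact
  have : CompactSpace (cellsMeeting K) := ⟨hcompact⟩
  exact finite_of_compact_of_discrete (X := cellsMeeting K)

lemma exists_finite_subcomplex {K : Set (SSet.toTop.obj Y)} (hK : IsCompact K) :
    ∃ A : Y.Subcomplex, SSet.Finite (A : SSet.{u}) ∧ K ⊆ Set.range (SSet.toTop.map A.ι) := by
  have : Finite (cellsMeeting K) := finite_cellsMeeting_of_isCompact hK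
  let A : Y.Subcomplex := ⨆ z : cellsMeeting K, z.1.subcomplex
  refine ⟨A, ?_, fun x hx => ?_⟩
  · refine (SSet.finite_iSup_iff _).2 fun z => ?_
    have hrange : z.1.subcomplex =
        SSet.Subcomplex.range (SSet.yonedaEquiv.symm z.1.simplex) := by
      rw [SSet.Subcomplex.range_eq_ofSimplex, Equiv.apply_symm_apply]
    rw [hrange]
    infer_instance
  · obtain ⟨z, s, hs, rfl⟩ := exists_charMap_eq_of_nonDegenerate x
    have hzA : z.simplex ∈ A.obj (op ⦋z.dim⦌) :=
      (le_iSup (fun z : cellsMeeting K => z.1.subcomplex) ⟨z, s, hs, hx⟩) _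
        (SSet.Subcomplex.mem_ofSimplex_obj z.simplex)
    exact ⟨charMap (Y := A) ⟨z.simplex, hzA⟩ s, toTop_map_charMap A.ι (y := ⟨z.simplex, hzA⟩) s⟩

end CompactSubsets

/-! ### Homotopy invariance and excision -/

section HomotopyInvariance

variable {k : Type} [CommRing k] {X Y : SSet.{u}}

lemma isHomologyIso_iff_chainComplexFunctor (f : X ⟶ Y) : IsHomologyIso k f ↔
    QuasiIso (((SSet.chainComplexFunctor (ModuleCat.{u} k)).obj (coefficients k)).map f) :=
  (quasiIso_iff_of_arrow_mk_iso _ _ (Arrow.isoMk ((chainsIso k).app X) ((chainsIso k).app Y)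
    ((chainsIso k).hom.naturality f).symm)).symm

lemma isHomologyIso_iff_isIso (f : X ⟶ Y) :
    IsHomologyIso k f ↔ ∀ n, IsIso (SSet.homologyMap f (coefficients.{u} k) n) := by
  rw [isHomologyIso_iff_chainComplexFunctor, quasiIso_iff]
  simp only [quasiIsoAt_iff_isIso_homologyMap]

lemma isHomologyIso_iff_of_homotopy {f g : X ⟶ Y} (H : SimplicialObject.Homotopy f g) :
    IsHomologyIso k f ↔ IsHomologyIso k g := by
  simp only [isHomologyIso_iff_isIso, H.congr_sSetHomologyMap]

lemma IsHomologyIso.of_comp_of_comp {f : X ⟶ Y} {g : Y ⟶ X} (hfg : IsHomologyIso k (f ≫ g))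
    (hgf : IsHomologyIso k (g ≫ f)) : IsHomologyIso k f := by
  rw [isHomologyIso_iff_isIso] at *
  intro n
  have hfgn := hfg n
  have hgfn := hgf n
  rw [SSet.homologyMap_comp] at hfgn hgfn
  have : Mono (SSet.homologyMap f (coefficients.{u} k) n) :=
    mono_of_mono _ (SSet.homologyMap g (coefficients.{u} k) n)
  have : Epi (SSet.homologyMap f (coefficients.{u} k) n) :=
    epi_of_epi (SSet.homologyMap g (coefficients.{u} k) n) _
  exact isIso_of_mono_of_epi _

lemma IsHomologyIso.id (X : SSet.{u}) : IsHomologyIso k (𝟙 X) := IsHomologyIso.of_isIso _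

lemma IsHomologyIso.toSSet_map_of_homotopy {X Y : TopCat.{u}} {f g : X ⟶ Y}
    (h : TopCat.Homotopy f g) (hf : IsHomologyIso k (TopCat.toSSet.map f)) :
    IsHomologyIso k (TopCat.toSSet.map g) :=
  (isHomologyIso_iff_of_homotopy h.toSSet.toSimplicialObjectHomotopy).1 hf

lemma isHomologyIso_toSSet_map {X Y : TopCat.{u}} {f : X ⟶ Y} {g : Y ⟶ X}
    (h : TopCat.Homotopy (𝟙 X) (f ≫ g)) (h' : TopCat.Homotopy (𝟙 Y) (g ≫ f)) :
    IsHomologyIso k (TopCat.toSSet.map f) := by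
  have hid (Z : TopCat.{u}) : IsHomologyIso k (TopCat.toSSet.map (𝟙 Z)) := .of_isIso _
  refine IsHomologyIso.of_comp_of_comp (g := TopCat.toSSet.map g) ?_ ?_
  · rw [← Functor.map_comp]
    exact (hid X).toSSet_map_of_homotopy h
  · rw [← Functor.map_comp]
    exact (hid Y).toSSet_map_of_homotopy h'

end HomotopyInvariance

section Excision

variable {X Y : TopCat.{u}}

/-- The simplicial set of singular simplices of `X` contained in `U`. -/
def singularSubcomplex (X : TopCat.{u}) (U : Set X) : (TopCat.toSSet.obj X).Subcomplex where
  obj Δ := {σ | ∀ t, X.toSSetObjEquiv Δ σ t ∈ U}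
  map f _ hσ t := hσ (stdSimplex.map f.unop t)

lemma mem_singularSubcomplex {U : Set X} {n : ℕ} (σ : (TopCat.toSSet.obj X) _⦋n⦌) :
    σ ∈ (singularSubcomplex X U).obj (op ⦋n⦌) ↔ ∀ t, asMap σ t ∈ U := Iff.rfl

lemma singularSubcomplex_mono {U V : Set X} (h : U ⊆ V) :
    singularSubcomplex X U ≤ singularSubcomplex X V :=
  fun _ _ hσ t => h (hσ t)

/-- The map on singular simplices induced by a map of pairs `(X, U) ⟶ (Y, V)`. -/
def singularSubcomplexMap (g : X ⟶ Y) {U : Set X} {V : Set Y} (h : Set.MapsTo g U V) :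
    (singularSubcomplex X U : SSet.{u}) ⟶ (singularSubcomplex Y V : SSet.{u}) :=
  SSet.Subcomplex.lift ((singularSubcomplex X U).ι ≫ TopCat.toSSet.map g) (by
    rintro Δ _ ⟨σ, rfl⟩ t
    exact h (σ.2 t))

/-- The map from the singular simplices of `X` to those of `Y` contained in `V`, for a map with
values in `V`. -/
def singularSubcomplexLift (g : X ⟶ Y) {V : Set Y} (h : ∀ x, g x ∈ V) :
    TopCat.toSSet.obj X ⟶ (singularSubcomplex Y V : SSet.{u}) :=
  SSet.Subcomplex.lift (TopCat.toSSet.map g) (by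
    rintro Δ _ ⟨σ, rfl⟩ t
    exact h _)

lemma isIso_of_bijective {S T : SSet.{u}} (f : S ⟶ T)
    (h : ∀ n, Function.Bijective (f.app (op ⦋n⦌))) : IsIso f := by
  rw [NatTrans.isIso_iff_isIso_app]
  rintro ⟨Δ⟩
  induction Δ using SimplexCategory.rec with | _ n => ?_
  exact (isIso_iff_bijective _).2 (h n)

lemma continuous_of_continuous_comp_of_injOn {X Y T : Type*} [TopologicalSpace X]
    [TopologicalSpace Y] [TopologicalSpace T] {g : X → Y} {U : Set X} (hU : IsOpen U)
    (hinj : Set.InjOn g U) (hopen : ∀ W ⊆ U, IsOpen W → IsOpen (g '' W)) {s : T → X}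
    (hs : ∀ t, s t ∈ U) (hgs : Continuous fun t => g (s t)) : Continuous s := by
  refine continuous_def.2 fun W hW => ?_
  have hpre : s ⁻¹' W = (fun t => g (s t)) ⁻¹' (g '' (W ∩ U)) := by
    ext t
    refine ⟨fun ht => ⟨s t, ⟨ht, hs t⟩, rfl⟩, ?_⟩
    rintro ⟨x, ⟨hx, hxU⟩, hxt⟩
    rwa [hinj hxU (hs t) hxt] at hx
  rw [hpre]
  exact (hopen _ Set.inter_subset_right (hW.inter hU)).preimage hgs

lemma isIso_singularSubcomplexMap {g : X ⟶ Y} {U : Set X} {V : Set Y} (h : Set.BijOn g U V)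
    (hU : IsOpen U) (hopen : ∀ W ⊆ U, IsOpen W → IsOpen (g '' W)) :
    IsIso (singularSubcomplexMap g h.mapsTo) := by
  refine isIso_of_bijective _ fun n => ⟨?_, ?_⟩
  · rintro ⟨σ, hσ⟩ ⟨τ, hτ⟩ e
    refine Subtype.ext (asMap.injective (ContinuousMap.ext fun t => ?_))
    exact h.injOn (hσ t) (hτ t) (congrArg (fun ρ => asMap ρ.1 t) e)
  · rintro ⟨τ, hτ⟩
    choose s hs hg using fun t => h.surjOn ((mem_singularSubcomplex τ).1 hτ t)
    have hc : Continuous s := continuous_of_continuous_comp_of_injOn hU h.injOn hopen hs <| by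
      simp only [hg]
      exact (asMap τ).continuous
    exact ⟨⟨asMap.symm ⟨s, hc⟩, hs⟩, Subtype.ext (asMap.injective (ContinuousMap.ext hg))⟩

/-- The inclusion of a subspace. -/
abbrev subspaceInclusion (U : Set X) : TopCat.of U ⟶ X :=
  TopCat.ofHom ⟨Subtype.val, continuous_subtype_val⟩

lemma isIso_singularSubcomplexLift (U : Set X) :
    IsIso (singularSubcomplexLift (subspaceInclusion U) (V := U) fun x => x.2) := by
  refine isIso_of_bijective _ fun n => ⟨?_, ?_⟩
  · intro σ τ e
    refine asMap.injective (ContinuousMap.ext fun t => Subtype.ext ?_)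
    exact congrArg (fun ρ : (singularSubcomplex X U : SSet.{u}) _⦋n⦌ => asMap (n := n) ρ.1 t) e
  · rintro ⟨τ, hτ⟩
    refine ⟨asMap.symm ⟨fun t => ⟨asMap τ t, hτ t⟩, (asMap τ).continuous.subtype_mk _⟩, ?_⟩
    exact Subtype.ext (asMap.injective (ContinuousMap.ext fun t => rfl))

variable {k : Type} [CommRing k]

lemma isHomologyIso_singularSubcomplex_sup {U V : Set X} (hU : IsOpen U) (hV : IsOpen V)
    (h : U ∪ V = Set.univ) :
    IsHomologyIso k (singularSubcomplex X U ⊔ singularSubcomplex X V).ι := by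
  refine isHomologyIso_of_range_eq_smallSimplices (U := fun b : Bool => cond b U V) ?_ ?_ _ ?_ ?_
  · rintro (_ | _)
    exacts [hV, hU]
  · intro x
    rcases (h.ge (Set.mem_univ x) : x ∈ U ∪ V) with hx | hx
    exacts [⟨true, hx⟩, ⟨false, hx⟩]
  · intro n
    exact Subtype.val_injective
  · intro n
    ext σ
    constructor
    · rintro ⟨⟨σ, hσ | hσ⟩, rfl⟩
      exacts [⟨true, hσ⟩, ⟨false, hσ⟩]
    · rintro ⟨_ | _, hσ⟩
      exacts [⟨⟨σ, Or.inr hσ⟩, rfl⟩, ⟨⟨σ, Or.inl hσ⟩, rfl⟩]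

lemma bicartSq_singularSubcomplex (U V : Set X) :
    SSet.Subcomplex.BicartSq (singularSubcomplex X (U ∩ V)) (singularSubcomplex X U)
      (singularSubcomplex X V) (singularSubcomplex X U ⊔ singularSubcomplex X V) where
  sup_eq := rfl
  inf_eq := le_antisymm (fun _ _ hσ t => ⟨hσ.1 t, hσ.2 t⟩)
    fun _ _ hσ => ⟨fun t => (hσ t).1, fun t => (hσ t).2⟩

lemma isRelHomologyIso_excision {U V : Set X} (hU : IsOpen U) (hV : IsOpen V)
    (h : U ∪ V = Set.univ) :
    IsRelHomologyIso k
      (SSet.Subcomplex.homOfLE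
        (singularSubcomplex_mono (X := X) (Set.inter_subset_right : U ∩ V ⊆ V)))
      (singularSubcomplex X U).ι
      (SSet.Subcomplex.homOfLE
        (singularSubcomplex_mono (X := X) (Set.inter_subset_left : U ∩ V ⊆ U)))
      (singularSubcomplex X V).ι := by
  have hpushout :=
    IsRelHomologyIso.of_isPushout (k := k) (bicartSq_singularSubcomplex U V).isPushout
  have hsup : IsRelHomologyIso k
      (SSet.Subcomplex.homOfLE
        (le_sup_left : singularSubcomplex X U ≤ singularSubcomplex X U ⊔ singularSubcomplex X V))
      (singularSubcomplex X U).ι (𝟙 _) (singularSubcomplex X U ⊔ singularSubcomplex X V).ι :=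
    .of_isHomologyIso rfl (.id _) (isHomologyIso_singularSubcomplex_sup hU hV h)
  exact hpushout.comp hsup

end Excision

/-! ### Attaching cells -/

/-- A neighbourhood deformation retract: the image of `j` is the zero set of `height`, and the
neighbourhood `{height < 1/2}` is deformed into it by a homotopy that does not increase `height`. -/
structure NDRPair {A B : TopCat.{u}} (j : A ⟶ B) where
  isEmbedding : Topology.IsEmbedding j
  height : C(B, ℝ)
  height_nonneg : ∀ b, 0 ≤ height b
  height_eq_zero_iff : ∀ b, height b = 0 ↔ b ∈ Set.range j
  homotopy : C(unitInterval × B, B)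
  homotopy_zero : ∀ b, homotopy (0, b) = b
  homotopy_apply : ∀ t a, homotopy (t, j a) = j a
  height_homotopy_le : ∀ t b, height (homotopy (t, b)) ≤ height b
  homotopy_one_mem : ∀ b, height b < 1 / 2 → homotopy (1, b) ∈ Set.range j

namespace NDRPair

variable {A B : TopCat.{u}} {j : A ⟶ B} (P : NDRPair j)

/-- The neighbourhood of the subspace that deforms into it. -/
def nbhd : Set B := {b | P.height b < 1 / 2}

lemma isOpen_nbhd : IsOpen P.nbhd := isOpen_lt P.height.continuous continuous_const

/-- The complement of the subspace. -/
def compl : Set B := {b | 0 < P.height b}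

lemma isOpen_compl : IsOpen P.compl := isOpen_lt continuous_const P.height.continuous

lemma height_apply (a : A) : P.height (j a) = 0 := (P.height_eq_zero_iff _).2 ⟨a, rfl⟩

lemma notMem_range {b : B} (hb : b ∈ P.compl) : b ∉ Set.range j := fun h =>
  (hb : 0 < P.height b).ne' ((P.height_eq_zero_iff b).2 h)

lemma nbhd_union_compl : P.nbhd ∪ P.compl = Set.univ := by
  refine Set.eq_univ_of_forall fun b => ?_
  rcases (P.height_nonneg b).eq_or_lt with h | h
  · exact Or.inl (h.symm.trans_lt one_half_pos)
  · exact Or.inr h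

lemma mem_nbhd (a : A) : j a ∈ P.nbhd := (P.height_apply a).trans_lt one_half_pos

variable {k : Type} [CommRing k]

lemma exists_retraction_nbhd : ∃ r : C(P.nbhd, A), ∀ b, j (r b) = P.homotopy (1, b.1) := by
  choose r hr using fun b : P.nbhd => P.homotopy_one_mem b.1 b.2
  refine ⟨⟨r, ?_⟩, hr⟩
  have hjr : j ∘ r = fun b : P.nbhd => P.homotopy (1, b.1) := funext hr
  rw [P.isEmbedding.continuous_iff, hjr]
  fun_prop

lemma isHomologyIso_singularSubcomplexLift :
    IsHomologyIso k (singularSubcomplexLift j P.mem_nbhd) := by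
  obtain ⟨r, hr⟩ := P.exists_retraction_nbhd
  let f : A ⟶ TopCat.of P.nbhd :=
    TopCat.ofHom ⟨fun a => ⟨j a, P.mem_nbhd a⟩, j.hom.continuous.subtype_mk _⟩
  let g : TopCat.of P.nbhd ⟶ A := TopCat.ofHom r
  have hfg : f ≫ g = 𝟙 A := by
    ext a
    exact P.isEmbedding.injective ((hr _).trans (P.homotopy_apply 1 a))
  have hA : TopCat.Homotopy (𝟙 A) (f ≫ g) := by
    rw [hfg]
    exact ContinuousMap.Homotopy.refl _
  have hnbhd : TopCat.Homotopy (𝟙 (TopCat.of P.nbhd)) (g ≫ f) :=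
    { toFun := fun p : unitInterval × P.nbhd =>
        ⟨P.homotopy (p.1, p.2.1), (P.height_homotopy_le p.1 p.2.1).trans_lt p.2.2⟩
      continuous_toFun := Continuous.subtype_mk (P.homotopy.continuous.comp
        (continuous_fst.prodMk (continuous_subtype_val.comp continuous_snd))) _
      map_zero_left := fun b => Subtype.ext (P.homotopy_zero b.1)
      map_one_left := fun b => Subtype.ext (hr b).symm }
  have hf : IsHomologyIso k (TopCat.toSSet.map f) := isHomologyIso_toSSet_map hA hnbhd
  have := isIso_singularSubcomplexLift P.nbhd
  have hlift := hf.comp (IsHomologyIso.of_isIso (k := k)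
    (singularSubcomplexLift (subspaceInclusion P.nbhd) (V := P.nbhd) fun x => x.2))
  exact hlift

lemma mono_toSSet_map (P : NDRPair j) : Mono (TopCat.toSSet.map j) := by
  have : Mono j := (TopCat.mono_iff_injective j).2 P.isEmbedding.injective
  infer_instance

lemma isRelHomologyIso_nbhd : IsRelHomologyIso k (TopCat.toSSet.map j)
    (singularSubcomplex B P.nbhd).ι (singularSubcomplexLift j P.mem_nbhd) (𝟙 _) :=
  have := P.mono_toSSet_map
  .of_isHomologyIso (by rw [Category.comp_id]; rfl) P.isHomologyIso_singularSubcomplexLift (.id _)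

end NDRPair

section Pushout

variable {S A D B : TopCat.{u}} {f : S ⟶ A} {j : S ⟶ D} {j' : A ⟶ B} {g : D ⟶ B}

lemma exists_or_exists_of_isPushout (sq : IsPushout f j j' g) (b : B) :
    (∃ a, j' a = b) ∨ ∃ d, g d = b :=
  Types.eq_or_eq_of_isPushout (sq.map (forget TopCat)) b

lemma exists_continuousMap_of_isPushout (sq : IsPushout f j j' g) {T : Type u}
    [TopologicalSpace T] (α : C(A, T)) (β : C(D, T)) (h : ∀ s, α (f s) = β (j s)) :
    ∃ γ : C(B, T), (∀ a, γ (j' a) = α a) ∧ ∀ d, γ (g d) = β d := by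
  have w : f ≫ TopCat.ofHom α = j ≫ TopCat.ofHom β := ConcreteCategory.hom_ext _ _ h
  exact ⟨(sq.desc _ _ w).hom, ConcreteCategory.congr_hom (sq.inl_desc _ _ w),
    ConcreteCategory.congr_hom (sq.inr_desc _ _ w)⟩

lemma eq_of_isPushout (sq : IsPushout f j j' g) {d d' : D} (hd : d ∉ Set.range j)
    (h : g d' = g d) : d' = d := by
  let _ : TopologicalSpace (ULift.{u} Prop) := ⊤
  obtain ⟨γ, -, hγ⟩ := exists_continuousMap_of_isPushout sq
    (T := ULift.{u} Prop) ⟨fun _ => ⟨False⟩, continuous_top⟩ ⟨fun x => ⟨x = d⟩, continuous_top⟩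
    fun s => congrArg ULift.up (eq_false fun hs => hd ⟨s, hs⟩).symm
  have heq : (d' = d) = (d = d) :=
    congrArg ULift.down ((hγ d').symm.trans ((congrArg γ h).trans (hγ d)))
  exact heq.mpr rfl

lemma isOpen_of_isPushout (sq : IsPushout f j j' g) {U : Set B} (hA : IsOpen (j' ⁻¹' U))
    (hD : IsOpen (g ⁻¹' U)) : IsOpen U := by
  refine (TopCat.isOpen_iff_of_isColimit _ sq.isColimit U).2 ?_
  rintro (_ | _ | _)
  · exact hA.preimage f.hom.continuous
  · exact hA
  · exact hD

namespace NDRPair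

lemma exists_height_pushout (P : NDRPair j) (sq : IsPushout f j j' g) :
    ∃ m : C(B, ℝ), (∀ a, m (j' a) = 0) ∧ ∀ d, m (g d) = P.height d := by
  obtain ⟨m, hmA, hmD⟩ := exists_continuousMap_of_isPushout sq (ContinuousMap.const A (ULift.up 0))
    ((⟨ULift.up, continuous_uliftUp⟩ : C(ℝ, ULift.{u} ℝ)).comp P.height)
    fun s => congrArg ULift.up (P.height_apply s).symm
  exact ⟨⟨fun b => (m b).down, continuous_uliftDown.comp m.continuous⟩,
    fun a => congrArg ULift.down (hmA a), fun d => congrArg ULift.down (hmD d)⟩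

/- The product of a pushout square with `unitInterval` need not be presented as a pushout, so the
homotopy is glued after currying. -/
lemma exists_homotopy_pushout (P : NDRPair j) (sq : IsPushout f j j' g) :
    ∃ H : C(unitInterval × B, B), (∀ t a, H (t, j' a) = j' a) ∧
      ∀ t d, H (t, g d) = g (P.homotopy (t, d)) := by
  obtain ⟨H, hHA, hHD⟩ := exists_continuousMap_of_isPushout sq
    (ContinuousMap.curry ⟨fun x : A × unitInterval => j' x.1, by fun_prop⟩)
    (ContinuousMap.curry ⟨fun x : D × unitInterval => g (P.homotopy (x.2, x.1)), by fun_prop⟩)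
    fun s => ContinuousMap.ext fun t => (ConcreteCategory.congr_hom sq.w s).trans
      (congrArg g (P.homotopy_apply t s)).symm
  exact ⟨⟨fun x => H x.2 x.1, by fun_prop⟩, fun t a => congrArg (fun c => c t) (hHA a),
    fun t d => congrArg (fun c => c t) (hHD d)⟩

lemma exists_pushout (P : NDRPair j) (sq : IsPushout f j j' g) (hj' : Topology.IsEmbedding j') :
    ∃ P' : NDRPair j', ∀ d, P'.height (g d) = P.height d := by
  have hw (s : S) : j' (f s) = g (j s) := ConcreteCategory.congr_hom sq.w s
  obtain ⟨m, hmA, hmD⟩ := P.exists_height_pushout sq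
  obtain ⟨H, hHA, hHD⟩ := P.exists_homotopy_pushout sq
  refine ⟨{ isEmbedding := hj', height := m, height_nonneg := ?_, height_eq_zero_iff := ?_,
            homotopy := H, homotopy_zero := ?_, homotopy_apply := hHA, height_homotopy_le := ?_,
            homotopy_one_mem := ?_ }, hmD⟩
  · intro b
    rcases exists_or_exists_of_isPushout sq b with ⟨a, rfl⟩ | ⟨d, rfl⟩
    · exact (hmA a).ge
    · exact (P.height_nonneg d).trans_eq (hmD d).symm
  · intro b
    refine ⟨fun h => ?_, fun ⟨a, ha⟩ => ha ▸ hmA a⟩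
    rcases exists_or_exists_of_isPushout sq b with ⟨a, rfl⟩ | ⟨d, rfl⟩
    · exact ⟨a, rfl⟩
    · rw [hmD, P.height_eq_zero_iff] at h
      obtain ⟨s, rfl⟩ := h
      exact ⟨f s, hw s⟩
  · intro b
    rcases exists_or_exists_of_isPushout sq b with ⟨a, rfl⟩ | ⟨d, rfl⟩
    · exact hHA 0 a
    · rw [hHD, P.homotopy_zero]
  · intro t b
    rcases exists_or_exists_of_isPushout sq b with ⟨a, rfl⟩ | ⟨d, rfl⟩
    · rw [hHA]
    · rw [hHD, hmD, hmD]
      exact P.height_homotopy_le t d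
  · intro b hb
    rcases exists_or_exists_of_isPushout sq b with ⟨a, rfl⟩ | ⟨d, rfl⟩
    · exact ⟨a, (hHA 1 a).symm⟩
    · rw [hmD] at hb
      obtain ⟨s, hs⟩ := P.homotopy_one_mem d hb
      exact ⟨f s, by rw [hw, hs, hHD]⟩

variable (P : NDRPair j) (P' : NDRPair j') (sq : IsPushout f j j' g)
  (hP : ∀ d, P'.height (g d) = P.height d)

include hP in
lemma mapsTo_nbhd : Set.MapsTo g P.nbhd P'.nbhd := fun d hd => (hP d).trans_lt hd

include sq hP in
lemma bijOn_compl : Set.BijOn g P.compl P'.compl := by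
  refine ⟨fun d hd => lt_of_lt_of_eq hd (hP d).symm,
    fun d _ d' hd' h => eq_of_isPushout sq (P.notMem_range hd') h, fun b hb => ?_⟩
  rcases exists_or_exists_of_isPushout sq b with ⟨a, rfl⟩ | ⟨d, rfl⟩
  · exact absurd ⟨a, rfl⟩ (P'.notMem_range hb)
  · exact ⟨d, lt_of_lt_of_eq hb (hP d), rfl⟩

include sq hP in
lemma bijOn_nbhd_inter_compl : Set.BijOn g (P.nbhd ∩ P.compl) (P'.nbhd ∩ P'.compl) := by
  have hbij := bijOn_compl P P' sq hP
  refine ⟨(mapsTo_nbhd P P' hP).inter_inter hbij.mapsTo,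
    hbij.injOn.mono Set.inter_subset_right, fun b hb => ?_⟩
  obtain ⟨d, hd, rfl⟩ := hbij.surjOn hb.2
  exact ⟨d, ⟨(hP d).symm.trans_lt hb.1, hd⟩, rfl⟩

include sq hP in
lemma isOpen_image_of_subset_compl {W : Set D} (hW : W ⊆ P.compl) (hWo : IsOpen W) :
    IsOpen (g '' W) := by
  refine isOpen_of_isPushout sq ?_ ?_
  · have hempty : j' ⁻¹' (g '' W) = ∅ := by
      refine Set.eq_empty_of_forall_notMem ?_
      rintro a ⟨d, hd, hda⟩
      exact P'.notMem_range ((bijOn_compl P P' sq hP).mapsTo (hW hd)) ⟨a, hda.symm⟩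
    rw [hempty]
    exact isOpen_empty
  · have himage : g ⁻¹' (g '' W) = W := by
      refine Set.Subset.antisymm ?_ (Set.subset_preimage_image g W)
      rintro d ⟨d', hd', h⟩
      rwa [eq_of_isPushout sq (P.notMem_range (hW hd')) h.symm]
    rwa [himage]

variable {k : Type} [CommRing k]

include sq in
lemma isRelHomologyIso_singularSubcomplex :
    IsRelHomologyIso k (singularSubcomplex D P.nbhd).ι (singularSubcomplex B P'.nbhd).ι
      (singularSubcomplexMap g (mapsTo_nbhd P P' hP)) (TopCat.toSSet.map g) := by
  have hcompl := bijOn_compl P P' sq hP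
  have hinter := bijOn_nbhd_inter_compl P P' sq hP
  have : IsIso (singularSubcomplexMap g hcompl.mapsTo) :=
    isIso_singularSubcomplexMap hcompl P.isOpen_compl
      fun W hW => isOpen_image_of_subset_compl P P' sq hP hW
  have : IsIso (singularSubcomplexMap g hinter.mapsTo) :=
    isIso_singularSubcomplexMap hinter (P.isOpen_nbhd.inter P.isOpen_compl)
      fun W hW => isOpen_image_of_subset_compl P P' sq hP (hW.trans Set.inter_subset_right)
  have hiso : IsRelHomologyIso k
      (SSet.Subcomplex.homOfLE
        (singularSubcomplex_mono (Set.inter_subset_right : P.nbhd ∩ P.compl ⊆ _)))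
      (SSet.Subcomplex.homOfLE
        (singularSubcomplex_mono (Set.inter_subset_right : P'.nbhd ∩ P'.compl ⊆ _)))
      (singularSubcomplexMap g hinter.mapsTo) (singularSubcomplexMap g hcompl.mapsTo) :=
    .of_isHomologyIso rfl (.of_isIso _) (.of_isIso _)
  have hD := isRelHomologyIso_excision (k := k) P.isOpen_nbhd P.isOpen_compl P.nbhd_union_compl
  have hB :=
    isRelHomologyIso_excision (k := k) P'.isOpen_nbhd P'.isOpen_compl P'.nbhd_union_compl
  exact hD.of_comp_left rfl (hiso.comp hB)

include P sq in
theorem isRelHomologyIso_of_isPushout (hj' : Topology.IsEmbedding j') :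
    IsRelHomologyIso k (TopCat.toSSet.map j) (TopCat.toSSet.map j') (TopCat.toSSet.map f)
      (TopCat.toSSet.map g) := by
  obtain ⟨P', hP⟩ := P.exists_pushout sq hj'
  have hw : TopCat.toSSet.map j ≫ TopCat.toSSet.map g =
      TopCat.toSSet.map f ≫ TopCat.toSSet.map j' := by
    rw [← Functor.map_comp, ← Functor.map_comp, sq.w]
  have hlift : singularSubcomplexLift j P.mem_nbhd ≫
      singularSubcomplexMap g (mapsTo_nbhd P P' hP) =
        TopCat.toSSet.map f ≫ singularSubcomplexLift j' P'.mem_nbhd := by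
    rw [← cancel_mono (singularSubcomplex B P'.nbhd).ι]
    exact hw
  have h := (P.isRelHomologyIso_nbhd (k := k)).comp
    (isRelHomologyIso_singularSubcomplex (k := k) P P' sq hP)
  rw [hlift, Category.id_comp] at h
  refine IsRelHomologyIso.of_comp_right hw (P'.isRelHomologyIso_nbhd (k := k)) ?_
  rwa [Category.comp_id]

end NDRPair

end Pushout

section Simplex

variable (d : ℕ)

/-- The tautological simplex of `Δ[d]`. -/
def tautSimplex : (Δ[d] : SSet.{u}) _⦋d⦌ := SSet.stdSimplex.objEquiv.symm (𝟙 _)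

lemma map_tautSimplex {n : ℕ} (f : ⦋n⦌ ⟶ ⦋d⦌) :
    (Δ[d] : SSet.{u}).map f.op (tautSimplex d) = SSet.stdSimplex.objEquiv.symm f :=
  congrArg SSet.stdSimplex.objEquiv.symm (Category.comp_id f)

lemma exists_coords : ∃ φ : C(SSet.toTop.obj (Δ[d] : SSet.{u}), stdSimplex ℝ (Fin (d + 1))),
    (∀ n (y : (Δ[d] : SSet.{u}) _⦋n⦌) t, φ (charMap y t) =
      stdSimplex.map (SSet.stdSimplex.objEquiv y) t) ∧
    (∀ x, charMap (tautSimplex d) (φ x) = x) ∧ (∀ t, φ (charMap (tautSimplex d) t) = t) := by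
  obtain ⟨g, hg⟩ := exists_toTop_desc (Y := (Δ[d] : SSet.{u}))
    (TopCat.of (ULift.{u} (stdSimplex ℝ (Fin (d + 1)))))
    (fun n y => ⟨fun t => ULift.up (stdSimplex.map (SSet.stdSimplex.objEquiv y) t),
      continuous_uliftUp.comp (stdSimplex.continuous_map _)⟩)
    fun n m f y t => congrArg ULift.up (stdSimplex_map_comp f (SSet.stdSimplex.objEquiv y) t)
  have hcoords : ∀ n (y : (Δ[d] : SSet.{u}) _⦋n⦌) t, (g (charMap y t)).down =
      stdSimplex.map (SSet.stdSimplex.objEquiv y) t := fun n y t => congrArg ULift.down (hg n y t)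
  refine ⟨⟨fun x => (g x).down, continuous_uliftDown.comp g.hom.continuous⟩, hcoords, ?_, ?_⟩
  · intro x
    obtain ⟨n, y, t, rfl⟩ := exists_charMap_eq x
    refine (congrArg _ (hcoords n y t)).trans ?_
    rw [← charMap_map, map_tautSimplex, Equiv.symm_apply_apply]
  · intro t
    exact (hcoords _ _ t).trans (stdSimplex_map_id t)

/-- Barycentric coordinates on `|Δ[d]|`. -/
def coords : C(SSet.toTop.obj (Δ[d] : SSet.{u}), stdSimplex ℝ (Fin (d + 1))) :=
  (exists_coords d).choose

lemma coords_charMap {n : ℕ} (y : (Δ[d] : SSet.{u}) _⦋n⦌) (t) : coords d (charMap y t) =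
      stdSimplex.map (SSet.stdSimplex.objEquiv y) t := (exists_coords d).choose_spec.1 n y t

lemma charMap_coords (x : SSet.toTop.obj (Δ[d] : SSet.{u})) :
    charMap (tautSimplex d) (coords d x) = x := (exists_coords d).choose_spec.2.1 x

lemma coords_charMap_tautSimplex (t) : coords.{u} d (charMap (tautSimplex d) t) = t :=
  (exists_coords d).choose_spec.2.2 t

variable {d}

/-- The point dividing the segment from `t` to `t'` in the ratio `s : 1 - s`. -/
def mix (s : unitInterval) (t t' : stdSimplex ℝ (Fin (d + 1))) : stdSimplex ℝ (Fin (d + 1)) :=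
  ⟨(1 - (s : ℝ)) • t.1 + (s : ℝ) • t'.1,
    convex_stdSimplex ℝ _ t.2 t'.2 (sub_nonneg.2 s.2.2) s.2.1 (by ring)⟩

lemma mix_apply (s : unitInterval) (t t' : stdSimplex ℝ (Fin (d + 1))) (i : Fin (d + 1)) :
    (mix s t t').1 i = (1 - (s : ℝ)) * t.1 i + (s : ℝ) * t'.1 i := rfl

lemma mix_zero (t t' : stdSimplex ℝ (Fin (d + 1))) : mix 0 t t' = t :=
  Subtype.ext (funext fun i => by rw [mix_apply]; simp)

lemma mix_one (t t' : stdSimplex ℝ (Fin (d + 1))) : mix 1 t t' = t' :=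
  Subtype.ext (funext fun i => by rw [mix_apply]; simp)

lemma mix_self (s : unitInterval) (t : stdSimplex ℝ (Fin (d + 1))) : mix s t t = t :=
  Subtype.ext (funext fun i => by rw [mix_apply]; ring)

lemma continuous_mix {X : Type*} [TopologicalSpace X] {s : X → unitInterval}
    {t t' : X → stdSimplex ℝ (Fin (d + 1))} (hs : Continuous s) (ht : Continuous t)
    (ht' : Continuous t') : Continuous fun x => mix (s x) (t x) (t' x) := by
  refine Continuous.subtype_mk ?_ _
  have hs' : Continuous fun x => (s x : ℝ) := continuous_subtype_val.comp hs
  exact ((continuous_const.sub hs').smul (continuous_subtype_val.comp ht)).add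
    (hs'.smul (continuous_subtype_val.comp ht'))

/-- The straight-line homotopy between two maps to `|Δ[d]|`. -/
def simplexHomotopy {X : TopCat.{u}} (f g : X ⟶ SSet.toTop.obj (Δ[d] : SSet.{u})) :
    TopCat.Homotopy f g where
  toFun p := charMap (tautSimplex d) (mix p.1 (coords d (f p.2)) (coords d (g p.2)))
  continuous_toFun := (charMap (tautSimplex d)).continuous.comp
    (continuous_mix continuous_fst
      ((coords d).continuous.comp (f.hom.continuous.comp continuous_snd))
      ((coords d).continuous.comp (g.hom.continuous.comp continuous_snd)))
  map_zero_left x := by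
    change charMap (tautSimplex d) (mix 0 (coords d (f x)) (coords d (g x))) = f x
    rw [mix_zero, charMap_coords]
  map_one_left x := by
    change charMap (tautSimplex d) (mix 1 (coords d (f x)) (coords d (g x))) = g x
    rw [mix_one, charMap_coords]

/-- The distance from `t` to the boundary of the simplex: the least barycentric coordinate,
normalized to be `1` at the barycenter. -/
def depth (t : stdSimplex ℝ (Fin (d + 1))) : ℝ :=
  (d + 1) * Finset.univ.inf' Finset.univ_nonempty fun i => t.1 i

lemma continuous_depth : Continuous (depth (d := d)) :=
  continuous_const.mul (Continuous.finset_inf'_apply Finset.univ_nonempty fun i _ =>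
    (continuous_apply i).comp continuous_subtype_val)

lemma depth_le (t : stdSimplex ℝ (Fin (d + 1))) (i) : depth t ≤ (d + 1) * t.1 i :=
  mul_le_mul_of_nonneg_left (Finset.inf'_le _ (Finset.mem_univ i)) (by positivity)

lemma exists_depth_eq (t : stdSimplex ℝ (Fin (d + 1))) : ∃ i, depth t = (d + 1) * t.1 i := by
  obtain ⟨i, -, hi⟩ := Finset.exists_mem_eq_inf' Finset.univ_nonempty fun i => t.1 i
  exact ⟨i, congrArg _ hi⟩

lemma depth_nonneg (t : stdSimplex ℝ (Fin (d + 1))) : 0 ≤ depth t := by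
  obtain ⟨i, hi⟩ := exists_depth_eq t
  rw [hi]
  exact mul_nonneg (by positivity) (t.2.1 i)

lemma depth_le_one (t : stdSimplex ℝ (Fin (d + 1))) : depth t ≤ 1 := by
  have hsum : ∑ i, t.1 i = 1 := t.2.2
  have h := Finset.card_nsmul_le_sum Finset.univ (fun i => (d + 1) * t.1 i) (depth t)
    fun i _ => depth_le t i
  rw [← Finset.mul_sum, hsum, Finset.card_univ, Fintype.card_fin, nsmul_eq_mul] at h
  push_cast at h
  exact le_of_mul_le_mul_left h (by positivity)

lemma depth_eq_zero_iff (t : stdSimplex ℝ (Fin (d + 1))) : depth t = 0 ↔ ∃ i, t.1 i = 0 := by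
  have hd : (d + 1 : ℝ) ≠ 0 := by positivity
  constructor
  · intro h
    obtain ⟨i, hi⟩ := exists_depth_eq t
    exact ⟨i, (mul_eq_zero_iff_left hd).1 (hi.symm.trans h)⟩
  · rintro ⟨i, hi⟩
    exact le_antisymm ((depth_le t i).trans_eq (by rw [hi, mul_zero])) (depth_nonneg t)

/-- The map of the simplex that shifts all barycentric coordinates down by the same amount and
rescales; it sends the points of depth at most `1 / 2` to the boundary. -/
def stretch (t : stdSimplex ℝ (Fin (d + 1))) : stdSimplex ℝ (Fin (d + 1)) :=
  ⟨fun i => (t.1 i - min (depth t) (1 / 2) / (d + 1)) / (1 - min (depth t) (1 / 2)), by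
    have hδ : 0 < 1 - min (depth t) (1 / 2) := by linarith [min_le_right (depth t) (1 / 2)]
    refine ⟨fun i => div_nonneg (sub_nonneg.2 ?_) hδ.le, ?_⟩
    · rw [div_le_iff₀' (by positivity)]
      exact (min_le_left _ _).trans (depth_le t i)
    · have hsum : ∑ i, t.1 i = 1 := t.2.2
      rw [← Finset.sum_div, Finset.sum_sub_distrib, hsum, Finset.sum_const, Finset.card_univ,
        Fintype.card_fin, nsmul_eq_mul, Nat.cast_add_one, mul_div_cancel₀ _ (by positivity),
        div_self hδ.ne']⟩

lemma stretch_apply (t : stdSimplex ℝ (Fin (d + 1))) (i) : (stretch t).1 i =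
    (t.1 i - min (depth t) (1 / 2) / (d + 1)) / (1 - min (depth t) (1 / 2)) := rfl

lemma continuous_stretch : Continuous (stretch (d := d)) := by
  have hδ : Continuous fun t : stdSimplex ℝ (Fin (d + 1)) => min (depth t) (1 / 2) :=
    continuous_depth.min continuous_const
  refine Continuous.subtype_mk (continuous_pi fun i => ?_) _
  refine (((continuous_apply i).comp continuous_subtype_val).sub (hδ.div_const _)).div
    (continuous_const.sub hδ) fun t => ?_
  linarith [min_le_right (depth t) (1 / 2)]

lemma stretch_eq_self {t : stdSimplex ℝ (Fin (d + 1))} (h : depth t = 0) : stretch t = t :=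
  Subtype.ext (funext fun i => by rw [stretch_apply, h]; norm_num)

lemma depth_stretch {t : stdSimplex ℝ (Fin (d + 1))} (h : depth t < 1 / 2) :
    depth (stretch t) = 0 := by
  obtain ⟨i, hi⟩ := exists_depth_eq t
  refine (depth_eq_zero_iff _).2 ⟨i, ?_⟩
  rw [stretch_apply, min_eq_left h.le, hi, mul_div_cancel_left₀ _ (by positivity), sub_self,
    zero_div]

lemma stretch_le {t : stdSimplex ℝ (Fin (d + 1))} {i} (hi : depth t = (d + 1) * t.1 i) :
    (stretch t).1 i ≤ t.1 i := by
  have hδ : 0 < 1 - min (depth t) (1 / 2) := by linarith [min_le_right (depth t) (1 / 2)]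
  have hδ' : 0 ≤ min (depth t) (1 / 2) := le_min (depth_nonneg t) one_half_pos.le
  have ht : t.1 i ≤ 1 / (d + 1) := by
    rw [le_div_iff₀' (by positivity), ← hi]
    exact depth_le_one t
  have hmul := mul_le_mul_of_nonneg_left ht hδ'
  rw [mul_one_div] at hmul
  rw [stretch_apply, div_le_iff₀ hδ]
  linarith

lemma depth_mix_stretch_le (s : unitInterval) (t : stdSimplex ℝ (Fin (d + 1))) :
    depth (mix s t (stretch t)) ≤ depth t := by
  obtain ⟨i, hi⟩ := exists_depth_eq t
  have hmix : (mix s t (stretch t)).1 i ≤ t.1 i := by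
    rw [mix_apply]
    linarith [mul_le_mul_of_nonneg_left (stretch_le hi) s.2.1]
  exact (depth_le _ i).trans ((mul_le_mul_of_nonneg_left hmix (by positivity)).trans_eq hi.symm)

lemma mem_range_boundary_iff (x : SSet.toTop.obj (Δ[d] : SSet.{u})) :
    x ∈ Set.range (SSet.toTop.map (SSet.boundary.{u} d).ι) ↔ depth (coords d x) = 0 := by
  rw [depth_eq_zero_iff]
  constructor
  · rintro ⟨x, rfl⟩
    obtain ⟨n, ⟨y, hy⟩, t, rfl⟩ := exists_charMap_eq x
    obtain ⟨i, hi⟩ := (SSet.mem_boundary_iff_notMem_range y).1 hy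
    refine ⟨i, ?_⟩
    have hcoords := (congrArg (coords d) (toTop_map_charMap (SSet.boundary.{u} d).ι
      (y := (⟨y, hy⟩ : (SSet.boundary.{u} d).obj (op ⦋n⦌))) t)).trans (coords_charMap d y t)
    refine (congrArg (fun s => s.1 i) hcoords).trans ?_
    refine (stdSimplex_map_apply _ t i).trans (Finset.sum_eq_zero fun j hj => ?_)
    exact absurd ⟨j, (Finset.mem_filter.1 hj).2⟩ hi
  · rintro ⟨i, hi⟩
    obtain ⟨r, k, t₀, -, h₀, ht⟩ := exists_face (coords d x)
    have hmem : (SSet.stdSimplex.objEquiv.symm k : (Δ[d] : SSet.{u}) _⦋r⦌) ∈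
        (SSet.boundary.{u} d).obj (op ⦋r⦌) := by
      rw [SSet.mem_boundary_iff_notMem_range]
      refine ⟨i, fun h => ?_⟩
      have hpos := (stdSimplex_map_pos_iff k h₀ i).2 h
      rw [ht, hi] at hpos
      exact lt_irrefl _ hpos
    refine ⟨charMap (Y := (SSet.boundary.{u} d : SSet.{u})) ⟨_, hmem⟩ t₀, ?_⟩
    refine (toTop_map_charMap (SSet.boundary.{u} d).ι
      (y := (⟨_, hmem⟩ : (SSet.boundary.{u} d).obj (op ⦋r⦌))) t₀).trans ?_
    change charMap (SSet.stdSimplex.objEquiv.symm k : (Δ[d] : SSet.{u}) _⦋r⦌) t₀ = x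
    rw [← map_tautSimplex, charMap_map, ht, charMap_coords]

variable (d) in
/-- The boundary of a simplex, as a neighbourhood deformation retract. -/
def boundaryNDRPair : NDRPair (SSet.toTop.map (SSet.boundary.{u} d).ι) where
  isEmbedding := (toTop_map_isClosedEmbedding _).isEmbedding
  height := ⟨fun x => depth (coords d x), continuous_depth.comp (coords d).continuous⟩
  height_nonneg x := depth_nonneg _
  height_eq_zero_iff x := (mem_range_boundary_iff x).symm
  homotopy := ⟨fun p => charMap (tautSimplex d) (mix p.1 (coords d p.2) (stretch (coords d p.2))),
    (charMap (tautSimplex d)).continuous.comp (continuous_mix continuous_fst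
      ((coords d).continuous.comp continuous_snd)
      (continuous_stretch.comp ((coords d).continuous.comp continuous_snd)))⟩
  homotopy_zero x := by
    change charMap (tautSimplex d) (mix 0 (coords d x) (stretch (coords d x))) = x
    rw [mix_zero, charMap_coords]
  homotopy_apply s a := by
    have h := (mem_range_boundary_iff _).1 ⟨a, rfl⟩
    generalize SSet.toTop.map (SSet.boundary.{u} d).ι a = x at *
    change charMap (tautSimplex d) (mix s (coords d x) (stretch (coords d x))) = x
    rw [stretch_eq_self h, mix_self, charMap_coords]
  height_homotopy_le s x := by
    refine Eq.trans_le ?_ (depth_mix_stretch_le s (coords d x))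
    exact congrArg depth (coords_charMap_tautSimplex d _)
  homotopy_one_mem x hx := by
    rw [mem_range_boundary_iff]
    refine (congrArg depth (coords_charMap_tautSimplex d _)).trans ?_
    rw [mix_one]
    exact depth_stretch hx

end Simplex

section Units

variable {k : Type} [CommRing k]

/-- The one-point simplicial set, presented as the target of the augmentation of `Δ[d]`. -/
abbrev pointSSet : SSet.{u} := (SimplicialObject.const (Type u)).obj (⊤_ (Type u))

lemma subsingleton_pointSSet (Δ : SimplexCategoryᵒᵖ) : Subsingleton (pointSSet.{u}.obj Δ) :=
  ⟨fun _ _ => (Types.terminalIso.{u}.toEquiv.injective (Subsingleton.elim _ _) : _)⟩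

lemma subsingleton_toTop_pointSSet : Subsingleton (SSet.toTop.obj pointSSet.{u}) := by
  have key : ∀ n (y : pointSSet.{u} _⦋n⦌) t (y₀ : pointSSet.{u} _⦋0⦌),
      charMap y t = charMap y₀ default := by
    intro n y t y₀
    let f : ⦋n⦌ ⟶ ⦋0⦌ := SimplexCategory.isTerminalZero.from _
    have h := subsingleton_pointSSet.{u} (op ⦋n⦌)
    have : y = pointSSet.{u}.map f.op y₀ := Subsingleton.elim _ _
    rw [this, charMap_map]
    congr 1
    exact Subsingleton.elim (α := stdSimplex ℝ (Fin 1)) _ _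
  refine ⟨fun a b => ?_⟩
  obtain ⟨n, y, t, rfl⟩ := exists_charMap_eq a
  obtain ⟨m, z, s, rfl⟩ := exists_charMap_eq b
  let y₀ : pointSSet.{u} _⦋0⦌ := y
  rw [key n y t y₀, key m z s y₀]

lemma isHomologyIso_unit_pointSSet : IsHomologyIso k (sSetTopAdj.unit.app pointSSet.{u}) := by
  have : IsIso (sSetTopAdj.unit.app pointSSet.{u}) := by
    refine isIso_of_bijective _ fun n => ⟨?_, ?_⟩
    · intro a b _
      have h := subsingleton_pointSSet.{u} (op ⦋n⦌)
      exact h.elim a b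
    · intro σ
      have h := subsingleton_toTop_pointSSet.{u}
      let y : pointSSet.{u} _⦋n⦌ := Types.terminalIso.{u}.inv PUnit.unit
      exact ⟨y, asMap.injective (ContinuousMap.ext fun t => Subsingleton.elim _ _)⟩
  exact IsHomologyIso.of_isIso _

lemma isHomologyIso_unit_stdSimplex (d : ℕ) :
    IsHomologyIso k (sSetTopAdj.unit.app (Δ[d] : SSet.{u})) := by
  let ed := SSet.Augmented.StandardSimplex.extraDegeneracy.{u} ⦋d⦌
  let f : (Δ[d] : SSet.{u}) ⟶ pointSSet.{u} := (SSet.Augmented.stdSimplex.{u}.obj ⦋d⦌).hom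
  let g : pointSSet.{u} ⟶ (Δ[d] : SSet.{u}) := ed.section_
  have hgf : g ≫ f = 𝟙 _ := ed.section_comp_hom
  have H : SimplicialObject.Homotopy (f ≫ g) (𝟙 (Δ[d] : SSet.{u})) := ed.homotopy
  have hg : IsHomologyIso k g := by
    refine IsHomologyIso.of_comp_of_comp (g := f) (by rw [hgf]; exact IsHomologyIso.id _) ?_
    exact (isHomologyIso_iff_of_homotopy H).2 (IsHomologyIso.id _)
  have hn : g ≫ sSetTopAdj.unit.app (Δ[d] : SSet.{u}) =
      sSetTopAdj.unit.app pointSSet.{u} ≫ TopCat.toSSet.map (SSet.toTop.map g) :=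
    sSetTopAdj.unit.naturality g
  refine IsHomologyIso.of_comp_left hg ?_
  rw [hn]
  refine isHomologyIso_unit_pointSSet.comp (isHomologyIso_toSSet_map (g := SSet.toTop.map f) ?_
    (simplexHomotopy _ _))
  rw [← Functor.map_comp, hgf, CategoryTheory.Functor.map_id]
  exact ContinuousMap.Homotopy.refl _

end Units

section Cells

variable {X : SSet.{u}}

lemma isPushout_cell (A : X.Subcomplex) {d : ℕ} (z : X _⦋d⦌) (hz : z ∈ X.nonDegenerate d)
    (hA : ∀ (n : ℕ) (f : ⦋n⦌ ⟶ ⦋d⦌), X.map f.op z ∈ A.obj (op ⦋n⦌) ↔ ¬ Function.Surjective f)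
    (hcov : ∀ (n : ℕ) (x : X _⦋n⦌), x ∈ A.obj (op ⦋n⦌) ∨ ∃ f : ⦋n⦌ ⟶ ⦋d⦌, X.map f.op z = x) :
    ∃ t : (SSet.boundary.{u} d : SSet.{u}) ⟶ (A : SSet.{u}),
      IsPushout t (SSet.boundary.{u} d).ι A.ι (SSet.yonedaEquiv.symm z) := by
  let t : (SSet.boundary.{u} d : SSet.{u}) ⟶ (A : SSet.{u}) :=
    SSet.Subcomplex.lift ((SSet.boundary.{u} d).ι ≫ SSet.yonedaEquiv.symm z) (by
      rintro ⟨Δ⟩ _ ⟨⟨f, hf⟩, rfl⟩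
      induction Δ using SimplexCategory.rec with | _ n => ?_
      exact (hA n (SSet.stdSimplex.objEquiv f)).2 hf)
  have w : t ≫ A.ι = (SSet.boundary.{u} d).ι ≫ SSet.yonedaEquiv.symm z := rfl
  refine ⟨t, ⟨⟨w⟩, ⟨evaluationJointlyReflectsColimits _ ?_⟩⟩⟩
  rintro ⟨Δ⟩
  induction Δ using SimplexCategory.rec with | _ n => ?_
  refine (isColimitMapCoconePushoutCoconeEquiv _ _).2 (IsPushout.isColimit ?_)
  refine Types.isPushout_of_isPullback_of_mono' ?_ ?_ ?_
  · rw [Types.isPullback_iff]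
    refine ⟨NatTrans.congr_app w _, fun _ _ h => Subtype.ext h.2, ?_⟩
    rintro ⟨x, hx⟩ f h
    obtain rfl : x = X.map (SSet.stdSimplex.objEquiv f).op z := h
    exact ⟨⟨f, (hA _ _).1 hx⟩, rfl, rfl⟩
  · refine Set.eq_univ_of_forall fun x => ?_
    rcases hcov n x with hx | ⟨f, rfl⟩
    · exact Or.inl ⟨⟨x, hx⟩, rfl⟩
    · exact Or.inr ⟨SSet.stdSimplex.objEquiv.symm f, rfl⟩
  · intro f₁ f₂ hf₁ hf₂ h
    have hepi {f : (Δ[d] : SSet.{u}) _⦋n⦌}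
        (hf : f ∉ Set.range ((SSet.boundary.{u} d).ι.app (op ⦋n⦌))) :
        Epi (SSet.stdSimplex.objEquiv f) :=
      SimplexCategory.epi_iff_surjective.2 (by_contra fun hs => hf ⟨⟨f, hs⟩, rfl⟩)
    have := hepi hf₁
    have := hepi hf₂
    have hmap : X.map (SSet.stdSimplex.objEquiv f₁).op z =
        X.map (SSet.stdSimplex.objEquiv f₂).op z := h
    exact SSet.stdSimplex.objEquiv.injective
      (X.unique_nonDegenerate_map _ _ ⟨z, hz⟩ rfl _ ⟨z, hz⟩ hmap)

lemma epi_of_map_eq_map {n d : ℕ} {z : X _⦋d⦌} (hz : z ∈ X.nonDegenerate d)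
    {e f : ⦋n⦌ ⟶ ⦋d⦌} [Epi e] (h : X.map f.op z = X.map e.op z) : Epi f := by
  obtain ⟨⟨s⟩⟩ := isSplitEpi_of_epi e
  have hs : X.map (s.section_ ≫ f).op z = z := by
    rw [simplex_map_comp, h, ← simplex_map_comp, s.id, op_id, Functor.map_id_apply]
  have : Mono (s.section_ ≫ f) := X.mono_of_nonDegenerate ⟨z, hz⟩ _ z hs
  have hid : s.section_ ≫ f = 𝟙 _ := SimplexCategory.eq_id_of_mono _
  exact (SplitEpi.mk _ hid).epi

/-- The subcomplex generated by the nondegenerate simplices other than `z`. -/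
def removeCell (z : X.N) : X.Subcomplex := ⨆ w : {w : X.N // w ≠ z}, w.1.subcomplex

lemma map_mem_removeCell {z w : X.N} (h : w ≠ z) {n : ℕ} (f : ⦋n⦌ ⟶ ⦋w.dim⦌) :
    X.map f.op w.simplex ∈ (removeCell z).obj (op ⦋n⦌) :=
  (le_iSup (fun w : {w : X.N // w ≠ z} => w.1.subcomplex) ⟨w, h⟩) _
    ((SSet.Subcomplex.mem_ofSimplex_obj_iff _ _).2 ⟨f, rfl⟩)

lemma notMem_removeCell {z : X.N} (hmax : ∀ w : X.N, w.dim ≤ z.dim) :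
    z.simplex ∉ (removeCell z).obj (op ⦋z.dim⦌) := by
  intro h
  obtain ⟨⟨w, hw⟩, h⟩ : ∃ w : {w : X.N // w ≠ z},
      z.simplex ∈ w.1.subcomplex.obj (op ⦋z.dim⦌) := by
    simpa only [removeCell, Subfunctor.iSup_obj, Set.mem_iUnion] using h
  obtain ⟨f, hf⟩ := (SSet.Subcomplex.mem_ofSimplex_obj_iff _ _).1 h
  obtain ⟨d, z, rfl⟩ := z.mk_surjective
  obtain ⟨d', w, rfl⟩ := w.mk_surjective
  change ⦋d⦌ ⟶ ⦋d'⦌ at f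
  replace hf : X.map f.op w.1 = z.1 := hf
  have := X.mono_of_nonDegenerate z f w.1 hf
  obtain rfl : d = d' :=
    le_antisymm (SimplexCategory.len_le_of_mono f) (hmax (SSet.N.mk w.1 w.2))
  obtain rfl := SimplexCategory.eq_id_of_mono f
  rw [op_id, Functor.map_id_apply] at hf
  obtain rfl : w = z := Subtype.ext hf
  exact hw rfl

lemma map_mem_removeCell_iff {z : X.N} (hmax : ∀ w : X.N, w.dim ≤ z.dim) {n : ℕ}
    (f : ⦋n⦌ ⟶ ⦋z.dim⦌) :
    X.map f.op z.simplex ∈ (removeCell z).obj (op ⦋n⦌) ↔ ¬ Function.Surjective f := by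
  refine ⟨fun hmem hf => notMem_removeCell hmax ?_, fun hf => ?_⟩
  · have : Epi f := SimplexCategory.epi_iff_surjective.2 hf
    obtain ⟨⟨s⟩⟩ := isSplitEpi_of_epi f
    have h := (removeCell z).map s.section_.op hmem
    rwa [Set.mem_preimage, ← simplex_map_comp, s.id, op_id, Functor.map_id_apply] at h
  · obtain ⟨p, e, _, w, hw⟩ := X.exists_nonDegenerate (X.map f.op z.simplex)
    rw [hw]
    refine map_mem_removeCell (w := SSet.N.mk w.1 w.2) ?_ e
    rintro rfl
    exact hf (SimplexCategory.epi_iff_surjective.1 (epi_of_map_eq_map w.2 hw))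

lemma exists_isPushout_removeCell {z : X.N} (hmax : ∀ w : X.N, w.dim ≤ z.dim) :
    ∃ t : (SSet.boundary.{u} z.dim : SSet.{u}) ⟶ (removeCell z : SSet.{u}),
      IsPushout t (SSet.boundary.{u} z.dim).ι (removeCell z).ι
        (SSet.yonedaEquiv.symm z.simplex) := by
  refine isPushout_cell (removeCell z) z.simplex z.nonDegenerate
    (fun n f => map_mem_removeCell_iff hmax f) fun n x => ?_
  obtain ⟨p, e, _, w, rfl⟩ := X.exists_nonDegenerate x
  by_cases h : SSet.N.mk w.1 w.2 = z
  · subst h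
    exact Or.inr ⟨e, rfl⟩
  · exact Or.inl (map_mem_removeCell (w := SSet.N.mk w.1 w.2) h e)

lemma card_removeCell_lt [X.Finite] {z : X.N} (hmax : ∀ w : X.N, w.dim ≤ z.dim) :
    Nat.card (removeCell z : SSet.{u}).N < Nat.card X.N := by
  have hfin : Finite X.N := SSet.Finite.finite
  let F (s : (removeCell z : SSet.{u}).N) : X.N :=
    SSet.N.mk ((removeCell z).ι.app _ s.simplex)
      ((SSet.nonDegenerate_iff_of_mono _ _).2 s.nonDegenerate)
  have hF : Function.Injective F := by
    intro s s' h
    obtain ⟨d, s, rfl⟩ := s.mk_surjective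
    obtain ⟨d', s', rfl⟩ := s'.mk_surjective
    obtain rfl : d = d' := congrArg (fun x : X.N => x.dim) h
    have hS : SSet.S.mk s.1.1 = SSet.S.mk s'.1.1 := congrArg SSet.N.toS h
    obtain rfl : s = s' := Subtype.ext (Subtype.ext (by injection hS))
    rfl
  have hz : z ∉ Set.range F := by
    rintro ⟨s, hs⟩
    have hnot (w : X.N) (hw : w = z) : w.simplex ∉ (removeCell z).obj (op ⦋w.dim⦌) := by
      subst hw
      exact notMem_removeCell hmax
    exact hnot _ hs s.simplex.2
  have : Finite (removeCell z : SSet.{u}).N := Finite.of_injective F hF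
  have := Fintype.ofFinite X.N
  have := Fintype.ofFinite (removeCell z : SSet.{u}).N
  rw [Nat.card_eq_fintype_card, Nat.card_eq_fintype_card]
  exact Fintype.card_lt_of_injective_of_notMem F hF hz

end Cells

section Comparison

variable {k : Type} [CommRing k]

lemma unit_naturality {Y Z : SSet.{u}} (f : Y ⟶ Z) : f ≫ sSetTopAdj.unit.app Z =
    sSetTopAdj.unit.app Y ≫ TopCat.toSSet.map (SSet.toTop.map f) :=
  sSetTopAdj.unit.naturality f

lemma isHomologyIso_unit_of_isPushout {X : SSet.{u}} (A : X.Subcomplex) {d : ℕ}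
    {t : (SSet.boundary.{u} d : SSet.{u}) ⟶ (A : SSet.{u})} {ζ : (Δ[d] : SSet.{u}) ⟶ X}
    (sq : IsPushout t (SSet.boundary.{u} d).ι A.ι ζ)
    (hA : IsHomologyIso k (sSetTopAdj.unit.app (A : SSet.{u})))
    (hb : IsHomologyIso k (sSetTopAdj.unit.app (SSet.boundary.{u} d : SSet.{u}))) :
    IsHomologyIso k (sSetTopAdj.unit.app X) := by
  have hemb := (toTop_map_isClosedEmbedding A.ι).isEmbedding
  have := (boundaryNDRPair.{u} d).mono_toSSet_map
  have : Mono (TopCat.toSSet.map (SSet.toTop.map A.ι)) := by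
    have : Mono (SSet.toTop.map A.ι) := (TopCat.mono_iff_injective _).2 hemb.injective
    infer_instance
  have hunit : IsRelHomologyIso k (SSet.boundary.{u} d).ι (TopCat.toSSet.map (SSet.toTop.map
      (SSet.boundary.{u} d).ι)) (sSetTopAdj.unit.app (SSet.boundary.{u} d : SSet.{u}))
      (sSetTopAdj.unit.app (Δ[d] : SSet.{u})) :=
    .of_isHomologyIso (unit_naturality _) hb (isHomologyIso_unit_stdSimplex d)
  have hcomp := hunit.comp
    ((boundaryNDRPair.{u} d).isRelHomologyIso_of_isPushout (sq.map SSet.toTop) hemb)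
  rw [← unit_naturality, ← unit_naturality] at hcomp
  have hX : IsRelHomologyIso k A.ι (TopCat.toSSet.map (SSet.toTop.map A.ι))
      (sSetTopAdj.unit.app (A : SSet.{u})) (sSetTopAdj.unit.app X) :=
    .of_comp_left (.of_isPushout sq) (unit_naturality _) hcomp
  exact hX.isHomologyIso hA

lemma isHomologyIso_unit_of_isEmpty {X : SSet.{u}} (h : IsEmpty X.N) :
    IsHomologyIso k (sSetTopAdj.unit.app X) := by
  have : IsIso (sSetTopAdj.unit.app X) := by
    refine isIso_of_bijective _ fun n => ⟨fun x => ?_, fun σ => ?_⟩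
    · obtain ⟨_, _, _, w, -⟩ := X.exists_nonDegenerate x
      exact h.elim (SSet.N.mk w.1 w.2)
    · obtain ⟨z, -⟩ := exists_charMap_eq_of_nonDegenerate (asMap σ stdSimplex.barycenter)
      exact h.elim z
  exact .of_isIso _

lemma isHomologyIso_unit_of_hasDimensionLT (D : ℕ) (X : SSet.{u}) [X.Finite]
    [X.HasDimensionLT D] : IsHomologyIso k (sSetTopAdj.unit.app X) := by
  induction D generalizing X with
  | zero =>
    refine isHomologyIso_unit_of_isEmpty ⟨fun z => ?_⟩
    exact absurd (X.dim_lt_of_nonDegenerate ⟨z.simplex, z.nonDegenerate⟩ 0) (Nat.not_lt_zero _)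
  | succ D ihD =>
    induction hN : Nat.card X.N using Nat.strong_induction_on generalizing X with | _ N ihN => ?_
    rcases isEmpty_or_nonempty X.N with h | h
    · exact isHomologyIso_unit_of_isEmpty h
    have hfin : Finite X.N := SSet.Finite.finite
    obtain ⟨z, hz⟩ := Finite.exists_max fun z : X.N => z.dim
    obtain ⟨t, sq⟩ := exists_isPushout_removeCell hz
    have hd : z.dim ≤ D := X.dim_le_of_nonDegenerate ⟨z.simplex, z.nonDegenerate⟩ D
    have : SSet.HasDimensionLT (SSet.boundary.{u} z.dim : SSet.{u}) D :=
      SSet.hasDimensionLT_of_le _ z.dim D hd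
    exact isHomologyIso_unit_of_isPushout _ sq
      (ihN _ (hN ▸ card_removeCell_lt hz) (removeCell z) rfl) (ihD _)

lemma isHomologyIso_unit_of_finite (X : SSet.{u}) [X.Finite] :
    IsHomologyIso k (sSetTopAdj.unit.app X) := by
  obtain ⟨D, _⟩ := X.hasDimensionLT_of_finite
  exact isHomologyIso_unit_of_hasDimensionLT D X

lemma toSSet_map_injective {A B : TopCat.{u}} {j : A ⟶ B} (hj : Function.Injective j) (n : ℕ) :
    Function.Injective ((TopCat.toSSet.map j).app (op ⦋n⦌)) := fun _ _ h =>
  asMap.injective (ContinuousMap.ext fun t => hj (congrArg (fun ρ => asMap ρ t) h))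

lemma mem_range_toSSet_map {A B : TopCat.{u}} {j : A ⟶ B} (hj : Topology.IsEmbedding j) {n : ℕ}
    {σ : (TopCat.toSSet.obj B) _⦋n⦌} (hσ : Set.range (asMap σ) ⊆ Set.range j) :
    σ ∈ Set.range ((TopCat.toSSet.map j).app (op ⦋n⦌)) := by
  choose s hs using fun t => hσ ⟨t, rfl⟩
  have hs' : j ∘ s = asMap σ := funext hs
  have hcont : Continuous s := by
    rw [hj.continuous_iff, hs']
    exact (asMap σ).continuous
  exact ⟨asMap.symm ⟨s, hcont⟩, asMap.injective (ContinuousMap.ext hs)⟩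

lemma IsCycle.of_mapDomain {X Y : SSet.{u}} {f : X ⟶ Y}
    (hf : ∀ n, Function.Injective (f.app (op ⦋n⦌))) {n : ℕ} {x : X _⦋n⦌ →₀ k}
    (hx : IsCycle k (Finsupp.mapDomain (f.app (op ⦋n⦌)) x)) : IsCycle k x := by
  cases n with
  | zero => trivial
  | succ n =>
    refine Finsupp.mapDomain_injective (hf n) ?_
    rw [Finsupp.mapDomain_zero]
    exact (boundary_mapDomain f n x).symm.trans hx

lemma mapDomain_unit {Y Z : SSet.{u}} (f : Y ⟶ Z) {n : ℕ} (y : Y _⦋n⦌ →₀ k) :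
    Finsupp.mapDomain ((sSetTopAdj.unit.app Z).app (op ⦋n⦌))
        (Finsupp.mapDomain (f.app (op ⦋n⦌)) y) =
      Finsupp.mapDomain ((TopCat.toSSet.map (SSet.toTop.map f)).app (op ⦋n⦌))
        (Finsupp.mapDomain ((sSetTopAdj.unit.app Y).app (op ⦋n⦌)) y) := by
  rw [← Finsupp.mapDomain_comp, ← Finsupp.mapDomain_comp]
  exact congrArg (fun φ => Finsupp.mapDomain φ y) (funext fun a =>
    (ConcreteCategory.congr_hom (NatTrans.congr_app (unit_naturality f) (op ⦋n⦌)) a :))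

/-- Every class in the singular homology of `|Y|` is simplicial, since its support is compact and
hence lies in a finite subcomplex. -/
theorem exists_simplicial_cycle (Y : SSet.{u}) {n : ℕ}
    (x : (TopCat.toSSet.obj (SSet.toTop.obj Y)) _⦋n⦌ →₀ k) (hx : IsCycle k x) :
    ∃ y : Y _⦋n⦌ →₀ k, IsCycle k y ∧ ∃ w,
      x = Finsupp.mapDomain ((sSetTopAdj.unit.app Y).app (op ⦋n⦌)) y + boundary k _ n w := by
  have hK : IsCompact (⋃ σ ∈ x.support, Set.range (asMap σ)) :=
    x.support.isCompact_biUnion fun σ _ => isCompact_range (asMap σ).continuous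
  obtain ⟨A, _, hKA⟩ := exists_finite_subcomplex hK
  have hemb := (toTop_map_isClosedEmbedding A.ι).isEmbedding
  have hinj := toSSet_map_injective hemb.injective
  obtain ⟨x', rfl⟩ := (mapDomain_mem_supported_iff (hinj n) x).1 fun σ hσ =>
    mem_range_toSSet_map hemb ((Set.subset_biUnion_of_mem hσ).trans hKA)
  obtain ⟨y, hy, w, rfl⟩ := ((isHomologyIso_iff _).1
    (isHomologyIso_unit_of_finite (k := k) (A : SSet.{u})) n).2 x' (hx.of_mapDomain hinj)
  refine ⟨Finsupp.mapDomain (A.ι.app (op ⦋n⦌)) y, hy.map A.ι,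
    Finsupp.mapDomain ((TopCat.toSSet.map (SSet.toTop.map A.ι)).app (op ⦋n + 1⦌)) w, ?_⟩
  rw [boundary_mapDomain, Finsupp.mapDomain_add]
  exact congrArg (· + _) (mapDomain_unit A.ι y).symm

end Comparison

theorem isHomologyIso_toTop_of_retraction {k : Type} [CommRing k] {X Y : SSet.{u}} (i : X ⟶ Y)
    (r : Y ⟶ X) (hr : i ≫ r = 𝟙 X)
    (h : ∀ (n : ℕ) (y : Y _⦋n⦌ →₀ k), IsCycle k y →
      ∃ w, boundary k Y n w = y - Finsupp.mapDomain ((r ≫ i).app (op ⦋n⦌)) y) :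
    IsHomologyIso k (TopCat.toSSet.map (SSet.toTop.map i)) := by
  let I := TopCat.toSSet.map (SSet.toTop.map i)
  let R := TopCat.toSSet.map (SSet.toTop.map r)
  have hR : I ≫ R = 𝟙 _ := by
    rw [← Functor.map_comp, ← Functor.map_comp, hr,
      CategoryTheory.Functor.map_id, CategoryTheory.Functor.map_id]
  refine (isHomologyIso_iff _).2 fun n => ⟨fun x _ y hxy => ?_, fun x hx => ?_⟩
  · refine ⟨Finsupp.mapDomain (R.app (op ⦋n + 1⦌)) y, ?_⟩
    rw [boundary_mapDomain, ← hxy, ← Finsupp.mapDomain_comp]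
    have hRI : ⇑(R.app (op ⦋n⦌)) ∘ ⇑(I.app (op ⦋n⦌)) = id :=
      funext fun σ => ConcreteCategory.congr_hom (congr_app hR (op ⦋n⦌)) σ
    exact (congrArg (fun g => Finsupp.mapDomain g x) hRI).trans Finsupp.mapDomain_id
  · obtain ⟨y, hy, w, rfl⟩ := exists_simplicial_cycle Y x hx
    obtain ⟨w', hw'⟩ := h n y hy
    let z := Finsupp.mapDomain (r.app (op ⦋n⦌)) y
    have hyz : Finsupp.mapDomain (i.app (op ⦋n⦌)) z + boundary k Y n w' = y := by
      rw [hw', ← Finsupp.mapDomain_comp]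
      exact add_sub_cancel _ _
    refine ⟨Finsupp.mapDomain ((sSetTopAdj.unit.app X).app (op ⦋n⦌)) z, (hy.map r).map _,
      Finsupp.mapDomain ((sSetTopAdj.unit.app Y).app (op ⦋n + 1⦌)) w' + w, ?_⟩
    rw [map_add, boundary_mapDomain, ← mapDomain_unit, ← add_assoc, ← Finsupp.mapDomain_add]
    exact congrArg (fun y => Finsupp.mapDomain _ y + _) hyz.symm

/-! ### Transfer along the kernel of an idempotent endomorphism -/

section Edges

variable {K : Type u} [CommGroup K]

lemma prod_ite_inv_mul {m : ℕ} (v : Fin (m + 1) → K) {s t : Fin (m + 1)} (h : s ≤ t) :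
    (∏ j : Fin m, if s ≤ j.castSucc ∧ j.succ ≤ t then (v j.castSucc)⁻¹ * v j.succ else 1) =
      (v s)⁻¹ * v t := by
  rcases h.eq_or_lt with rfl | hlt
  · rw [inv_mul_cancel]
    exact Finset.prod_eq_one fun j _ => if_neg fun hj => (hj.2.trans hj.1).not_gt j.castSucc_lt_succ
  · obtain ⟨a, rfl⟩ := Fin.exists_castSucc_eq.2 (hlt.trans_le (Fin.le_last t)).ne
    obtain ⟨b, rfl⟩ := Fin.exists_succ_eq.2 ((Fin.zero_le _).trans_lt hlt).ne'
    rw [← div_eq_inv_mul, ← Fin.prod_Icc_div (Fin.castSucc_lt_succ_iff.1 hlt) v,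
      ← Finset.prod_ite_mem_eq (Finset.Icc a b)]
    refine Finset.prod_congr rfl fun j _ => ?_
    simp only [Finset.mem_Icc, Fin.castSucc_le_castSucc_iff, Fin.succ_le_succ_iff, div_eq_inv_mul]

variable [TopologicalSpace K]

lemma latticeHom_ext {n : ℕ} {ρ σ : Multiplicative (Fin n → ℤ) →ₜ* K}
    (h : ∀ i, ρ (Multiplicative.ofAdd (Pi.single i 1)) = σ (Multiplicative.ofAdd (Pi.single i 1))) :
    ρ = σ := by
  have : ρ.toMonoidHom.toAdditiveRight = σ.toMonoidHom.toAdditiveRight :=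
    AddMonoidHom.functions_ext' _ _ _ fun i => AddMonoidHom.ext_int (h i)
  exact ContinuousMonoidHom.toMonoidHom_injective (MonoidHom.toAdditiveRight.injective this)

/-- The homomorphism `ℤⁿ → K` whose values on the basis are the edges of a tuple of points. -/
def edges {n : ℕ} (v : Fin (n + 1) → K) : Multiplicative (Fin n → ℤ) →ₜ* K where
  toFun a := ∏ i, ((v i.castSucc)⁻¹ * v i.succ) ^ a.toAdd i
  map_one' := by simp
  map_mul' a b := by simp [zpow_add, Finset.prod_mul_distrib]
  continuous_toFun := continuous_of_discreteTopology

@[simp]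
lemma edges_single {n : ℕ} (v : Fin (n + 1) → K) (i : Fin n) :
    edges v (Multiplicative.ofAdd (Pi.single i 1)) = (v i.castSucc)⁻¹ * v i.succ := by
  change ∏ j, ((v j.castSucc)⁻¹ * v j.succ) ^ (Pi.single i 1 : Fin n → ℤ) j = _
  rw [Finset.prod_eq_single i]
  · simp
  · intro j _ hj
    simp [Pi.single_eq_of_ne hj]
  · simp

lemma edges_comp_pushforwardHom {n m : ℕ} (v : Fin (m + 1) → K)
    (f : Fin (n + 1) →o Fin (m + 1)) :
    (edges v).comp (pushforwardHom ℤ f) = edges (v ∘ f) := by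
  refine latticeHom_ext fun i => ?_
  rw [edges_single]
  refine Eq.trans ?_ (prod_ite_inv_mul v (f.monotone i.castSucc_lt_succ.le))
  change ∏ j, _ ^ pushforward ℤ f (Pi.single i 1) j = _
  refine Finset.prod_congr rfl fun j _ => ?_
  rw [pushforward_apply, Finset.sum_eq_single i]
  · split_ifs <;> simp
  · intro i' _ hi'
    simp [Pi.single_eq_of_ne hi']
  · simp

lemma edges_surjective (n : ℕ) : Function.Surjective (edges (K := K) (n := n)) := fun ρ =>
  ⟨Fin.partialProd fun i => ρ (Multiplicative.ofAdd (Pi.single i 1)),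
    latticeHom_ext fun i => by rw [edges_single, Fin.partialProd_right_inv]⟩

lemma edges_mul_left {n : ℕ} (c : K) (v : Fin (n + 1) → K) :
    edges ((fun y => c * y) ∘ v) = edges v :=
  latticeHom_ext fun i => by simp [mul_assoc]

lemma edges_map_mul (φ : K →ₜ* K) (g : K) {n : ℕ} (v : Fin (n + 1) → K) :
    edges ((fun y => φ y * g) ∘ v) = φ.comp (edges v) :=
  latticeHom_ext fun i => by
    refine Eq.trans ?_ (congrArg φ (edges_single v i)).symm
    rw [edges_single, map_mul, map_inv, Function.comp_apply, Function.comp_apply, ← div_eq_inv_mul,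
      ← div_eq_inv_mul, mul_div_mul_right_eq_div]

lemma exists_eq_mul_left_of_edges_eq {n : ℕ} {v v' : Fin (n + 1) → K} (h : edges v = edges v') :
    ∃ c, v' = (fun y => c * y) ∘ v := by
  refine ⟨v' 0 * (v 0)⁻¹, funext fun i => ?_⟩
  induction i using Fin.induction with
  | zero => simp
  | succ i ih =>
    have hedge : (v i.castSucc)⁻¹ * v i.succ = (v' i.castSucc)⁻¹ * v' i.succ := by
      rw [← edges_single, ← edges_single, h]
    rw [eq_inv_mul_iff_mul_eq, ih] at hedge
    rw [← hedge]
    simp [mul_assoc]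

end Edges

/-- Postcomposition with a continuous homomorphism of the targets. -/
def homSSetPost (A : Type) [AddCommGroup A] [TopologicalSpace A] [IsTopologicalAddGroup A]
    {G G' : Type u} [Group G] [TopologicalSpace G] [Group G'] [TopologicalSpace G']
    (φ : G →ₜ* G') : homSSet A G ⟶ homSSet A G' where
  app _ := TypeCat.ofHom fun ρ => φ.comp ρ
  naturality _ _ _ := rfl

section Transfer

/-- The map that sends a tuple of points of `K` to its edges. It identifies `homSSet ℤ K` with the
quotient of the simplicial set of tuples by the translations of `K`. -/
def edgesSSetMap (K : Type u) [CommGroup K] [TopologicalSpace K] :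
    tupleSSet K ⟶ homSSet ℤ K where
  app _ := TypeCat.ofHom edges
  naturality _ _ f := by
    ext v
    exact (edges_comp_pushforwardHom v f.unop.toOrderHom).symm

variable (k : Type) [CommRing k] {K : Type u} [CommGroup K] [TopologicalSpace K]

/-- The map on chains induced by `edgesSSetMap`. -/
def edgesMap (n : ℕ) : ((Fin (n + 1) → K) →₀ k) →ₗ[k] ((homSSet ℤ K) _⦋n⦌ →₀ k) :=
  Finsupp.lmapDomain k k ((edgesSSetMap K).app (op ⦋n⦌))

/-- A linear section of `edgesMap`; it is not a chain map. -/
def liftTuples (n : ℕ) : ((homSSet ℤ K) _⦋n⦌ →₀ k) →ₗ[k] ((Fin (n + 1) → K) →₀ k) :=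
  Finsupp.lmapDomain k k (Function.surjInv (edges_surjective n))

variable {k}

lemma edgesMap_single {n : ℕ} (v : Fin (n + 1) → K) :
    edgesMap k n (Finsupp.single v 1) = Finsupp.single ((edgesSSetMap K).app (op ⦋n⦌) v) 1 :=
  Finsupp.mapDomain_single

lemma boundary_edgesMap {n : ℕ} (x : (Fin (n + 2) → K) →₀ k) :
    boundary k (homSSet ℤ K) n (edgesMap k (n + 1) x) = edgesMap k n (tupleBoundary k K n x) :=
  boundary_mapDomain (edgesSSetMap K) n x

lemma edgesMap_liftTuples {n : ℕ} (x : (homSSet ℤ K) _⦋n⦌ →₀ k) :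
    edgesMap k n (liftTuples k n x) = x := by
  have hsection : (edgesSSetMap K).app (op ⦋n⦌) ∘ Function.surjInv (edges_surjective n) = id :=
    funext (Function.surjInv_eq (edges_surjective n))
  exact Finsupp.mapDomain_comp.symm.trans
    ((congrArg (fun f => Finsupp.mapDomain f x) hsection).trans Finsupp.mapDomain_id)

lemma edgesMap_tupleMap_mul_left {n : ℕ} (c : K) (x : (Fin (n + 1) → K) →₀ k) :
    edgesMap k n (tupleMap k (fun y => c * y) n x) = edgesMap k n x := by
  suffices h : edgesMap k n ∘ₗ tupleMap k (fun y => c * y) n = edgesMap k n from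
    LinearMap.congr_fun h x
  refine tupleChain_hom_ext fun v => ?_
  rw [LinearMap.comp_apply, tupleMap_single, edgesMap_single, edgesMap_single]
  exact congrArg (fun σ => Finsupp.single σ 1) (edges_mul_left c v)

lemma edgesMap_tupleMap_map_mul (φ : K →ₜ* K) (g : K) {n : ℕ} (x : (Fin (n + 1) → K) →₀ k) :
    edgesMap k n (tupleMap k (fun y => φ y * g) n x) =
      Finsupp.mapDomain ((homSSetPost ℤ φ).app (op ⦋n⦌)) (edgesMap k n x) := by
  suffices h : edgesMap k n ∘ₗ tupleMap k (fun y => φ y * g) n =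
      Finsupp.lmapDomain k k ((homSSetPost ℤ φ).app (op ⦋n⦌)) ∘ₗ edgesMap k n from
    LinearMap.congr_fun h x
  refine tupleChain_hom_ext fun v => ?_
  rw [LinearMap.comp_apply, LinearMap.comp_apply, tupleMap_single, edgesMap_single,
    edgesMap_single]
  refine Eq.trans ?_ Finsupp.mapDomain_single.symm
  exact congrArg (fun σ => Finsupp.single σ 1) (edges_map_mul φ g v)

lemma apply_liftTuples_edgesMap {n : ℕ} {M : Type*} [AddCommGroup M] [Module k M]
    {Φ : ((Fin (n + 1) → K) →₀ k) →ₗ[k] M}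
    (hΦ : ∀ (c : K) x, Φ (tupleMap k (fun y => c * y) n x) = Φ x) (x : (Fin (n + 1) → K) →₀ k) :
    Φ (liftTuples k n (edgesMap k n x)) = Φ x := by
  suffices h : Φ ∘ₗ liftTuples k n ∘ₗ edgesMap k n = Φ from LinearMap.congr_fun h x
  refine tupleChain_hom_ext fun v => ?_
  obtain ⟨c, hc⟩ := exists_eq_mul_left_of_edges_eq
    (Function.surjInv_eq (edges_surjective n) (edges v)).symm
  rw [LinearMap.comp_apply, LinearMap.comp_apply, edgesMap_single, ← hΦ c (Finsupp.single v 1),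
    tupleMap_single, ← hc]
  exact congrArg Φ Finsupp.mapDomain_single

variable (k) (φ : K →ₜ* K)

/-- The sum over the kernel of `φ` of the homotopies of the maps `y ↦ φ y * g`. Summing makes it
invariant under translations, so that it descends to chains of `homSSet ℤ K`. -/
def kernelHomotopy (n : ℕ) :
    ((Fin (n + 1) → K) →₀ k) →ₗ[k] ((homSSet ℤ K) _⦋n + 1⦌ →₀ k) :=
  ∑ᶠ g : φ.toMonoidHom.ker, edgesMap k (n + 1) ∘ₗ mapHomotopy k (fun y => φ y * g) n

variable {k φ}

lemma kernelHomotopy_apply [Fintype φ.toMonoidHom.ker] {n : ℕ} (x : (Fin (n + 1) → K) →₀ k) :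
    kernelHomotopy k φ n x =
      ∑ g : φ.toMonoidHom.ker, edgesMap k (n + 1) (mapHomotopy k (fun y => φ y * g) n x) := by
  rw [kernelHomotopy, finsum_eq_sum_of_fintype, LinearMap.sum_apply]
  rfl

lemma kernelHomotopy_tupleMap_mul_left [Finite φ.toMonoidHom.ker] (hφ : ∀ x, φ (φ x) = φ x)
    {n : ℕ} (c : K) (x : (Fin (n + 1) → K) →₀ k) :
    kernelHomotopy k φ n (tupleMap k (fun y => c * y) n x) = kernelHomotopy k φ n x := by
  have := Fintype.ofFinite φ.toMonoidHom.ker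
  rw [kernelHomotopy_apply, kernelHomotopy_apply]
  let c' : φ.toMonoidHom.ker := ⟨c * (φ c)⁻¹, by
    change φ (c * (φ c)⁻¹) = 1
    rw [map_mul, map_inv, hφ, mul_inv_cancel]⟩
  refine (Fintype.sum_equiv (Equiv.mulLeft c') _ _ fun g => ?_).symm
  rw [← tupleMap_mapHomotopy (r := fun y => φ y * g) fun y => ?_, edgesMap_tupleMap_mul_left]
  calc c * (φ y * g) = (φ c * (φ c)⁻¹) * (c * (φ y * g)) := by rw [mul_inv_cancel, one_mul]
    _ = φ c * φ y * (c * (φ c)⁻¹ * g) := by ac_rfl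
    _ = φ (c * y) * (c' * g) := by rw [map_mul]

lemma boundary_edgesMap_mapHomotopy {n : ℕ} (g : K) {x : (Fin (n + 2) → K) →₀ k}
    (hx : Finsupp.mapDomain ((homSSetPost ℤ φ).app (op ⦋n + 1⦌)) (edgesMap k (n + 1) x) = 0) :
    boundary k _ (n + 1) (edgesMap k (n + 2) (mapHomotopy k (fun y => φ y * g) (n + 1) x)) =
      -edgesMap k (n + 1) x -
        edgesMap k (n + 1) (mapHomotopy k (fun y => φ y * g) n (tupleBoundary k K n x)) := by
  rw [boundary_edgesMap, tupleBoundary_mapHomotopy, map_sub, map_sub, edgesMap_tupleMap_map_mul,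
    hx, zero_sub]

lemma boundary_kernelHomotopy_liftTuples [Finite φ.toMonoidHom.ker] (hφ : ∀ x, φ (φ x) = φ x)
    {n : ℕ} {u : (homSSet ℤ K) _⦋n + 1⦌ →₀ k} (hu : boundary k _ n u = 0)
    (hφu : Finsupp.mapDomain ((homSSetPost ℤ φ).app (op ⦋n + 1⦌)) u = 0) :
    boundary k _ (n + 1) (kernelHomotopy k φ (n + 1) (liftTuples k (n + 1) u)) =
      -((Nat.card φ.toMonoidHom.ker : k) • u) := by
  have := Fintype.ofFinite φ.toMonoidHom.ker
  have hzero : kernelHomotopy k φ n (tupleBoundary k K n (liftTuples k (n + 1) u)) = 0 := by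
    rw [← apply_liftTuples_edgesMap (kernelHomotopy_tupleMap_mul_left hφ), ← boundary_edgesMap,
      edgesMap_liftTuples, hu, map_zero, map_zero]
  rw [kernelHomotopy_apply] at hzero
  rw [← edgesMap_liftTuples u] at hφu
  simp_rw [kernelHomotopy_apply, map_sum, boundary_edgesMap_mapHomotopy _ hφu]
  rw [Finset.sum_sub_distrib, hzero, edgesMap_liftTuples, Finset.sum_const, Finset.card_univ,
    Nat.card_eq_fintype_card, sub_zero, smul_neg, Nat.cast_smul_eq_nsmul]

lemma exists_boundary_eq_of_idempotent [Finite φ.toMonoidHom.ker] (hφ : ∀ x, φ (φ x) = φ x)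
    (hcard : IsUnit (Nat.card φ.toMonoidHom.ker : k)) {n : ℕ}
    {u : (homSSet ℤ K) _⦋n + 1⦌ →₀ k} (hu : boundary k _ n u = 0)
    (hφu : Finsupp.mapDomain ((homSSetPost ℤ φ).app (op ⦋n + 1⦌)) u = 0) :
    ∃ w, boundary k _ (n + 1) w = u := by
  obtain ⟨d, hd⟩ := hcard
  refine ⟨-((↑d⁻¹ : k) • kernelHomotopy k φ (n + 1) (liftTuples k (n + 1) u)), ?_⟩
  rw [map_neg, map_smul, boundary_kernelHomotopy_liftTuples hφ hu hφu, ← hd, smul_neg, neg_neg,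
    smul_smul, Units.inv_mul, one_smul]

end Transfer

/-! ### Primary parts of commuting tuples -/

section PrimaryPart

variable (l : ℕ)

/-- An exponent that projects a group of exponent `e` to its `l`-primary part. -/
def primaryExp (e : ℕ) : ℕ :=
  if h : (ordProj[l] e).Coprime (ordCompl[l] e) then Nat.chineseRemainder h 1 0 else 1

/-- The `l`-primary part of a torsion element. -/
def primaryPart {G : Type*} [Group G] (h : G) : G := h ^ primaryExp l (orderOf h)

lemma primaryPart_map {G G' : Type*} [Group G] [Group G'] (j : G →* G')
    (hj : Function.Injective j) (h : G) : primaryPart l (j h) = j (primaryPart l h) := by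
  rw [primaryPart, primaryPart, map_pow, orderOf_injective j hj]

variable {l} [hl : Fact l.Prime]

lemma coprime_ordProj_ordCompl {e : ℕ} (he : e ≠ 0) : (ordProj[l] e).Coprime (ordCompl[l] e) :=
  Nat.Coprime.pow_left _ (Nat.coprime_ordCompl hl.out he)

lemma primaryExp_modEq_one {e : ℕ} (he : e ≠ 0) : primaryExp l e ≡ 1 [MOD ordProj[l] e] := by
  rw [primaryExp, dif_pos (coprime_ordProj_ordCompl he)]
  exact (Nat.chineseRemainder _ 1 0).2.1

lemma ordCompl_dvd_primaryExp {e : ℕ} (he : e ≠ 0) : ordCompl[l] e ∣ primaryExp l e := by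
  rw [primaryExp, dif_pos (coprime_ordProj_ordCompl he)]
  exact Nat.modEq_zero_iff_dvd.1 (Nat.chineseRemainder _ 1 0).2.2

lemma primaryExp_modEq {e o : ℕ} (he : e ≠ 0) (ho : o ∣ e) :
    primaryExp l e ≡ primaryExp l o [MOD o] := by
  have ho' : o ≠ 0 := fun h => he (zero_dvd_iff.1 (h ▸ ho))
  have hproj : primaryExp l e ≡ primaryExp l o [MOD ordProj[l] o] :=
    ((primaryExp_modEq_one he).of_dvd (Nat.ordProj_dvd_ordProj_of_dvd he ho l)).trans
      (primaryExp_modEq_one ho').symm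
  have hcompl : primaryExp l e ≡ primaryExp l o [MOD ordCompl[l] o] :=
    (Nat.modEq_zero_iff_dvd.2 ((Nat.ordCompl_dvd_ordCompl_of_dvd ho l).trans
      (ordCompl_dvd_primaryExp he))).trans
      (Nat.modEq_zero_iff_dvd.2 (ordCompl_dvd_primaryExp ho')).symm
  have hmul := (Nat.modEq_and_modEq_iff_modEq_mul (coprime_ordProj_ordCompl ho')).1
    ⟨hproj, hcompl⟩
  rwa [Nat.ordProj_mul_ordCompl_eq_self] at hmul

variable {G : Type*} [Group G]

lemma pow_primaryExp {h : G} {e : ℕ} (he : e ≠ 0) (hh : h ^ e = 1) :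
    h ^ primaryExp l e = primaryPart l h :=
  pow_eq_pow_iff_modEq.2 (primaryExp_modEq he (orderOf_dvd_of_pow_eq_one hh))

lemma primaryPart_of_pow_eq_one {h : G} {a : ℕ} (hh : h ^ l ^ a = 1) : primaryPart l h = h := by
  have hla : l ^ a ≠ 0 := pow_ne_zero _ hl.out.ne_zero
  rw [← pow_primaryExp hla hh]
  conv_rhs => rw [← pow_one h]
  refine pow_eq_pow_iff_modEq.2 (Nat.ModEq.of_dvd (orderOf_dvd_of_pow_eq_one hh) ?_)
  have hmod := primaryExp_modEq_one (l := l) hla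
  rwa [hl.out.factorization_pow, Finsupp.single_eq_same] at hmod

lemma exists_primaryPart_pow_eq_one {h : G} (hh : IsOfFinOrder h) :
    ∃ a, primaryPart l h ^ l ^ a = 1 := by
  refine ⟨(orderOf h).factorization l, ?_⟩
  rw [primaryPart, ← pow_mul]
  refine orderOf_dvd_iff_pow_eq_one.1 ?_
  conv_lhs => rw [← Nat.ordProj_mul_ordCompl_eq_self (orderOf h) l, mul_comm]
  exact Nat.mul_dvd_mul_right (ordCompl_dvd_primaryExp hh.orderOf_pos.ne') _

lemma primaryPart_primaryPart {h : G} (hh : IsOfFinOrder h) :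
    primaryPart l (primaryPart l h) = primaryPart l h := by
  obtain ⟨a, ha⟩ := exists_primaryPart_pow_eq_one (l := l) hh
  exact primaryPart_of_pow_eq_one ha

lemma coprime_card_of_primaryPart_eq_one [Finite G] (h : ∀ x : G, primaryPart l x = 1) :
    (Nat.card G).Coprime l := by
  rw [Nat.coprime_comm, hl.out.coprime_iff_not_dvd]
  intro hdvd
  obtain ⟨x, hx⟩ := exists_prime_orderOf_dvd_card' l hdvd
  have hpow : x ^ l ^ 1 = 1 := by rw [pow_one, ← hx, pow_orderOf_eq_one]
  have hone : x = 1 := (primaryPart_of_pow_eq_one hpow).symm.trans (h x)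
  rw [hone, orderOf_one] at hx
  exact hl.out.one_lt.ne hx

end PrimaryPart

section Torsion

variable {H : Type u} [Group H]

lemma isMulTorsion_of_isLocallyFinite (hH : IsLocallyFinite H) : IsMulTorsion H := by
  obtain ⟨J, _, _, F, ι, hF, ⟨hc⟩⟩ := hH
  intro h
  obtain ⟨j, y, hy⟩ := Types.jointly_surjective_of_isColimit
    (isColimitOfPreserves (forget GrpCat.{u}) hc) h
  have := hF j
  have hfin : IsOfFinOrder ((ι.app j).hom y) :=
    MonoidHom.isOfFinOrder _ (isOfFinOrder_of_finite (y : F.obj j))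
  exact (show (ι.app j).hom y = h from hy) ▸ hfin

lemma finite_range_of_isMulTorsion (hT : IsMulTorsion H) {n : ℕ}
    (ρ : Multiplicative (Fin n → ℤ) →* H) : Finite ρ.range := by
  let _ : CommGroup ρ.range := { (inferInstance : Group ρ.range) with
    mul_comm := fun x y => mul_comm' x y }
  exact CommGroup.finite_of_fg_isMulTorsion _ fun x => (Submonoid.isOfFinOrder_coe).1 (hT x)

lemma exists_forall_pow_eq_one (hT : IsMulTorsion H) {n : ℕ} (ρ : Multiplicative (Fin n → ℤ) →* H) :
    ∃ e ≠ 0, ∀ a, ρ a ^ e = 1 := by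
  have := finite_range_of_isMulTorsion hT ρ
  refine ⟨Nat.card ρ.range, Nat.card_pos.ne', fun a => ?_⟩
  exact congrArg Subtype.val (pow_card_eq_one' (x := (⟨ρ a, a, rfl⟩ : ρ.range)))

variable [TopologicalSpace H] (l : ℕ) [hl : Fact l.Prime] (hT : IsMulTorsion H)

/-- The `l`-primary part of a homomorphism from a lattice to a torsion group. -/
def primaryHom {n : ℕ} (ρ : Multiplicative (Fin n → ℤ) →ₜ* H) :
    Multiplicative (Fin n → ℤ) →ₜ* H where
  toFun a := primaryPart l (ρ a)
  map_one' := by rw [map_one, primaryPart, one_pow]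
  map_mul' a b := by
    obtain ⟨e, he, h⟩ := exists_forall_pow_eq_one hT ρ.toMonoidHom
    replace h : ∀ a, ρ a ^ e = 1 := h
    rw [← pow_primaryExp he (h _), ← pow_primaryExp he (h a), ← pow_primaryExp he (h b), map_mul]
    exact ((Commute.all a b).map ρ.toMonoidHom).mul_pow _
  continuous_toFun := continuous_of_discreteTopology

/-- Taking the `l`-primary part, as a simplicial map. -/
def primaryMap : homSSet ℤ H ⟶ homSSet ℤ H where
  app _ := TypeCat.ofHom fun ρ => primaryHom l hT ρ
  naturality _ _ _ := rfl

end Torsion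

/-! ### The homotopy carried by finite commutative subgroups -/

section ValuedIn

variable {H : Type u} [Group H] [TopologicalSpace H]

/-- A simplex of `homSSet A H`, viewed as a homomorphism. -/
def toHom {A : Type} [AddCommGroup A] [TopologicalSpace A] [IsTopologicalAddGroup A] {n : ℕ}
    (τ : (homSSet A H) _⦋n⦌) : Multiplicative (Fin n → A) →ₜ* H := τ

/-- The simplices of `homSSet ℤ H` with values in a subgroup. -/
def valuedIn (K : Subgroup H) (n : ℕ) : Set ((homSSet ℤ H) _⦋n⦌) :=
  Set.ofPred fun τ => ∀ a, toHom τ a ∈ K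

lemma valuedIn_mono {K K' : Subgroup H} (h : K ≤ K') (n : ℕ) : valuedIn K n ⊆ valuedIn K' n :=
  fun _ hτ a => h (hτ a)

lemma δ_mem_valuedIn {K : Subgroup H} {n : ℕ} {τ : (homSSet ℤ H) _⦋n + 1⦌}
    (h : τ ∈ valuedIn K (n + 1)) (i : Fin (n + 2)) : (homSSet ℤ H).δ i τ ∈ valuedIn K n :=
  fun _ => h _

lemma mem_valuedIn_range {n : ℕ} (τ : (homSSet ℤ H) _⦋n⦌) :
    τ ∈ valuedIn (toHom τ).toMonoidHom.range n := fun a => ⟨a, rfl⟩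

lemma boundary_single_mem_supported {k : Type} [CommRing k] {K : Subgroup H} {n : ℕ}
    {τ : (homSSet ℤ H) _⦋n + 1⦌} (h : τ ∈ valuedIn K (n + 1)) :
    boundary k _ n (Finsupp.single τ 1) ∈ Finsupp.supported k k (valuedIn K n) := by
  rw [boundary_single]
  exact Submodule.sum_mem _ fun i _ => Submodule.smul_mem _ _
    (Finsupp.single_mem_supported k 1 (δ_mem_valuedIn h i))

variable {K : Type u} [Group K] [TopologicalSpace K] {j : K →ₜ* H}

lemma homSSetPost_injective (hj : Function.Injective j) (n : ℕ) :
    Function.Injective ((homSSetPost ℤ j).app (op ⦋n⦌)) := fun σ τ h =>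
  ContinuousMonoidHom.ext fun a => hj (DFunLike.congr_fun (show j.comp (toHom σ) =
    j.comp (toHom τ) from h) a)

lemma range_homSSetPost (hj : Function.Injective j) (n : ℕ) :
    Set.range ((homSSetPost ℤ j).app (op ⦋n⦌)) = valuedIn j.toMonoidHom.range n := by
  refine Set.Subset.antisymm ?_ fun τ hτ => ?_
  · rintro _ ⟨σ, rfl⟩ a
    exact ⟨toHom σ a, rfl⟩
  · let e := MonoidHom.ofInjective (f := j.toMonoidHom) hj
    let σ : Multiplicative (Fin n → ℤ) →ₜ* K :=
      { toMonoidHom := e.symm.toMonoidHom.comp ((toHom τ).toMonoidHom.codRestrict _ hτ)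
        continuous_toFun := continuous_of_discreteTopology }
    refine ⟨σ, ContinuousMonoidHom.ext fun a => ?_⟩
    exact congrArg Subtype.val (e.apply_symm_apply ⟨toHom τ a, hτ a⟩)

end ValuedIn

section PrimaryChains

variable {H : Type u} [Group H] [TopologicalSpace H] (k : Type) [CommRing k] (l : ℕ)
  [Fact l.Prime] (hT : IsMulTorsion H)

/-- The map on chains induced by `primaryMap`. -/
def primaryChainMap (n : ℕ) :
    ((homSSet ℤ H) _⦋n⦌ →₀ k) →ₗ[k] ((homSSet ℤ H) _⦋n⦌ →₀ k) :=
  Finsupp.lmapDomain k k ((primaryMap l hT).app (op ⦋n⦌))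

variable {k l}

lemma boundary_primaryChainMap {n : ℕ} (x : (homSSet ℤ H) _⦋n + 1⦌ →₀ k) :
    boundary k _ n (primaryChainMap k l hT (n + 1) x) =
      primaryChainMap k l hT n (boundary k _ n x) :=
  boundary_mapDomain (primaryMap l hT) n x

lemma primaryChainMap_primaryChainMap {n : ℕ} (x : (homSSet ℤ H) _⦋n⦌ →₀ k) :
    primaryChainMap k l hT n (primaryChainMap k l hT n x) = primaryChainMap k l hT n x := by
  refine Finsupp.mapDomain_comp.symm.trans (congrArg (fun f => Finsupp.mapDomain f x) ?_)
  exact funext fun τ => ContinuousMonoidHom.ext fun _ => primaryPart_primaryPart (hT _)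

lemma primaryChainMap_mem_supported {K : Subgroup H} {n : ℕ} {x : (homSSet ℤ H) _⦋n⦌ →₀ k}
    (h : x ∈ Finsupp.supported k k (valuedIn K n)) :
    primaryChainMap k l hT n x ∈ Finsupp.supported k k (valuedIn K n) := by
  classical
  intro τ hτ
  obtain ⟨σ, hσ, rfl⟩ := Finset.mem_image.1 (Finsupp.mapDomain_support hτ)
  exact fun a => K.pow_mem (h hσ a) _

lemma primaryChainMap_zero_apply (x : (homSSet ℤ H) _⦋0⦌ →₀ k) :
    primaryChainMap k l hT 0 x = x := by
  refine (congrArg (fun f => Finsupp.mapDomain f x) (funext fun τ => ?_)).trans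
    Finsupp.mapDomain_id
  refine ContinuousMonoidHom.ext fun a => ?_
  have ha : a = 1 := Multiplicative.toAdd.injective (funext fun i => i.elim0)
  rw [ha]
  exact (map_one (toHom ((primaryMap l hT).app (op ⦋0⦌) τ))).trans (map_one (toHom τ)).symm

end PrimaryChains

section PrimaryEnd

variable (l : ℕ) (K : Type u) [CommGroup K] [TopologicalSpace K] [DiscreteTopology K]

/-- The projection of a finite commutative group to its `l`-primary part. -/
def primaryEnd : K →ₜ* K where
  toMonoidHom := powMonoidHom (primaryExp l (Nat.card K))
  continuous_toFun := continuous_of_discreteTopology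

variable {l K} [hl : Fact l.Prime] [Finite K]

lemma primaryEnd_apply (x : K) : primaryEnd l K x = primaryPart l x :=
  pow_primaryExp Nat.card_pos.ne' pow_card_eq_one'

lemma primaryEnd_primaryEnd (x : K) :
    primaryEnd l K (primaryEnd l K x) = primaryEnd l K x := by
  rw [primaryEnd_apply, primaryEnd_apply, primaryPart_primaryPart (isOfFinOrder_of_finite x)]

lemma isUnit_card_ker_primaryEnd :
    IsUnit (Nat.card (primaryEnd l K).toMonoidHom.ker : ZMod l) := by
  rw [ZMod.isUnit_iff_coprime]
  refine coprime_card_of_primaryPart_eq_one fun x => Subtype.ext ?_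
  have hmap := primaryPart_map l (primaryEnd l K).toMonoidHom.ker.subtype Subtype.val_injective x
  exact hmap.symm.trans ((primaryEnd_apply _).symm.trans x.2)

lemma homSSetPost_comp_primaryMap {H : Type u} [Group H] [TopologicalSpace H]
    (hT : IsMulTorsion H) {j : K →ₜ* H} (hj : Function.Injective j) :
    homSSetPost ℤ j ≫ primaryMap l hT = homSSetPost ℤ (primaryEnd l K) ≫ homSSetPost ℤ j := by
  ext Δ σ
  refine ContinuousMonoidHom.ext fun a => ?_
  exact (primaryPart_map l j.toMonoidHom hj (toHom σ a)).trans
    (congrArg j (primaryEnd_apply _).symm)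

end PrimaryEnd

section Carriers

variable {H : Type u} [Group H] [TopologicalSpace H] {l : ℕ} [Fact l.Prime] (hT : IsMulTorsion H)

lemma exists_boundary_eq_of_finite {K : Type u} [CommGroup K] [TopologicalSpace K]
    [DiscreteTopology K] [Finite K] {j : K →ₜ* H} (hj : Function.Injective j) {n : ℕ}
    {u : (homSSet ℤ H) _⦋n + 1⦌ →₀ ZMod l}
    (hs : u ∈ Finsupp.supported _ (ZMod l) (valuedIn j.toMonoidHom.range (n + 1)))
    (hu : boundary _ _ n u = 0) (hpu : primaryChainMap (ZMod l) l hT (n + 1) u = 0) :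
    ∃ w ∈ Finsupp.supported _ (ZMod l) (valuedIn j.toMonoidHom.range (n + 2)),
      boundary _ _ (n + 1) w = u := by
  rw [← range_homSSetPost hj, mapDomain_mem_supported_iff (homSSetPost_injective hj _)] at hs
  obtain ⟨u', rfl⟩ := hs
  have hu' : boundary _ _ n u' = 0 := by
    refine Finsupp.mapDomain_injective (homSSetPost_injective hj n) ?_
    rw [← boundary_mapDomain, hu, Finsupp.mapDomain_zero]
  have hpu' :
      Finsupp.mapDomain ((homSSetPost ℤ (primaryEnd l K)).app (op ⦋n + 1⦌)) u' = 0 := by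
    refine Finsupp.mapDomain_injective (homSSetPost_injective hj (n + 1)) ?_
    rw [Finsupp.mapDomain_zero, ← hpu, ← Finsupp.mapDomain_comp]
    refine Eq.trans ?_ Finsupp.mapDomain_comp
    exact congrArg (fun f => Finsupp.mapDomain f u') (funext fun σ => (ConcreteCategory.congr_hom
      (congr_app (homSSetPost_comp_primaryMap hT hj) (op ⦋n + 1⦌)) σ).symm)
  obtain ⟨w', hw'⟩ := exists_boundary_eq_of_idempotent primaryEnd_primaryEnd
    isUnit_card_ker_primaryEnd hu' hpu'
  refine ⟨Finsupp.mapDomain ((homSSetPost ℤ j).app (op ⦋n + 2⦌)) w', ?_, ?_⟩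
  · rw [← range_homSSetPost hj]
    exact (mapDomain_mem_supported_iff (homSSetPost_injective hj _) _).2 ⟨w', rfl⟩
  · rw [boundary_mapDomain, hw']

/-- The inductive property of a homotopy, on `n`-cycles, between the identity and the `l`-primary
part, carried by the subgroups of `H`. The condition `primaryChainMap_apply` makes it possible to
fill the cycles that arise in degree `n + 1`. -/
structure IsCarriedHomotopy (n : ℕ)
    (h : ((homSSet ℤ H) _⦋n⦌ →₀ ZMod l) →ₗ[ZMod l] ((homSSet ℤ H) _⦋n + 1⦌ →₀ ZMod l)) :
    Prop where
  mem_supported (K : Subgroup H) {x : (homSSet ℤ H) _⦋n⦌ →₀ ZMod l} :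
    x ∈ Finsupp.supported _ (ZMod l) (valuedIn K n) →
      h x ∈ Finsupp.supported _ (ZMod l) (valuedIn K (n + 1))
  primaryChainMap_apply (x : (homSSet ℤ H) _⦋n⦌ →₀ ZMod l) :
    primaryChainMap (ZMod l) l hT (n + 1) (h x) = 0
  boundary_apply {z : (homSSet ℤ H) _⦋n⦌ →₀ ZMod l} : IsCycle (ZMod l) z →
    boundary _ _ n (h z) = z - primaryChainMap (ZMod l) l hT n z

variable {hT} in
lemma isCarriedHomotopy_zero : IsCarriedHomotopy (l := l) hT 0 0 where
  mem_supported _ _ _ := Submodule.zero_mem _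
  primaryChainMap_apply _ := map_zero _
  boundary_apply {z} _ := by
    rw [primaryChainMap_zero_apply, sub_self]
    exact map_zero _

variable [DiscreteTopology H]

lemma exists_boundary_eq_of_range {m : ℕ} (ρ : Multiplicative (Fin m → ℤ) →* H)
    {n : ℕ} {u : (homSSet ℤ H) _⦋n + 1⦌ →₀ ZMod l}
    (hs : u ∈ Finsupp.supported _ (ZMod l) (valuedIn ρ.range (n + 1)))
    (hu : boundary _ _ n u = 0) (hpu : primaryChainMap (ZMod l) l hT (n + 1) u = 0) :
    ∃ w ∈ Finsupp.supported _ (ZMod l) (valuedIn ρ.range (n + 2)), boundary _ _ (n + 1) w = u := by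
  let _ : CommGroup ρ.range := { (inferInstance : Group ρ.range) with
    mul_comm := fun x y => mul_comm' x y }
  have := finite_range_of_isMulTorsion hT ρ
  let j : ρ.range →ₜ* H :=
    { toMonoidHom := ρ.range.subtype
      continuous_toFun := continuous_of_discreteTopology }
  have hj : j.toMonoidHom.range = ρ.range := ρ.range.range_subtype
  have hfinite := exists_boundary_eq_of_finite hT (j := j) Subtype.val_injective (n := n) (u := u)
  rw [hj] at hfinite
  exact hfinite hs hu hpu

variable {hT}

namespace IsCarriedHomotopy

variable {n : ℕ}
  {h : ((homSSet ℤ H) _⦋n⦌ →₀ ZMod l) →ₗ[ZMod l] ((homSSet ℤ H) _⦋n + 1⦌ →₀ ZMod l)}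

lemma exists_filling (hh : IsCarriedHomotopy hT n h) (ρ : (homSSet ℤ H) _⦋n + 1⦌) :
    ∃ w ∈ Finsupp.supported _ (ZMod l) (valuedIn (toHom ρ).toMonoidHom.range (n + 2)),
      boundary _ _ (n + 1) w = Finsupp.single ρ 1 -
        primaryChainMap (ZMod l) l hT (n + 1) (Finsupp.single ρ 1) -
          h (boundary _ _ n (Finsupp.single ρ 1)) := by
  have hρ := Finsupp.single_mem_supported (ZMod l) (1 : ZMod l) (mem_valuedIn_range ρ)
  refine exists_boundary_eq_of_range hT _ ?_ ?_ ?_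
  · exact Submodule.sub_mem _ (Submodule.sub_mem _ hρ (primaryChainMap_mem_supported hT hρ))
      (hh.mem_supported _ (boundary_single_mem_supported (mem_valuedIn_range ρ)))
  · rw [map_sub, map_sub, hh.boundary_apply (isCycle_boundary _), boundary_primaryChainMap,
      sub_self]
  · rw [map_sub, map_sub, primaryChainMap_primaryChainMap, sub_self, hh.primaryChainMap_apply,
      sub_zero]

lemma exists_succ (hh : IsCarriedHomotopy hT n h) :
    ∃ h', IsCarriedHomotopy (l := l) hT (n + 1) h' := by
  choose w hw hdw using hh.exists_filling
  let P (m : ℕ) := primaryChainMap (ZMod l) l hT m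
  have hP {m : ℕ} (x) : P m (P m x) = P m x := primaryChainMap_primaryChainMap hT x
  have hdP (x) : boundary _ _ (n + 1) (P (n + 2) x) = P (n + 1) (boundary _ _ (n + 1) x) :=
    boundary_primaryChainMap hT x
  let h' : ((homSSet ℤ H) _⦋n + 1⦌ →₀ ZMod l) →ₗ[ZMod l] ((homSSet ℤ H) _⦋n + 2⦌ →₀ ZMod l) :=
    Finsupp.linearCombination (ZMod l) fun ρ => w ρ - P (n + 2) (w ρ)
  have hprimary : P (n + 2) ∘ₗ h' = 0 := Finsupp.lhom_ext' fun ρ => LinearMap.ext_ring <| by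
    simp only [LinearMap.comp_apply, Finsupp.lsingle_apply, h', Finsupp.linearCombination_single,
      one_smul, map_sub, hP, sub_self, LinearMap.zero_apply]
  have hboundary : boundary _ _ (n + 1) ∘ₗ h' =
      LinearMap.id - P (n + 1) - h ∘ₗ boundary _ _ n :=
    Finsupp.lhom_ext' fun ρ => LinearMap.ext_ring <| by
      simp only [LinearMap.comp_apply, Finsupp.lsingle_apply, h',
        Finsupp.linearCombination_single, one_smul, LinearMap.sub_apply, LinearMap.id_apply]
      rw [map_sub, hdP, hdw, map_sub, map_sub, hP, sub_self, zero_sub,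
        show P (n + 1) (h _) = 0 from hh.primaryChainMap_apply _, neg_zero, sub_zero]
  refine ⟨h', fun K x hx => ?_, fun x => LinearMap.congr_fun hprimary x, fun {z} hz => ?_⟩
  · refine Submodule.sum_mem _ fun ρ hρ => Submodule.smul_mem _ _ ?_
    have hρK : (toHom ρ).toMonoidHom.range ≤ K := by
      rintro _ ⟨a, rfl⟩
      exact hx hρ a
    have hwK := Finsupp.supported_mono (valuedIn_mono hρK (n + 2)) (hw ρ)
    exact Submodule.sub_mem _ hwK (primaryChainMap_mem_supported hT hwK)
  · refine (LinearMap.congr_fun hboundary z).trans ?_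
    simp only [LinearMap.comp_apply, LinearMap.sub_apply, LinearMap.id_apply]
    rw [show boundary _ _ n z = 0 from hz, map_zero, sub_zero]

end IsCarriedHomotopy

lemma exists_isCarriedHomotopy (hT : IsMulTorsion H) (n : ℕ) :
    ∃ h, IsCarriedHomotopy (l := l) hT n h := by
  induction n with
  | zero => exact ⟨0, isCarriedHomotopy_zero⟩
  | succ n ih =>
    obtain ⟨h, hh⟩ := ih
    exact hh.exists_succ

end Carriers

/-! ### The retraction to homomorphisms from powers of `ℤ_l` -/

section Completion

open Filter Topology

variable {H : Type u} [Group H] [TopologicalSpace H]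

lemma map_ofAdd_eq_of_intCast_eq {n q : ℕ} {τ : Multiplicative (Fin n → ℤ) →ₜ* H}
    (hτ : ∀ a, τ a ^ q = 1) {a b : Fin n → ℤ} (hab : ∀ i, (a i : ZMod q) = b i) :
    τ (Multiplicative.ofAdd a) = τ (Multiplicative.ofAdd b) := by
  have hdvd (i) : ∃ c : ℤ, a i = b i + q * c := by
    obtain ⟨c, hc⟩ := (ZMod.intCast_eq_intCast_iff_dvd_sub _ _ _).1 (hab i).symm
    exact ⟨c, by rw [← hc]; ring⟩
  choose c hc using hdvd
  have hmul : Multiplicative.ofAdd a = Multiplicative.ofAdd b * Multiplicative.ofAdd c ^ q := by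
    refine Multiplicative.toAdd.injective (funext fun i => ?_)
    simpa using hc i
  rw [hmul, map_mul, map_pow, hτ, mul_one]

variable {l : ℕ} [hl : Fact l.Prime]

lemma continuous_toZModPow (N : ℕ) :
    @Continuous ℤ_[l] (ZMod (l ^ N)) _ ⊥ (PadicInt.toZModPow N) := by
  let _ : TopologicalSpace (ZMod (l ^ N)) := ⊥
  have _ : DiscreteTopology (ZMod (l ^ N)) := ⟨rfl⟩
  refine continuous_iff_continuousAt.2 fun x => ?_
  rw [ContinuousAt, nhds_discrete (ZMod (l ^ N)), tendsto_pure]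
  have hpos : (0 : ℝ) < (l : ℝ) ^ (-N : ℤ) := zpow_pos (Nat.cast_pos.2 hl.out.pos) _
  filter_upwards [Metric.closedBall_mem_nhds x hpos] with y hy
  rwa [Metric.mem_closedBall, dist_eq_norm, PadicInt.norm_le_pow_iff_mem_span_pow,
    ← PadicInt.ker_toZModPow, RingHom.mem_ker, map_sub, sub_eq_zero] at hy

lemma mem_range_homSSetMap {n N : ℕ} (τ : (homSSet ℤ H) _⦋n⦌) (hτ : ∀ a, toHom τ a ^ l ^ N = 1) :
    τ ∈ Set.range ((homSSetMap (completionMap l) H).app (op ⦋n⦌)) := by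
  let _ : TopologicalSpace (ZMod (l ^ N)) := ⊥
  have _ : DiscreteTopology (ZMod (l ^ N)) := ⟨rfl⟩
  have _ : NeZero (l ^ N) := ⟨pow_ne_zero _ hl.out.ne_zero⟩
  let residue (x : Fin n → ℤ_[l]) (i : Fin n) : ℤ := (PadicInt.toZModPow N (x i)).val
  have hresidue (x i) : (residue x i : ZMod (l ^ N)) = PadicInt.toZModPow N (x i) := by
    simp [residue]
  let σ : Multiplicative (Fin n → ℤ_[l]) →ₜ* H :=
    { toFun := fun x => toHom τ (Multiplicative.ofAdd (residue x.toAdd))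
      map_one' := by
        refine (map_ofAdd_eq_of_intCast_eq hτ (b := 0) fun i => ?_).trans (map_one (toHom τ))
        rw [hresidue]
        simp
      map_mul' := fun x y => by
        rw [← map_mul]
        refine map_ofAdd_eq_of_intCast_eq hτ (b := residue x.toAdd + residue y.toAdd) fun i => ?_
        rw [hresidue, Pi.add_apply, Int.cast_add, hresidue, hresidue]
        exact map_add _ _ _
      continuous_toFun := (continuous_of_discreteTopology (f := fun y : Fin n → ZMod (l ^ N) =>
        toHom τ (Multiplicative.ofAdd fun i => ((y i).val : ℤ)))).comp
          (continuous_pi fun i => (continuous_toZModPow N).comp (continuous_apply i)) }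
  refine ⟨σ, ContinuousMonoidHom.ext fun a => ?_⟩
  refine map_ofAdd_eq_of_intCast_eq hτ (b := a.toAdd) fun i => (hresidue _ i).trans ?_
  exact map_intCast (PadicInt.toZModPow (p := l) N) _

lemma primaryMap_mem_range (hT : IsMulTorsion H) {n : ℕ} (τ : (homSSet ℤ H) _⦋n⦌) :
    (primaryMap l hT).app (op ⦋n⦌) τ ∈
      Set.range ((homSSetMap (completionMap l) H).app (op ⦋n⦌)) := by
  obtain ⟨e, he, h⟩ := exists_forall_pow_eq_one hT (toHom τ).toMonoidHom
  replace h : ∀ a, toHom τ a ^ e = 1 := h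
  refine mem_range_homSSetMap (N := e.factorization l) _ fun a => ?_
  change primaryPart l (toHom τ a) ^ _ = 1
  rw [← pow_primaryExp he (h a), ← pow_mul]
  obtain ⟨c, hc⟩ := ordCompl_dvd_primaryExp (l := l) he
  rw [hc, mul_comm, ← mul_assoc, Nat.ordProj_mul_ordCompl_eq_self, pow_mul, h, one_pow]

lemma exists_pow_eq_one [DiscreteTopology H] {n : ℕ} (σ : Multiplicative (Fin n → ℤ_[l]) →ₜ* H)
    (x : Multiplicative (Fin n → ℤ_[l])) : ∃ N, σ x ^ l ^ N = 1 := by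
  have hlim : Tendsto (fun N => Multiplicative.ofAdd ((l : ℤ_[l]) ^ N • x.toAdd)) atTop
      (𝓝 1) := by
    have hlt : ‖(l : ℤ_[l])‖ < 1 := by
      rw [PadicInt.norm_p]
      exact inv_lt_one_of_one_lt₀ (Nat.one_lt_cast.2 hl.out.one_lt)
    have h := (tendsto_pow_atTop_nhds_zero_of_norm_lt_one hlt).smul_const x.toAdd
    rwa [zero_smul] at h
  have hσ := ((map_continuous σ).tendsto 1).comp hlim
  rw [map_one, nhds_discrete, tendsto_pure] at hσ
  obtain ⟨N, hN⟩ := hσ.exists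
  refine ⟨N, Eq.trans ?_ hN⟩
  rw [← map_pow]
  refine congrArg σ (Multiplicative.toAdd.injective (funext fun i => ?_))
  simp

lemma homSSetMap_comp_primaryMap [DiscreteTopology H] (hT : IsMulTorsion H) :
    homSSetMap (completionMap l) H ≫ primaryMap l hT = homSSetMap (completionMap l) H := by
  ext Δ σ
  refine ContinuousMonoidHom.ext fun a => ?_
  obtain ⟨N, hN⟩ := exists_pow_eq_one (n := Δ.unop.len) σ (coordHom (completionMap l) _ a)
  exact primaryPart_of_pow_eq_one hN

lemma homSSetMap_completionMap_injective [T2Space H] (n : ℕ) :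
    Function.Injective ((homSSetMap (completionMap l) H).app (op ⦋n⦌)) := by
  intro σ τ h
  have hdense : DenseRange (coordHom (completionMap l) n) :=
    DenseRange.piMap (fun _ => PadicInt.denseRange_intCast)
  have hcomp : toHom σ ∘ coordHom (completionMap l) n = toHom τ ∘ coordHom (completionMap l) n :=
    congrArg (fun ρ => ⇑(toHom ρ)) h
  exact ContinuousMonoidHom.ext (congrFun (hdense.equalizer (map_continuous (toHom σ))
    (map_continuous (toHom τ)) hcomp))

instance mono_homSSetMap_completionMap [T2Space H] : Mono (homSSetMap (completionMap l) H) := by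
  have (Δ : SimplexCategoryᵒᵖ) : Mono ((homSSetMap (completionMap l) H).app Δ) :=
    (mono_iff_injective _).2 (homSSetMap_completionMap_injective Δ.unop.len)
  exact NatTrans.mono_of_mono_app _

lemma exists_retraction (l : ℕ) [Fact l.Prime] [DiscreteTopology H] (hT : IsMulTorsion H) :
    ∃ r : homSSet ℤ H ⟶ homSSet ℤ_[l] H,
      homSSetMap (completionMap l) H ≫ r = 𝟙 _ ∧
        r ≫ homSSetMap (completionMap l) H = primaryMap l hT := by
  let i := homSSetMap (completionMap l) H
  have hrange : SSet.Subcomplex.range (primaryMap l hT) ≤ SSet.Subcomplex.range i := by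
    rintro Δ _ ⟨τ, rfl⟩
    exact primaryMap_mem_range hT (n := Δ.unop.len) τ
  let r := SSet.Subcomplex.lift (primaryMap l hT) hrange ≫ inv (SSet.Subcomplex.toRange i)
  have hr : r ≫ i = primaryMap l hT := by
    have hinv : inv (SSet.Subcomplex.toRange i) ≫ i = (SSet.Subcomplex.range i).ι := by
      rw [IsIso.inv_comp_eq, SSet.Subcomplex.toRange_ι]
    rw [Category.assoc, hinv, SSet.Subcomplex.lift_ι]
  refine ⟨r, (cancel_mono i).1 ?_, hr⟩
  rw [Category.assoc, hr, homSSetMap_comp_primaryMap, Category.id_comp]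

end Completion

end CommClassifying

end

theorem proposition4p3_general (l : ℕ) [Fact l.Prime] (H : Type u) [Group H] [TopologicalSpace H]
    [DiscreteTopology H] (hT : IsMulTorsion H) :
    CommClassifying.IsModEquivalence l
      (CommClassifying.BMap (CommClassifying.completionMap l) H) := by
  obtain ⟨r, hr, hprimary⟩ := CommClassifying.exists_retraction l hT
  refine (CommClassifying.isHomologyIso_iff_isIso _).1
    (CommClassifying.isHomologyIso_toTop_of_retraction _ r hr fun n y hy => ?_)
  obtain ⟨h, hh⟩ := CommClassifying.exists_isCarriedHomotopy (l := l) hT n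
  rw [hprimary]
  exact ⟨h y, hh.boundary_apply hy⟩

theorem proposition4p3 (l : ℕ) [Fact l.Prime] (H : Type u) [Group H] [TopologicalSpace H]
    [DiscreteTopology H] (hH : CommClassifying.IsLocallyFinite H) :
    CommClassifying.IsModEquivalence l
      (CommClassifying.BMap (CommClassifying.completionMap l) H) :=
  proposition4p3_general l H (CommClassifying.isMulTorsion_of_isLocallyFinite hH)
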